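/- There is a deterministic algorithm and an absolute constant $C>0$ such that the following holds. Given integers $n\ge 2$, $k\ge 1$ and a rational number $0<\epsilon<1/2^k$, the algorithm runs in (bit-)time polynomial in $n$, $1/\epsilon$ and the length of the binary encoding of $\epsilon$, and outputs a nonempty finite multiset $S$ of vectors in $\{0,1\}^n$ of size (counted with multiplicity) $$|S|\le C\cdot\frac{k^3\log n}{2^k\epsilon^3}$$ that is an $\epsilon$-almost $k$-wise independent set in the $L_\infty$-norm, that is, for all $1\le i_1<\cdots<i_k\le n$ and all $\xi\in\{0,1\}^k$, $$\left|\Pr_{s\in S}\left[s_{i_1}=\xi_1,\ldots,s_{i_k}=\xi_k\right]-\frac1{2^k}\right|\le\epsilon ,$$ where $s$ is uniformly distributed on $S$ (each vector weighted by its multiplicity). -/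

import Mathlib

/-! ### Almost `k`-wise independence -/

/-- The distribution `Q_I` of `(s_{i₁}, …, s_{iₖ})` for `s ∼ Q`, where `I = (i₁ < ⋯ < iₖ)`. -/
noncomputable def restrictPMF {n k : ℕ} (Q : PMF (Fin n → Bool)) (I : Fin k ↪o Fin n) :
    PMF (Fin k → Bool) :=
  Q.map fun s j => s (I j)

/-- The distance in the `L_∞`-norm between two distributions on a finite set. -/
noncomputable def linftyDist {α : Type*} [Fintype α] (D Q : PMF α) : ℝ :=
  ⨆ a : α, |(D a).toReal - (Q a).toReal|

/-- `Q` is `ε`-almost `k`-wise independent in the `L_∞`-norm. -/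
def AlmostKWiseIndep {n : ℕ} (ε : ℝ) (k : ℕ) (Q : PMF (Fin n → Bool)) : Prop :=
  ∀ I : Fin k ↪o Fin n,
    linftyDist (restrictPMF Q I) (restrictPMF (PMF.uniformOfFintype (Fin n → Bool)) I) ≤ ε

/-- The (finite, nonempty) multiset `S` of elements of `{0,1}^n` is an `ε`-almost `k`-wise
independent set in the `L_∞`-norm: the uniform distribution on `S` (each element weighted by its
multiplicity) is `ε`-almost `k`-wise independent in the `L_∞`-norm. -/
def IsAlmostKWiseIndepSet {n : ℕ} (ε : ℝ) (k : ℕ) (S : Multiset (Fin n → Bool)) : Prop :=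
  ∃ hS : S ≠ 0, AlmostKWiseIndep ε k (PMF.ofMultiset S hS)

/-! ### Machine model: a random access machine with structured control and bit-cost

The memory consists of variables `x₀, x₁, …` and of arrays `A₀, A₁, …`, all holding natural
numbers; a program is a fixed finite text, so it mentions only finitely many of them by name. Each
step is charged at least the number of bits of all the numbers it handles, addresses included
(products and quotients are charged schoolbook time), so that polynomial time here is polynomial
time on a Turing machine. -/

namespace RAM

/-- The contents of the memory. -/
@[ext] structure State where
  /-- the variables -/
  var : ℕ → ℕ
  /-- the arrays: `arr A i` is the content of cell `i` of array `A` -/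
  arr : ℕ → ℕ → ℕ

/-- The arithmetic operations: `sub` is truncated at zero, `div` is integer division. -/
inductive Op
  | add | sub | mul | div | mod

/-- The value of an operation. -/
def Op.apply : Op → ℕ → ℕ → ℕ
  | .add, a, b => a + b
  | .sub, a, b => a - b
  | .mul, a, b => a * b
  | .div, a, b => a / b
  | .mod, a, b => a % b

/-- Expressions: constants, variables, array cells, operations. -/
inductive Expr
  | lit (c : ℕ)
  | var (x : ℕ)
  | get (A : ℕ) (i : Expr)
  | op (o : Op) (e₁ e₂ : Expr)

/-- The value of an expression. -/
def Expr.val (s : State) : Expr → ℕ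
  | .lit c => c
  | .var x => s.var x
  | .get A i => s.arr A (i.val s)
  | .op o e₁ e₂ => o.apply (e₁.val s) (e₂.val s)

/-- The bit-cost of evaluating an expression (`Nat.size` is the number of binary digits). -/
def Expr.cost (s : State) : Expr → ℕ
  | .lit c => c.size + 1
  | .var x => (s.var x).size + 1
  | .get A i => i.cost s + (i.val s).size + (s.arr A (i.val s)).size + 1
  | .op _ e₁ e₂ => e₁.cost s + e₂.cost s + ((e₁.val s).size + 1) * ((e₂.val s).size + 1)

/-- Programs: `x := e`, `A[i] := e`, sequencing, `if e ≠ 0 then c₁ else c₂`,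
`while e ≠ 0 do c`. -/
inductive Prog
  | skip
  | assign (x : ℕ) (e : Expr)
  | store (A : ℕ) (i e : Expr)
  | seq (c₁ c₂ : Prog)
  | cond (e : Expr) (c₁ c₂ : Prog)
  | loop (e : Expr) (c : Prog)

/-- The memory after `x := v`. -/
def State.setVar (s : State) (x v : ℕ) : State :=
  { s with var := Function.update s.var x v }

/-- The memory after `A[i] := v`. -/
def State.setArr (s : State) (A i v : ℕ) : State :=
  { s with arr := Function.update s.arr A (Function.update (s.arr A) i v) }

/-- `Runs c s t s'`: started in memory `s`, the program `c` halts in memory `s'` after time `t`. -/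
inductive Runs : Prog → State → ℕ → State → Prop
  | skip (s : State) : Runs .skip s 1 s
  | assign (s : State) (x : ℕ) (e : Expr) :
      Runs (.assign x e) s (e.cost s + (e.val s).size + 1) (s.setVar x (e.val s))
  | store (s : State) (A : ℕ) (i e : Expr) :
      Runs (.store A i e) s (i.cost s + e.cost s + (i.val s).size + (e.val s).size + 1)
        (s.setArr A (i.val s) (e.val s))
  | seq {c₁ c₂ : Prog} {s s' s'' : State} {t₁ t₂ : ℕ} (h₁ : Runs c₁ s t₁ s')
      (h₂ : Runs c₂ s' t₂ s'') : Runs (.seq c₁ c₂) s (t₁ + t₂) s''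
  | cond_true {e : Expr} {c₁ c₂ : Prog} {s s' : State} {t : ℕ} (he : e.val s ≠ 0)
      (h : Runs c₁ s t s') : Runs (.cond e c₁ c₂) s (e.cost s + 1 + t) s'
  | cond_false {e : Expr} {c₁ c₂ : Prog} {s s' : State} {t : ℕ} (he : e.val s = 0)
      (h : Runs c₂ s t s') : Runs (.cond e c₁ c₂) s (e.cost s + 1 + t) s'
  | loop_stop {e : Expr} {c : Prog} {s : State} (he : e.val s = 0) :
      Runs (.loop e c) s (e.cost s + 1) s
  | loop_step {e : Expr} {c : Prog} {s s' s'' : State} {t₁ t₂ : ℕ} (he : e.val s ≠ 0)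
      (h₁ : Runs c s t₁ s') (h₂ : Runs (.loop e c) s' t₂ s'') :
      Runs (.loop e c) s (e.cost s + 1 + t₁ + t₂) s''

/-- The initial memory on the input `l`: the numbers of `l` are in the first variables, everything
else is zero. -/
def State.init (l : List ℕ) : State where
  var x := l.getD x 0
  arr _ _ := 0

/-- The memory `s` presents the list `L` of vectors of `{0,1}^n` as the output: `x₀` is the length
of `L`, and `A₀` holds the `0/1` entries of the vectors one after the other. -/
def State.Outputs (s : State) {n : ℕ} (L : List (Fin n → Bool)) : Prop :=
  s.var 0 = L.length ∧
    ∀ (j : Fin L.length) (i : Fin n), s.arr 0 (j * n + i) = (L.get j i).toNat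

end RAM

/-! Write `R = n.size`, which is about `log n`, and `M = ⌈1/ε⌉`, so that `2 ^ k < M`. Two classical
constructions with error at most `1/M` are combined; which of them meets the size bound in
polynomial time depends on whether `R * 2 ^ k ≤ k ^ 3 * M`.

If this holds, a small-bias space is used. A sample point is a pair `(a, y)` of elements of GF(2^r),
and bit `i` is the inner product of `y` with `p_i(a)`, where the coefficients of `p_i` are the
digits of the powers `i ^ 0, …, i ^ (k - 1)` in GF(2^R). By a Vandermonde argument a nonempty sum of
at most `k` of the `p_i` is a nonzero polynomial, so it has few roots
(`card_bchEval_sum_eq_zero_le`), and Fourier expansion turns this into the `L_∞` bound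
(`abs_card_sub_le_of_bias`). The size is of order `M² (R + k)²`, which the case assumption makes
small enough (`biasSize_le`).

Otherwise `k ^ 3 < R`, and the positions are first hashed into GF(2^d) by evaluating polynomials at
a random `a`. Any `k` positions stay distinct except for a fraction at most `1/(2M)` of the `a`
(`card_not_injective_digitEval_le`). On the hashed positions, order `k d M² / 2 ^ k` points of an
exactly `k`-wise independent space suffice. They are found greedily: every event (a pattern at `k`
positions) carries a multiplicative weight for each direction of deviation, and the average of the
update factor over the exact space is 1, so some point keeps the total weight from growing, up to
rounding (`choice_lt_and_potential_le`). A bounded final weight means a bounded deviation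
(`abs_card_choice_sub_le`). The search is polynomial because the exact space has at most `(2n) ^ 8`
points in this case (`pow_hashDeg_le`).

For the running time, `Comp` is a class of functions computed by programs in time polynomial in the
magnitudes of their arguments, closed under composition, bounded recursion and bounded search.
Magnitudes are affordable since `n`, `k` and `M` are polynomial in `n` and `1/ε`. Only the
computation of `M` from the numerator and denominator of `ε` has to be polynomial in binary lengths.
-/

namespace RAM

/-! ### Total correctness triples with a time bound -/

/-- Started in `s`, the program `c` halts within time `T` in a memory satisfying `Q`. -/
def Tri (c : Prog) (s : State) (T : ℕ) (Q : State → Prop) : Prop :=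
  ∃ t s', Runs c s t s' ∧ t ≤ T ∧ Q s'

theorem Tri.mono {c : Prog} {s : State} {T T' : ℕ} {Q Q' : State → Prop} (h : Tri c s T Q)
    (hT : T ≤ T') (hQ : ∀ s', Q s' → Q' s') : Tri c s T' Q' := by
  obtain ⟨t, s', hr, ht, hq⟩ := h
  exact ⟨t, s', hr, ht.trans hT, hQ _ hq⟩

theorem Tri.seq {c₁ c₂ : Prog} {s : State} {T₁ T₂ : ℕ} {Q Q' : State → Prop}
    (h₁ : Tri c₁ s T₁ Q) (h₂ : ∀ s', Q s' → Tri c₂ s' T₂ Q') : Tri (.seq c₁ c₂) s (T₁ + T₂) Q' := by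
  obtain ⟨t, s', hr, ht, hq⟩ := h₁
  obtain ⟨t', s'', hr', ht', hq'⟩ := h₂ s' hq
  exact ⟨t + t', s'', .seq hr hr', by omega, hq'⟩

theorem Tri.assign {x : ℕ} {e : Expr} {s : State} {T : ℕ} {Q : State → Prop}
    (hT : e.cost s + (e.val s).size + 1 ≤ T) (hQ : Q (s.setVar x (e.val s))) :
    Tri (.assign x e) s T Q :=
  ⟨_, _, .assign s x e, hT, hQ⟩

theorem Tri.store {A : ℕ} {i e : Expr} {s : State} {T : ℕ} {Q : State → Prop}
    (hT : i.cost s + e.cost s + (i.val s).size + (e.val s).size + 1 ≤ T)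
    (hQ : Q (s.setArr A (i.val s) (e.val s))) :
    Tri (.store A i e) s T Q :=
  ⟨_, _, .store s A i e, hT, hQ⟩

/-- The invariant is indexed by the round, so the loop runs exactly `m` rounds; the extra 1 in `m +
1` pays for the last, failing test of the guard. -/
theorem Tri.loop {e : Expr} {c : Prog} {m U T : ℕ} (Inv : ℕ → State → Prop)
    (hstep : ∀ i < m, ∀ s, Inv i s → e.val s ≠ 0 ∧ e.cost s ≤ U ∧ Tri c s T (Inv (i + 1)))
    (hexit : ∀ s, Inv m s → e.val s = 0 ∧ e.cost s ≤ U) {s : State} (h : Inv 0 s) :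
    Tri (.loop e c) s ((m + 1) * (U + 1 + T)) (Inv m) := by
  have key : ∀ j, j ≤ m → ∀ s, Inv (m - j) s →
      Tri (.loop e c) s ((j + 1) * (U + 1 + T)) (Inv m) := by
    intro j
    induction j with
    | zero =>
      intro _ s hs
      obtain ⟨h0, hc⟩ := hexit s hs
      exact ⟨e.cost s + 1, s, by constructor; exact h0, by omega, hs⟩
    | succ j ih =>
      intro hj s hs
      obtain ⟨h0, hc, t, s', hr, ht, hI⟩ := hstep (m - (j + 1)) (by omega) s hs
      rw [show m - (j + 1) + 1 = m - j by omega] at hI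
      obtain ⟨t', s'', hr', ht', hI'⟩ := ih (by omega) s' hI
      refine ⟨_, _, .loop_step h0 hr hr', ?_, hI'⟩
      rw [add_mul _ 1]
      omega
  exact key m le_rfl s (by simpa using h)

/-- All bit-costs are estimated through this crude bound, which loses nothing that matters when time
is measured in magnitudes. -/
theorem size_le_self (a : ℕ) : a.size ≤ a := Nat.size_le.2 a.lt_two_pow_self

@[simp] theorem setVar_arr (s : State) (x v : ℕ) : (s.setVar x v).arr = s.arr := rfl

@[simp] theorem setVar_var_self (s : State) (x v : ℕ) : (s.setVar x v).var x = v := by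
  simp [State.setVar]

theorem setVar_var_of_ne (s : State) {x y : ℕ} (v : ℕ) (h : y ≠ x) :
    (s.setVar x v).var y = s.var y := by
  simp [State.setVar, h]

/-! ### Contexts and polynomially bounded functions -/

/-- A type of contexts: a context is presented by the contents of `len` registers and of the
array number `1`, all of which are at most its size. -/
class Ctx (α : Type) where
  /-- the number of registers -/
  len : ℕ
  /-- the contents of the registers -/
  enc : α → ℕ → ℕ
  /-- the contents of array number `1` -/
  arr : α → ℕ → ℕ
  /-- the size -/
  sz : α → ℕ
  enc_le : ∀ a, ∀ i < len, enc a i ≤ sz a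
  arr_le : ∀ a i, arr a i ≤ sz a

open Ctx

/-- Nested pairs act as environments: loop indices and accumulators are appended as new last
registers. -/
instance (α : Type) [Ctx α] : Ctx (α × ℕ) where
  len := len α + 1
  enc p j := if j < len α then enc p.1 j else p.2
  arr p := arr p.1
  sz p := sz p.1 + p.2
  enc_le p i _ := by
    by_cases h : i < len α
    · simpa [h] using (enc_le p.1 i h).trans (Nat.le_add_right _ _)
    · simp [h]
  arr_le p i := (arr_le p.1 i).trans (Nat.le_add_right _ _)

section

variable {α : Type} [Ctx α]

theorem sz_prod (p : α × ℕ) : sz p = sz p.1 + p.2 := rfl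

/-- `f` is bounded by a polynomial in the size of the context. -/
def PB (f : α → ℕ) : Prop := ∃ d, ∀ a, f a ≤ (sz a + 2) ^ d

theorem PB.mono {f g : α → ℕ} (hg : PB g) (h : ∀ a, f a ≤ g a) : PB f := by
  obtain ⟨d, hd⟩ := hg
  exact ⟨d, fun a => (h a).trans (hd a)⟩

theorem PB.const (c : ℕ) : PB fun _ : α => c :=
  ⟨c, fun _ => c.lt_two_pow_self.le.trans (Nat.pow_le_pow_left (by omega) c)⟩

theorem PB.add {f g : α → ℕ} (hf : PB f) (hg : PB g) : PB fun a => f a + g a := by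
  obtain ⟨d, hd⟩ := hf
  obtain ⟨e, he⟩ := hg
  refine ⟨d + e + 1, fun a => ?_⟩
  have h1 : (sz a + 2) ^ d ≤ (sz a + 2) ^ (d + e) := Nat.pow_le_pow_right (by omega) (by omega)
  have h2 : (sz a + 2) ^ e ≤ (sz a + 2) ^ (d + e) := Nat.pow_le_pow_right (by omega) (by omega)
  have h3 : (sz a + 2) ^ (d + e) * 2 ≤ (sz a + 2) ^ (d + e + 1) := by
    rw [pow_succ]; exact Nat.mul_le_mul_left _ (by omega)
  have := hd a
  have := he a
  show f a + g a ≤ _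
  omega

theorem PB.mul {f g : α → ℕ} (hf : PB f) (hg : PB g) : PB fun a => f a * g a := by
  obtain ⟨d, hd⟩ := hf
  obtain ⟨e, he⟩ := hg
  refine ⟨d + e, fun a => ?_⟩
  rw [pow_add]
  exact Nat.mul_le_mul (hd a) (he a)

theorem PB.pow {f : α → ℕ} (hf : PB f) (c : ℕ) : PB fun a => f a ^ c := by
  obtain ⟨d, hd⟩ := hf
  exact ⟨d * c, fun a => by rw [pow_mul]; exact Nat.pow_le_pow_left (hd a) c⟩

theorem PB.sz : PB (Ctx.sz : α → ℕ) := ⟨1, fun a => by simp⟩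

theorem PB.weaken {f : α → ℕ} (hf : PB f) : PB fun p : α × ℕ => f p.1 := by
  obtain ⟨d, hd⟩ := hf
  exact ⟨d, fun p => (hd p.1).trans (Nat.pow_le_pow_left (by rw [sz_prod]; omega) d)⟩

theorem PB.snd : PB fun p : α × ℕ => p.2 :=
  PB.sz.mono fun p => by rw [sz_prod]; omega

/-- Substitution of a polynomially bounded function for the last register, uniformly below it. -/
theorem PB.subst {f : α × ℕ → ℕ} {g : α → ℕ} (hf : PB f) (hg : PB g) :
    ∃ F : α → ℕ, PB F ∧ ∀ a, ∀ i ≤ g a, f (a, i) ≤ F a := by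
  obtain ⟨d, hd⟩ := hf
  refine ⟨fun a => (Ctx.sz a + g a + 2) ^ d, ((PB.sz.add hg).add (PB.const 2)).pow d,
    fun a i hi => (hd _).trans (Nat.pow_le_pow_left ?_ d)⟩
  rw [sz_prod]
  simp only
  omega

/-- The memory `s` holds the context `a` in the registers `x 0, x 1, …` and in array `1`. -/
def Holds (x : ℕ → ℕ) (a : α) (s : State) : Prop :=
  (∀ i < len α, s.var (x i) = enc a i) ∧ s.arr 1 = arr a

/-- The postcondition of the evaluation of a function: the value is in register `b`, and only
registers from `b` on have been changed. -/
def Post (b v : ℕ) (s s' : State) : Prop :=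
  s'.var b = v ∧ (∀ r < b, s'.var r = s.var r) ∧ s'.arr = s.arr

theorem Holds.congr {x : ℕ → ℕ} {a : α} {s s' : State} {b : ℕ} (h : Holds x a s)
    (hx : ∀ i < len α, x i < b) (hv : ∀ r < b, s'.var r = s.var r) (ha : s'.arr = s.arr) :
    Holds x a s' :=
  ⟨fun i hi => (hv _ (hx i hi)).trans (h.1 i hi), ha ▸ h.2⟩

/-- The function `f` of the context is computable in polynomial time, for every placement of the
context in registers below the register `b` of the result, and its values are polynomially
bounded. -/
structure Comp (f : α → ℕ) : Prop where
  bdd : PB f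
  run : ∀ (x : ℕ → ℕ) (b : ℕ), (∀ i < len α, x i < b) → ∃ (P : Prog) (T : α → ℕ), PB T ∧
    ∀ a s, Holds x a s → Tri P s (T a) (Post b (f a) s)

theorem Comp.const (c : ℕ) : Comp fun _ : α => c where
  bdd := .const c
  run x b _ := ⟨.assign b (.lit c), fun _ => c.size + 1 + c.size + 1, .const _, fun a s h =>
    .assign le_rfl ⟨by simp [Expr.val], fun r hr => by rw [setVar_var_of_ne _ _ hr.ne], rfl⟩⟩

theorem Comp.reg {i : ℕ} (hi : i < len α) : Comp fun a : α => enc a i where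
  bdd := PB.sz.mono fun a => enc_le a i hi
  run x b _ := ⟨.assign b (.var (x i)), fun a => sz a + 1 + sz a + 1,
    ((PB.sz.add (.const 1)).add .sz).add (.const 1), fun a s h =>
    .assign (by
      simp only [Expr.cost, Expr.val, h.1 i hi]
      have := (size_le_self (enc a i)).trans (enc_le a i hi)
      omega)
      ⟨by simp [Expr.val, h.1 i hi], fun r hr => by rw [setVar_var_of_ne _ _ hr.ne], rfl⟩⟩

theorem Comp.weaken {f : α → ℕ} (hf : Comp f) : Comp fun p : α × ℕ => f p.1 where
  bdd := hf.bdd.weaken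
  run x b hx := by
    obtain ⟨P, T, hT, h⟩ := hf.run x b fun i hi => hx i (Nat.lt_succ_of_lt hi)
    refine ⟨P, fun p => T p.1, hT.weaken, fun p s hs => h p.1 s ⟨fun i hi => ?_, hs.2⟩⟩
    have := hs.1 i (Nat.lt_succ_of_lt hi)
    simpa [Ctx.enc, hi] using this

theorem Comp.snd : Comp fun p : α × ℕ => p.2 := by
  have := Comp.reg (α := α × ℕ) (i := len α) (Nat.lt_succ_self _)
  simpa [Ctx.enc] using this

theorem op_cost_le (a b U : ℕ) (ha : a ≤ U) (hb : b ≤ U) :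
    (a.size + 1) * (b.size + 1) ≤ (U + 1) * (U + 1) :=
  Nat.mul_le_mul (by have := size_le_self a; omega) (by have := size_le_self b; omega)

/-- The first operand waits in register `b` while the second is computed in `b + 1`; programs never
touch registers below their result. -/
theorem Comp.op (o : Op) {f g : α → ℕ} (hf : Comp f) (hg : Comp g)
    (hb : PB fun a => o.apply (f a) (g a)) : Comp fun a => o.apply (f a) (g a) where
  bdd := hb
  run x b hx := by
    obtain ⟨P, T, hT, hP⟩ := hf.run x b hx
    obtain ⟨P', T', hT', hP'⟩ := hg.run x (b + 1) fun i hi => (hx i hi).trans b.lt_succ_self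
    refine ⟨.seq P (.seq P' (.assign b (.op o (.var b) (.var (b + 1))))),
      fun a => T a + (T' a + ((f a + 1) + (g a + 1) + (f a + g a + 1) * (f a + g a + 1) +
        o.apply (f a) (g a) + 1)), ?_, fun a s hs => ?_⟩
    · exact hT.add (hT'.add (((((hf.bdd.add (.const 1)).add (hg.bdd.add (.const 1))).add
        (((hf.bdd.add hg.bdd).add (.const 1)).mul ((hf.bdd.add hg.bdd).add (.const 1)))).add
        hb).add (.const 1)))
    · refine (hP a s hs).seq fun s₁ h₁ => (hP' a s₁ (hs.congr hx h₁.2.1 h₁.2.2)).seq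
        fun s₂ h₂ => .assign ?_ ?_
      · have e1 : s₂.var b = f a := (h₂.2.1 b b.lt_succ_self).trans h₁.1
        simp only [Expr.cost, Expr.val, e1, h₂.1]
        have h3 := size_le_self (f a)
        have h4 := size_le_self (g a)
        have h5 := size_le_self (o.apply (f a) (g a))
        have := op_cost_le (f a) (g a) (f a + g a) (by omega) (by omega)
        omega
      · have e1 : s₂.var b = f a := (h₂.2.1 b b.lt_succ_self).trans h₁.1
        refine ⟨by simp [Expr.val, e1, h₂.1], fun r hr => ?_, ?_⟩
        · rw [setVar_var_of_ne _ _ hr.ne, h₂.2.1 r (hr.trans b.lt_succ_self), h₁.2.1 r hr]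
        · rw [setVar_arr, h₂.2.2, h₁.2.2]

/-- Reading array number `1`. -/
theorem Comp.get {f : α → ℕ} (hf : Comp f) : Comp fun a => arr a (f a) where
  bdd := PB.sz.mono fun a => arr_le a _
  run x b hx := by
    obtain ⟨P, T, hT, hP⟩ := hf.run x b hx
    refine ⟨.seq P (.assign b (.get 1 (.var b))),
      fun a => T a + ((f a + 1) + f a + sz a + 1 + sz a + 1), ?_, fun a s hs => ?_⟩
    · exact hT.add ((((((hf.bdd.add (.const 1)).add hf.bdd).add .sz).add (.const 1)).add
        .sz).add (.const 1))
    · refine (hP a s hs).seq fun s₁ h₁ => ?_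
      have e : s₁.arr 1 = arr a := by rw [h₁.2.2, hs.2]
      refine .assign ?_ ⟨by simp [Expr.val, e, h₁.1], fun r hr => ?_, ?_⟩
      · simp only [Expr.cost, Expr.val, h₁.1, e]
        have h3 := size_le_self (f a)
        have h4 := (size_le_self (arr a (f a))).trans (arr_le a _)
        omega
      · rw [setVar_var_of_ne _ _ hr.ne, h₁.2.1 r hr]
      · rw [setVar_arr, h₁.2.2]

/-- Primitive recursion with polynomially bounded values. -/
theorem Comp.natRec {base cnt : α → ℕ} {step : α → ℕ → ℕ → ℕ} (hbase : Comp base) (hcnt : Comp cnt)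
    (hstep : Comp fun p : (α × ℕ) × ℕ => step p.1.1 p.1.2 p.2) {g : α → ℕ} (hg : PB g)
    (hb : ∀ a, ∀ i ≤ cnt a, Nat.rec (motive := fun _ => ℕ) (base a) (step a) i ≤ g a) :
    Comp fun a => Nat.rec (motive := fun _ => ℕ) (base a) (step a) (cnt a) where
  bdd := hg.mono fun a => hb a _ le_rfl
  run x b hx := by
    set F : α → ℕ → ℕ := fun a i => Nat.rec (motive := fun _ => ℕ) (base a) (step a) i with hF
    obtain ⟨P, T, hT, hP⟩ := hbase.run x b hx
    obtain ⟨P', T', hT', hP'⟩ := hcnt.run x (b + 1) fun i hi => (hx i hi).trans b.lt_succ_self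
    -- Layout: accumulator in `b`, number of rounds in `b + 1`, loop index in `b + 2`, new value in
    -- `b + 3`.
    let y : ℕ → ℕ := fun j => if j < len α then x j else if j = len α then b + 2 else b
    obtain ⟨P'', T'', hT'', hP''⟩ := hstep.run y (b + 3) (by
      intro i hi
      by_cases h1 : i < len α
      · simp only [y, h1, if_true]; have := hx i h1; omega
      · by_cases h2 : i = len α
        · simp [y, h2]
        · simp only [y, h1, h2, if_false]; omega)
    -- The time of one round depends on the index and the accumulator; inserting their bounds `cnt`
    -- and `g` makes it a function of the context alone.
    obtain ⟨W, hW, hTW⟩ := hT''.subst (hg.weaken (α := α))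
    obtain ⟨W', hW', hTW'⟩ := hW.subst hcnt.bdd
    let U : α → ℕ := fun a => (cnt a + 1) + (cnt a + 1) + (cnt a + 1) * (cnt a + 1)
    have hU : PB U := ((hcnt.bdd.add (.const 1)).add (hcnt.bdd.add (.const 1))).add
      ((hcnt.bdd.add (.const 1)).mul (hcnt.bdd.add (.const 1)))
    let V : α → ℕ := fun a => W' a + ((g a + 1 + g a + 1) +
      ((cnt a + 1) + 2 + (cnt a + 1) * 2 + (cnt a + 1) + 1))
    have hV : PB V := hW'.add ((((hg.add (.const 1)).add hg).add (.const 1)).add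
      (((((hcnt.bdd.add (.const 1)).add (.const 2)).add ((hcnt.bdd.add (.const 1)).mul
        (.const 2))).add (hcnt.bdd.add (.const 1))).add (.const 1)))
    refine ⟨.seq P (.seq P' (.seq (.assign (b + 2) (.lit 0))
      (.loop (.op .sub (.var (b + 1)) (.var (b + 2)))
        (.seq P'' (.seq (.assign b (.var (b + 3)))
          (.assign (b + 2) (.op .add (.var (b + 2)) (.lit 1)))))))),
      fun a => T a + (T' a + (2 + (cnt a + 1) * (U a + 1 + V a))), ?_, fun a s hs => ?_⟩
    · exact hT.add (hT'.add ((PB.const 2).add ((hcnt.bdd.add (.const 1)).mul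
        ((hU.add (.const 1)).add hV))))
    · refine (hP a s hs).seq fun s₁ h₁ => ?_
      have hs₁ := hs.congr hx h₁.2.1 h₁.2.2
      refine (hP' a s₁ hs₁).seq fun s₂ h₂ => ?_
      let Inv : ℕ → State → Prop := fun i s' => i ≤ cnt a ∧ s'.var b = F a i ∧
        s'.var (b + 1) = cnt a ∧ s'.var (b + 2) = i ∧ (∀ r < b, s'.var r = s.var r) ∧
        s'.arr = s.arr
      refine Tri.seq (Q := Inv 0) (.assign ?_ ?_) fun s₃ h₃ => ?_
      · simp [Expr.cost, Expr.val]
      · refine ⟨Nat.zero_le _, ?_, ?_, by simp [Expr.val], fun r hr => ?_, ?_⟩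
        · rw [setVar_var_of_ne _ _ (by omega), h₂.2.1 b (by omega), h₁.1]; rfl
        · rw [setVar_var_of_ne _ _ (by omega), h₂.1]
        · rw [setVar_var_of_ne _ _ (by omega), h₂.2.1 r (by omega), h₁.2.1 r hr]
        · rw [setVar_arr, h₂.2.2, h₁.2.2]
      · have cost_le : ∀ i ≤ cnt a, (cnt a).size + 1 + (i.size + 1) +
            ((cnt a).size + 1) * (i.size + 1) ≤ U a := by
          intro i hi
          have h3 := size_le_self (cnt a)
          have h4 := size_le_self i
          have := op_cost_le (cnt a) i (cnt a) le_rfl hi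
          simp only [U]
          omega
        refine (Tri.loop (m := cnt a) (U := U a) (T := V a) Inv ?_ ?_ h₃).mono le_rfl ?_
        · rintro i hi s' ⟨-, e0, e1, e2, e3, e4⟩
          refine ⟨?_, ?_, ?_⟩
          · simp only [Expr.val, Op.apply, e1, e2]; omega
          · simpa only [Expr.cost, Expr.val, e1, e2] using cost_le i hi.le
          · have hold : Holds y ((a, i), F a i) s' := by
              refine ⟨fun j hj => ?_, by rw [e4]; exact hs.2⟩
              by_cases h1 : j < len α
              · have hj' : j < len α + 1 := by omega
                have := hs.1 j h1
                simp [y, h1, Ctx.enc, Ctx.len, hj', e3 _ (hx j h1), this]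
              · by_cases h2 : j = len α
                · simp [y, h2, Ctx.enc, Ctx.len, e2]
                · have hj' : ¬ j < len α + 1 := by omega
                  simp [y, h1, h2, Ctx.enc, Ctx.len, hj', e0]
            have hFg : F a i ≤ g a := hb a i hi.le
            have hFg' : F a (i + 1) ≤ g a := hb a (i + 1) hi
            have hstepF : F a (i + 1) = step a i (F a i) := rfl
            refine ((hP'' _ s' hold).mono ((hTW (a, i) _ hFg).trans (hTW' a i hi.le))
              fun _ h => h).seq fun s₄ h₄ => ?_
            have f1 : s₄.var (b + 3) = F a (i + 1) := h₄.1
            have f2 : s₄.var (b + 2) = i := (h₄.2.1 _ (by omega)).trans e2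
            refine Tri.seq (Q := fun s' => s'.var b = F a (i + 1) ∧ s'.var (b + 1) = cnt a ∧
              s'.var (b + 2) = i ∧ (∀ r < b, s'.var r = s.var r) ∧ s'.arr = s.arr)
              (.assign ?_ ?_) fun s₅ h₅ => .assign ?_ ?_
            · simp only [Expr.cost, Expr.val, f1]
              have := size_le_self (F a (i + 1))
              omega
            · refine ⟨by simp [Expr.val, f1], ?_, ?_, fun r hr => ?_, ?_⟩
              · rw [setVar_var_of_ne _ _ (by omega), h₄.2.1 _ (by omega), e1]
              · rw [setVar_var_of_ne _ _ (by omega), f2]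
              · rw [setVar_var_of_ne _ _ (by omega), h₄.2.1 _ (by omega), e3 r hr]
              · rw [setVar_arr, h₄.2.2, e4]
            · simp only [Expr.cost, Expr.val, h₅.2.2.1, Op.apply, Nat.size_one]
              have h3 := size_le_self i
              have h4 := size_le_self (i + 1)
              have : (i.size + 1) * (1 + 1) ≤ (cnt a + 1) * 2 := by omega
              omega
            · obtain ⟨g0, g1, g2, g3, g4⟩ := h₅
              refine ⟨hi, ?_, ?_, by simp [Expr.val, Op.apply, g2], fun r hr => ?_, g4⟩
              · rw [setVar_var_of_ne _ _ (by omega), g0]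
              · rw [setVar_var_of_ne _ _ (by omega), g1]
              · rw [setVar_var_of_ne _ _ (by omega), g3 r hr]
        · rintro s' ⟨-, e0, e1, e2, e3, e4⟩
          refine ⟨?_, ?_⟩
          · simp [Expr.val, Op.apply, e1, e2]
          · simpa only [Expr.cost, Expr.val, e1, e2] using cost_le _ le_rfl
        · rintro s' ⟨-, e0, e1, e2, e3, e4⟩
          exact ⟨e0, e3, e4⟩

end

end RAM

namespace RAM

open Ctx

section

variable {α : Type} [Ctx α]

/-! ### Closure properties of computable functions -/

theorem Comp.of_eq {f g : α → ℕ} (hf : Comp f) (h : ∀ a, f a = g a) : Comp g :=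
  funext h ▸ hf

/-- Weakening by a register below the last one. -/
theorem Comp.weaken_snd {f : α × ℕ → ℕ} (hf : Comp f) :
    Comp fun p : (α × ℕ) × ℕ => f (p.1.1, p.2) where
  bdd := by
    obtain ⟨d, hd⟩ := hf.bdd
    refine ⟨d, fun x => (hd _).trans (Nat.pow_le_pow_left ?_ d)⟩
    simp only [sz_prod]
    omega
  run x b hx := by
    let y : ℕ → ℕ := fun i => if i < len α then x i else x (i + 1)
    obtain ⟨P, T, hT, hP⟩ := hf.run y b (by
      intro i hi
      by_cases h1 : i < len α
      · simp only [y, h1, if_true]; exact hx i (Nat.lt_succ_of_lt (Nat.lt_succ_of_lt h1))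
      · simp only [y, h1, if_false]; exact hx _ (Nat.succ_lt_succ hi))
    refine ⟨P, fun x => T (x.1.1, x.2), ?_, fun z s hs => hP (z.1.1, z.2) s ⟨?_, hs.2⟩⟩
    · obtain ⟨d, hd⟩ := hT
      refine ⟨d, fun x => (hd _).trans (Nat.pow_le_pow_left ?_ d)⟩
      simp only [sz_prod]
      omega
    · intro i hi
      by_cases h1 : i < len α
      · have := hs.1 i (Nat.lt_succ_of_lt (Nat.lt_succ_of_lt h1))
        have h2 : i < len α + 1 := by omega
        simpa [y, h1, h2, Ctx.enc, Ctx.len] using this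
      · have hi' : i = len α := by have : i < len α + 1 := hi; omega
        have := hs.1 (i + 1) (Nat.succ_lt_succ hi)
        simpa [y, h1, hi', Ctx.enc, Ctx.len] using this

/-- Substitution of a computable function for the last register. -/
theorem Comp.subst {f : α × ℕ → ℕ} {g : α → ℕ} (hf : Comp f) (hg : Comp g) :
    Comp fun a => f (a, g a) where
  bdd := by
    obtain ⟨F, hF, h⟩ := hf.bdd.subst hg.bdd
    exact hF.mono fun a => h a _ le_rfl
  run x b hx := by
    let y : ℕ → ℕ := fun i => if i < len α then x i else b
    obtain ⟨P, T, hT, hP⟩ := hg.run x b hx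
    obtain ⟨P', T', hT', hP'⟩ := hf.run y (b + 1) (by
      intro i hi
      by_cases h1 : i < len α
      · simp only [y, h1, if_true]; have := hx i h1; omega
      · simp only [y, h1, if_false]; omega)
    obtain ⟨W, hW, hTW⟩ := hT'.subst hg.bdd
    obtain ⟨F, hF, hfF⟩ := hf.bdd.subst hg.bdd
    refine ⟨.seq P (.seq P' (.assign b (.var (b + 1)))),
      fun a => T a + (W a + (F a + 1 + F a + 1)),
      hT.add (hW.add (((hF.add (.const 1)).add hF).add (.const 1))), fun a s hs => ?_⟩
    refine (hP a s hs).seq fun s₁ h₁ => ?_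
    have hold : Holds y (a, g a) s₁ := by
      refine ⟨fun j hj => ?_, by rw [h₁.2.2]; exact hs.2⟩
      by_cases h1 : j < len α
      · simpa [y, h1, Ctx.enc, h₁.2.1 _ (hx j h1)] using hs.1 j h1
      · simpa [y, h1, Ctx.enc] using h₁.1
    refine ((hP' _ s₁ hold).mono (hTW a _ le_rfl) fun _ h => h).seq fun s₂ h₂ => ?_
    refine .assign ?_ ⟨by simp [Expr.val, h₂.1], fun r hr => ?_, ?_⟩
    · simp only [Expr.cost, Expr.val, h₂.1]
      have h3 := size_le_self (f (a, g a))
      have h4 := hfF a _ le_rfl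
      omega
    · rw [setVar_var_of_ne _ _ hr.ne, h₂.2.1 r (by omega), h₁.2.1 r hr]
    · rw [setVar_arr, h₂.2.2, h₁.2.2]

theorem Comp.add {f g : α → ℕ} (hf : Comp f) (hg : Comp g) : Comp fun a => f a + g a :=
  .op .add hf hg (hf.bdd.add hg.bdd)

theorem Comp.mul {f g : α → ℕ} (hf : Comp f) (hg : Comp g) : Comp fun a => f a * g a :=
  .op .mul hf hg (hf.bdd.mul hg.bdd)

theorem Comp.sub {f g : α → ℕ} (hf : Comp f) (hg : Comp g) : Comp fun a => f a - g a :=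
  .op .sub hf hg (hf.bdd.mono fun _ => Nat.sub_le _ _)

theorem Comp.div {f g : α → ℕ} (hf : Comp f) (hg : Comp g) : Comp fun a => f a / g a :=
  .op .div hf hg (hf.bdd.mono fun _ => Nat.div_le_self _ _)

theorem Comp.mod {f g : α → ℕ} (hf : Comp f) (hg : Comp g) : Comp fun a => f a % g a :=
  .op .mod hf hg (hf.bdd.mono fun _ => Nat.mod_le _ _)

/-- A decidable property of contexts, given by a computable function. -/
def CompP (p : α → Prop) : Prop := ∃ f : α → ℕ, Comp f ∧ ∀ a, f a ≠ 0 ↔ p a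

theorem CompP.of_iff {p q : α → Prop} (hp : CompP p) (h : ∀ a, p a ↔ q a) : CompP q := by
  obtain ⟨f, hf, h'⟩ := hp
  exact ⟨f, hf, fun a => (h' a).trans (h a)⟩

theorem CompP.not {p : α → Prop} (hp : CompP p) : CompP fun a => ¬ p a := by
  obtain ⟨f, hf, h'⟩ := hp
  exact ⟨_, (Comp.const 1).sub hf, fun a => by
    change _ ↔ ¬ p a
    rw [← h' a]; omega⟩

theorem CompP.and {p q : α → Prop} (hp : CompP p) (hq : CompP q) : CompP fun a => p a ∧ q a := by
  obtain ⟨f, hf, h⟩ := hp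
  obtain ⟨g, hg, h'⟩ := hq
  exact ⟨_, hf.mul hg, fun a => by
    change _ ↔ p a ∧ q a
    rw [← h a, ← h' a, mul_ne_zero_iff]⟩

theorem Comp.lt {f g : α → ℕ} (hf : Comp f) (hg : Comp g) : CompP fun a => f a < g a :=
  ⟨_, hg.sub hf, fun a => by omega⟩

theorem Comp.le {f g : α → ℕ} (hf : Comp f) (hg : Comp g) : CompP fun a => f a ≤ g a :=
  (hg.lt hf).not.of_iff fun a => by omega

theorem Comp.eq {f g : α → ℕ} (hf : Comp f) (hg : Comp g) : CompP fun a => f a = g a :=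
  ((hf.le hg).and (hg.le hf)).of_iff fun a => by omega

/-- Both branches are evaluated and combined arithmetically, `1 - (1 - c)` being the truth value.
Hence both must be polynomially bounded on every context, even where they are not selected. -/
theorem Comp.ite {p : α → Prop} [DecidablePred p] {f g : α → ℕ} (hp : CompP p) (hf : Comp f)
    (hg : Comp g) : Comp fun a => if p a then f a else g a := by
  obtain ⟨c, hc, h⟩ := hp
  refine ((((Comp.const 1).sub ((Comp.const 1).sub hc)).mul hf).add
    (((Comp.const 1).sub hc).mul hg)).of_eq fun a => ?_
  by_cases h0 : c a = 0
  · have : ¬ p a := fun hp => (h a).2 hp h0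
    simp [h0, this]
  · have : p a := (h a).1 h0
    have h1 : 1 - c a = 0 := by omega
    simp [h1, this]

theorem Comp.sum {n : α → ℕ} {f : α → ℕ → ℕ} (hn : Comp n)
    (hf : Comp fun p : α × ℕ => f p.1 p.2) : Comp fun a => ∑ i ∈ Finset.range (n a), f a i := by
  obtain ⟨F, hF, h⟩ := hf.bdd.subst hn.bdd
  have key : ∀ a i, Nat.rec (motive := fun _ => ℕ) 0 (fun i acc => acc + f a i) i =
      ∑ j ∈ Finset.range i, f a j := by
    intro a i
    induction i with
    | zero => rfl
    | succ i ih => rw [Finset.sum_range_succ, ← ih]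
  refine (Comp.natRec (base := fun _ => 0) (step := fun a i acc => acc + f a i) (.const 0) hn
    (Comp.snd.add hf.weaken) (hn.bdd.mul hF) fun a i hi => ?_).of_eq fun a => key a _
  rw [key]
  refine (Finset.sum_le_card_nsmul _ _ (F a) fun j hj => h a j ?_).trans ?_
  · exact (Finset.mem_range.1 hj).le.trans hi
  · rw [Finset.card_range, smul_eq_mul]
    exact Nat.mul_le_mul_right _ hi

theorem CompP.exists_lt {n : α → ℕ} {p : α → ℕ → Prop} (hn : Comp n)
    (hp : CompP fun x : α × ℕ => p x.1 x.2) : CompP fun a => ∃ i < n a, p a i := by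
  obtain ⟨f, hf, h⟩ := hp
  refine ⟨_, Comp.sum (f := fun a i => f (a, i)) hn hf, fun a => ?_⟩
  rw [Ne, Finset.sum_eq_zero_iff]
  push Not
  exact exists_congr fun i => and_congr Finset.mem_range (h (a, i))

theorem CompP.forall_lt {n : α → ℕ} {p : α → ℕ → Prop} (hn : Comp n)
    (hp : CompP fun x : α × ℕ => p x.1 x.2) : CompP fun a => ∀ i < n a, p a i :=
  (CompP.exists_lt (p := fun a i => ¬ p a i) hn hp.not).not.of_iff fun a => by push Not; rfl

open Classical in
/-- Bounded search for the least number with a property. -/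
theorem Comp.isLeast {n f : α → ℕ} {p : α → ℕ → Prop} (hn : Comp n)
    (hp : CompP fun x : α × ℕ => p x.1 x.2) (hf : ∀ a, IsLeast {i | p a i} (f a))
    (hfn : ∀ a, f a ≤ n a) : Comp f := by
  have hq : CompP fun x : α × ℕ => ∃ j < x.2 + 1, p x.1 j :=
    CompP.exists_lt (p := fun (x : α × ℕ) j => p x.1 j) (Comp.snd.add (.const 1)) (by
      obtain ⟨g, hg, h⟩ := hp
      exact ⟨_, hg.weaken_snd, fun x => h (x.1.1, x.2)⟩)
  -- The least witness equals the number of indices `i` below the bound with no witness up to `i`.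
  refine (Comp.sum (f := fun a i => if ∃ j < i + 1, p a j then 0 else 1) hn
    (Comp.ite hq (.const 0) (.const 1))).of_eq fun a => ?_
  have : ∀ i, (∃ j < i + 1, p a j) ↔ f a ≤ i := fun i =>
    ⟨fun ⟨j, hj, h⟩ => ((hf a).2 h).trans (by omega), fun h => ⟨f a, by omega, (hf a).1⟩⟩
  simp only [this]
  rw [Finset.sum_ite, Finset.sum_const_zero, zero_add, Finset.sum_const, smul_eq_mul, mul_one]
  have : (Finset.range (n a)).filter (fun i => ¬ f a ≤ i) = Finset.range (f a) := by
    ext i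
    have := hfn a
    simp only [Finset.mem_filter, Finset.mem_range]
    omega
  rw [this, Finset.card_range]

/-- Repeated division never forms `q ^ m`, so no bound on that power is required. -/
theorem Comp.div_pow {c q m : α → ℕ} (hc : Comp c) (hq : Comp q) (hm : Comp m) :
    Comp fun a => c a / q a ^ m a := by
  have key : ∀ a i, Nat.rec (motive := fun _ => ℕ) (c a) (fun _ acc => acc / q a) i =
      c a / q a ^ i := by
    intro a i
    induction i with
    | zero => simp
    | succ i ih => simp only [ih, pow_succ, Nat.div_div_eq_div_mul]
  refine (Comp.natRec (step := fun a _ acc => acc / q a) hc hm (Comp.snd.div hq.weaken.weaken)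
    hc.bdd fun a i _ => ?_).of_eq fun a => key a _
  rw [key]
  exact Nat.div_le_self _ _

theorem Comp.pow {c m : α → ℕ} (hc : Comp c) (hm : Comp m) (hb : PB fun a => c a ^ m a) :
    Comp fun a => c a ^ m a := by
  have key : ∀ a i, Nat.rec (motive := fun _ => ℕ) 1 (fun _ acc => acc * c a) i = c a ^ i := by
    intro a i
    induction i with
    | zero => simp
    | succ i ih => simp only [ih, pow_succ]
  refine (Comp.natRec (base := fun _ => 1) (step := fun a _ acc => acc * c a) (.const 1) hm
    (Comp.snd.mul hc.weaken.weaken) (hb.add (.const 1)) fun a i hi => ?_).of_eq fun a => key a _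
  rw [key]
  -- For `c a = 0` the intermediate value `0 ^ 0 = 1` may exceed the final one; this is why 1 was
  -- added to the bound.
  rcases Nat.eq_zero_or_pos (c a) with h | h
  · rcases Nat.eq_zero_or_pos i with h' | h'
    · simp [h']
    · simp [h, h'.ne']
  · exact (Nat.pow_le_pow_right h hi).trans (Nat.le_succ _)

theorem Comp.digit {c q m : α → ℕ} (hc : Comp c) (hq : Comp q) (hm : Comp m) :
    Comp fun a => c a / q a ^ m a % q a :=
  (hc.div_pow hq hm).mod hq

theorem Comp.size {c : α → ℕ} (hc : Comp c) : Comp fun a => (c a).size := by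
  refine Comp.isLeast (n := c) (p := fun a i => c a / 2 ^ i = 0) hc
    ((hc.weaken.div_pow (.const 2) .snd).eq (.const 0)) (fun a => ⟨?_, fun i hi => ?_⟩)
    (fun a => size_le_self _)
  · exact Nat.div_eq_of_lt (Nat.lt_size_self _)
  · rw [Nat.size_le]
    exact (Nat.div_eq_zero_iff.1 hi).resolve_left (by positivity)

theorem xor_le_add (a b : ℕ) : a ^^^ b ≤ a + b := by
  induction a using Nat.strong_induction_on generalizing b with
  | _ a ih =>
    rcases Nat.eq_zero_or_pos a with rfl | h
    · simp
    · have h1 := ih (a / 2) (by omega) (b / 2)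
      have h2 := Nat.xor_div_two_pow (a := a) (b := b) (n := 1)
      have h3 := @Nat.xor_mod_two_eq a b
      rw [pow_one] at h2
      rw [← h2] at h1
      omega

/-- The machine has no bitwise operations. The result is assembled from its top bit down, using `c +
e` as a safe bit length and the parity of the sum of two bits as their exclusive or. -/
theorem Comp.xor {c e : α → ℕ} (hc : Comp c) (he : Comp e) : Comp fun a => c a ^^^ e a := by
  have hL : ∀ a, c a ^^^ e a < 2 ^ (c a + e a) := fun a => Nat.xor_lt_two_pow
    (Nat.lt_two_pow_self.trans_le (Nat.pow_le_pow_right two_pos (by omega)))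
    (Nat.lt_two_pow_self.trans_le (Nat.pow_le_pow_right two_pos (by omega)))
  have hle : ∀ a, c a ^^^ e a ≤ c a + e a := fun a => xor_le_add _ _
  have key : ∀ a, ∀ i ≤ c a + e a, Nat.rec (motive := fun _ => ℕ) 0 (fun i acc => 2 * acc +
      (c a / 2 ^ (c a + e a - (i + 1)) + e a / 2 ^ (c a + e a - (i + 1))) % 2) i =
      (c a ^^^ e a) / 2 ^ (c a + e a - i) := by
    intro a i
    induction i with
    | zero => intro _; exact (Nat.div_eq_of_lt (hL a)).symm
    | succ i ih =>
      intro hi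
      simp only [ih (by omega)]
      rw [show c a + e a - i = (c a + e a - (i + 1)) + 1 by omega, pow_succ,
        ← Nat.div_div_eq_div_mul]
      generalize c a + e a - (i + 1) = m
      rw [Nat.add_mod, ← Nat.div_add_mod ((c a ^^^ e a) / 2 ^ m) 2, Nat.xor_div_two_pow,
        Nat.xor_mod_two_eq]
      omega
  refine (Comp.natRec (base := fun _ => 0) (step := fun a i acc => 2 * acc +
      (c a / 2 ^ (c a + e a - (i + 1)) + e a / 2 ^ (c a + e a - (i + 1))) % 2) (.const 0)
      (hc.add he) ?_ (hc.bdd.add he.bdd) fun a i hi => ?_).of_eq fun a => ?_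
  · have h2 := hc.weaken.weaken (α := α × ℕ)
    have h3 := he.weaken.weaken (α := α × ℕ)
    have h4 := (h2.add h3).sub (Comp.snd.weaken.add (.const 1))
    exact ((Comp.const 2).mul .snd).add (((h2.div_pow (.const 2) h4).add
      (h3.div_pow (.const 2) h4)).mod (.const 2))
  · rw [key a i hi]
    exact (Nat.div_le_self _ _).trans (hle a)
  · rw [key a _ le_rfl]
    simp

end

end RAM

section

/-! ### Binary fields on natural numbers -/

open Polynomial

/-- The polynomial over `𝔽₂` whose coefficients are the binary digits of `a`. -/
noncomputable def toPoly (a : ℕ) : (ZMod 2)[X] :=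
  ∑ i ∈ Finset.range a, if a.testBit i then X ^ i else 0

/-- Cutting the defining sum off at `a` loses nothing, because `a < 2 ^ a`. -/
theorem coeff_toPoly (a i : ℕ) : (toPoly a).coeff i = if a.testBit i then 1 else 0 := by
  have h : ∀ j, ((if a.testBit j then X ^ j else 0 : (ZMod 2)[X])).coeff i =
      if j = i then (if a.testBit i then 1 else 0) else 0 := by
    intro j
    by_cases hj : j = i
    · subst hj
      by_cases h : a.testBit j <;> simp [h]
    · by_cases h : a.testBit j <;> simp [h, hj, coeff_X_pow, Ne.symm hj]
  rw [toPoly, finsetSum_coeff, Finset.sum_congr rfl fun j _ => h j, Finset.sum_ite_eq']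
  by_cases hi : i < a
  · simp [hi]
  · have : a.testBit i = false :=
      Nat.testBit_lt_two_pow (a.lt_two_pow_self.trans_le (Nat.pow_le_pow_right two_pos (by omega)))
    simp [hi, this]

theorem toPoly_xor (a b : ℕ) : toPoly (a ^^^ b) = toPoly a + toPoly b := by
  ext i
  rw [coeff_add, coeff_toPoly, coeff_toPoly, coeff_toPoly, Nat.testBit_xor]
  cases a.testBit i <;> cases b.testBit i <;> simp
  decide

theorem toPoly_zero : toPoly 0 = 0 := by
  ext i; simp [coeff_toPoly]

theorem toPoly_two_mul_add (a e : ℕ) (he : e < 2) :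
    toPoly (2 * a + e) = X * toPoly a + (e : (ZMod 2)[X]) := by
  have hC : (e : (ZMod 2)[X]) = C (e : ZMod 2) := by simp
  rw [hC]
  ext i
  rcases i with _ | i
  · rw [coeff_toPoly]
    interval_cases e <;> simp
  · rw [coeff_toPoly, coeff_add, coeff_X_mul, coeff_toPoly, coeff_C_succ, add_zero,
      Nat.testBit_succ, show (2 * a + e) / 2 = a by omega]

theorem toPoly_one : toPoly 1 = 1 := by
  simpa [toPoly_zero] using toPoly_two_mul_add 0 1 (by norm_num)

theorem toPoly_injective : Function.Injective toPoly := by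
  intro a b h
  refine Nat.eq_of_testBit_eq fun i => ?_
  have := congrArg (fun p => coeff p i) h
  simp only [coeff_toPoly] at this
  revert this
  cases a.testBit i <;> cases b.testBit i <;> simp

theorem coeff_toPoly_of_lt {a r i : ℕ} (ha : a < 2 ^ r) (hi : r ≤ i) : (toPoly a).coeff i = 0 := by
  rw [coeff_toPoly,
    Nat.testBit_lt_two_pow (ha.trans_le (Nat.pow_le_pow_right two_pos hi))]
  simp

theorem exists_toPoly_eq (r : ℕ) (p : (ZMod 2)[X]) (hp : ∀ i, r ≤ i → p.coeff i = 0) :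
    ∃ a < 2 ^ r, toPoly a = p := by
  induction r generalizing p with
  | zero => exact ⟨0, by simp, by rw [toPoly_zero]; ext i; simp [hp i]⟩
  | succ r ih =>
    obtain ⟨a, ha, h⟩ := ih p.divX fun i hi => by rw [coeff_divX]; exact hp _ (by omega)
    have h2 := ZMod.val_lt (p.coeff 0)
    refine ⟨2 * a + (p.coeff 0).val, by rw [pow_succ]; omega, ?_⟩
    rw [toPoly_two_mul_add _ _ h2, h]
    conv_rhs => rw [← divX_mul_X_add p]
    rw [mul_comm, ← C_eq_natCast, ZMod.natCast_zmod_val]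

/-- Multiplication of polynomials over `𝔽₂` of degree less than `r` modulo the polynomial `f` of
degree `r`, on binary encodings. -/
def gmul (r f a b : ℕ) : ℕ :=
  Nat.rec (motive := fun _ => ℕ) 0 (fun i acc => ((2 * acc) ^^^ (f * (2 * acc / 2 ^ r)) ^^^
    (a * (b / 2 ^ (r - (i + 1)) % 2))) % 2 ^ r) r

/-- The residue class of the polynomial encoded by `a` modulo the polynomial encoded by `f`. -/
noncomputable def resid (f a : ℕ) : AdjoinRoot (toPoly f) := AdjoinRoot.mk (toPoly f) (toPoly a)

theorem resid_xor (f a b : ℕ) : resid f (a ^^^ b) = resid f a + resid f b := by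
  simp [resid, toPoly_xor]

theorem resid_zero (f : ℕ) : resid f 0 = 0 := by simp [resid, toPoly_zero]

theorem resid_one (f : ℕ) : resid f 1 = 1 := by simp [resid, toPoly_one]

theorem resid_self (f : ℕ) : resid f f = 0 := AdjoinRoot.mk_self

theorem resid_two_mul_add (f a e : ℕ) (he : e < 2) :
    resid f (2 * a + e) = resid f 2 * resid f a + (e : AdjoinRoot (toPoly f)) := by
  have h2 : toPoly 2 = X := by simpa [toPoly_one] using toPoly_two_mul_add 1 0 (by norm_num)
  simp [resid, toPoly_two_mul_add a e he, h2]

theorem gmul_lt (r f a b : ℕ) : gmul r f a b < 2 ^ r := by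
  unfold gmul
  cases r with
  | zero => simp
  | succ r => exact Nat.mod_lt _ (by positivity)

/-- This is one reduction step modulo a polynomial of degree `r`: the two leading terms cancel. -/
theorem xor_lt_of_msb {r x y : ℕ} (hx : 2 ^ r ≤ x) (hx' : x < 2 ^ (r + 1)) (hy : 2 ^ r ≤ y)
    (hy' : y < 2 ^ (r + 1)) : x ^^^ y < 2 ^ r := by
  have h1 : x / 2 ^ r = 1 := by
    rw [Nat.div_eq_iff (by positivity)]; rw [pow_succ] at hx'; omega
  have h2 : y / 2 ^ r = 1 := by
    rw [Nat.div_eq_iff (by positivity)]; rw [pow_succ] at hy'; omega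
  have h3 : (x ^^^ y) / 2 ^ r = 0 := by rw [Nat.xor_div_two_pow, h1, h2]; rfl
  exact (Nat.div_eq_zero_iff.1 h3).resolve_left (by positivity)

/-- Horner's rule over the bits of `b`: after `i` rounds the accumulator represents `a` times the
number formed by the top `i` of the `r` bits of `b`. A round multiplies by `X`, subtracts `f` if
degree `r` is reached, and adds `a` if the next bit is set. -/
theorem resid_gmul {r f a b : ℕ} (hf : 2 ^ r ≤ f) (hf' : f < 2 ^ (r + 1)) (ha : a < 2 ^ r)
    (hb : b < 2 ^ r) : resid f (gmul r f a b) = resid f a * resid f b := by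
  let F : ℕ → ℕ := fun i => Nat.rec (motive := fun _ => ℕ) 0 (fun i acc =>
    ((2 * acc) ^^^ (f * (2 * acc / 2 ^ r)) ^^^ (a * (b / 2 ^ (r - (i + 1)) % 2))) % 2 ^ r) i
  have key : ∀ i ≤ r, F i < 2 ^ r ∧ resid f (F i) = resid f a * resid f (b / 2 ^ (r - i)) := by
    intro i
    induction i with
    | zero =>
      intro _
      refine ⟨by simp [F], ?_⟩
      rw [Nat.sub_zero, Nat.div_eq_of_lt hb, resid_zero, mul_zero]
      exact resid_zero f
    | succ i ih =>
      intro hi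
      obtain ⟨h1, h2⟩ := ih (by omega)
      have hF : F (i + 1) = ((2 * F i) ^^^ (f * (2 * F i / 2 ^ r)) ^^^
        (a * (b / 2 ^ (r - (i + 1)) % 2))) % 2 ^ r := rfl
      set e := b / 2 ^ (r - (i + 1)) % 2 with he
      have he2 : e < 2 := Nat.mod_lt _ two_pos
      have hb' : b / 2 ^ (r - (i + 1)) = 2 * (b / 2 ^ (r - i)) + e := by
        rw [show r - i = (r - (i + 1)) + 1 by omega, pow_succ, ← Nat.div_div_eq_div_mul]
        omega
      have hred : (2 * F i) ^^^ (f * (2 * F i / 2 ^ r)) < 2 ^ r ∧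
          resid f ((2 * F i) ^^^ (f * (2 * F i / 2 ^ r))) = resid f 2 * resid f (F i) := by
        have h3 := resid_two_mul_add f (F i) 0 two_pos
        simp only [add_zero, Nat.cast_zero] at h3
        by_cases hlt : 2 * F i < 2 ^ r
        · rw [Nat.div_eq_of_lt hlt, mul_zero, Nat.xor_zero]
          exact ⟨hlt, h3⟩
        · have : 2 * F i / 2 ^ r = 1 := by
            rw [Nat.div_eq_iff (by positivity)]; omega
          rw [this, mul_one, resid_xor, resid_self, add_zero]
          exact ⟨xor_lt_of_msb (by omega) (by rw [pow_succ]; omega) hf hf', h3⟩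
      have hae : a * e < 2 ^ r ∧ resid f (a * e) = resid f a * (e : AdjoinRoot (toPoly f)) := by
        interval_cases e
        · simp [resid_zero]
        · simpa using ha
      have hlt := Nat.xor_lt_two_pow hred.1 hae.1
      rw [hF, Nat.mod_eq_of_lt hlt]
      refine ⟨hlt, ?_⟩
      rw [resid_xor, hred.2, hae.2, h2, hb', resid_two_mul_add _ _ _ he2]
      ring
  have := (key r le_rfl).2
  rwa [Nat.sub_self, pow_zero, Nat.div_one] at this

/-- The number `f` encodes a polynomial of degree `r` over `𝔽₂` modulo which there are no zero
divisors. -/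
def IsModulus (r f : ℕ) : Prop :=
  (2 ^ r ≤ f ∧ f < 2 ^ (r + 1)) ∧ ∀ a < 2 ^ r, ∀ b < 2 ^ r, gmul r f a b = 0 → a * b = 0

theorem toPoly_monic {r f : ℕ} (hf : 2 ^ r ≤ f) (hf' : f < 2 ^ (r + 1)) :
    (toPoly f).Monic ∧ (toPoly f).natDegree = r := by
  have h1 : (toPoly f).coeff r = 1 := by
    have : f / 2 ^ r = 1 := by
      rw [Nat.div_eq_iff (by positivity)]; rw [pow_succ] at hf'; omega
    rw [coeff_toPoly, Nat.testBit_eq_decide_div_mod_eq, this]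
    simp
  have h2 : (toPoly f).natDegree = r :=
    le_antisymm (natDegree_le_iff_coeff_eq_zero.2 fun i hi => coeff_toPoly_of_lt hf' hi)
      (le_natDegree_of_ne_zero (by simp [h1]))
  exact ⟨by rw [Monic, leadingCoeff, h2, h1], h2⟩

/-- The polynomial of `a ^^^ b` has degree below `r` and is divisible by one of degree `r`, so it
vanishes. -/
theorem resid_injOn {r f a b : ℕ} (hf : 2 ^ r ≤ f) (hf' : f < 2 ^ (r + 1)) (ha : a < 2 ^ r)
    (hb : b < 2 ^ r) (h : resid f a = resid f b) : a = b := by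
  have h0 : resid f (a ^^^ b) = 0 := by
    have := resid_xor f b b
    rw [Nat.xor_self, resid_zero] at this
    rw [resid_xor, h, ← this]
  have hab := Nat.xor_lt_two_pow ha hb
  obtain ⟨hm, hd⟩ := toPoly_monic hf hf'
  by_contra hne
  have hpos : toPoly (a ^^^ b) ≠ 0 := by
    intro h
    rw [← toPoly_zero] at h
    exact hne (Nat.xor_eq_zero_iff.1 (toPoly_injective h))
  have hdvd := AdjoinRoot.mk_eq_zero.1 h0
  have h1 := natDegree_le_of_dvd hdvd hpos
  rw [hd] at h1
  have := coeff_toPoly_of_lt hab h1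
  rw [coeff_natDegree, leadingCoeff_eq_zero] at this
  exact hpos this

theorem exists_resid_eq {r f : ℕ} (hf : 2 ^ r ≤ f) (hf' : f < 2 ^ (r + 1))
    (x : AdjoinRoot (toPoly f)) : ∃ a < 2 ^ r, resid f a = x := by
  obtain ⟨p, rfl⟩ := AdjoinRoot.mk_surjective x
  obtain ⟨hm, hd⟩ := toPoly_monic hf hf'
  obtain ⟨a, ha, h⟩ := exists_toPoly_eq r (p %ₘ toPoly f) fun i hi => by
    refine coeff_eq_zero_of_degree_lt ((degree_modByMonic_lt p hm).trans_le ?_)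
    rw [degree_eq_natDegree hm.ne_zero, hd]
    exact_mod_cast hi
  refine ⟨a, ha, ?_⟩
  rw [resid, h, AdjoinRoot.mk_eq_mk]
  refine ⟨-(p /ₘ toPoly f), ?_⟩
  linear_combination modByMonic_add_div p (toPoly f)

/-- Every residue class has a representative below `2 ^ r`, so the finite test in `IsModulus`, which
a machine can carry out, already excludes all zero divisors and can replace irreducibility. -/
theorem IsModulus.isDomain {r f : ℕ} (hr : 1 ≤ r) (h : IsModulus r f) :
    IsDomain (AdjoinRoot (toPoly f)) := by
  obtain ⟨⟨hf, hf'⟩, hz⟩ := h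
  have : NoZeroDivisors (AdjoinRoot (toPoly f)) := ⟨fun {x y} hxy => by
    obtain ⟨a, ha, rfl⟩ := exists_resid_eq hf hf' x
    obtain ⟨b, hb, rfl⟩ := exists_resid_eq hf hf' y
    rw [← resid_gmul hf hf' ha hb, ← resid_zero f] at hxy
    rcases mul_eq_zero.1 (hz a ha b hb (resid_injOn hf hf' (gmul_lt _ _ _ _) (by positivity) hxy))
      with rfl | rfl
    · exact Or.inl (resid_zero f)
    · exact Or.inr (resid_zero f)⟩
  have : Nontrivial (AdjoinRoot (toPoly f)) := ⟨⟨resid f 0, resid f 1, fun h =>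
    absurd (resid_injOn hf hf' (by positivity) (Nat.one_lt_two_pow (by omega)) h) (by norm_num)⟩⟩
  exact NoZeroDivisors.to_isDomain _

/-- The minimal polynomial of a primitive element of the field with `2 ^ r` elements does it. -/
theorem exists_irreducible_natDegree_eq (r : ℕ) (hr : r ≠ 0) :
    ∃ p : (ZMod 2)[X], Irreducible p ∧ p.natDegree = r := by
  obtain ⟨x, hx⟩ := Field.exists_primitive_element (ZMod 2) (GaloisField 2 r)
  refine ⟨minpoly (ZMod 2) x, minpoly.irreducible (Algebra.IsIntegral.isIntegral x), ?_⟩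
  rw [(Field.primitive_element_iff_minpoly_natDegree_eq _ x).1 hx, GaloisField.finrank 2 hr]

theorem exists_isModulus (r : ℕ) : ∃ f, IsModulus r f := by
  rcases Nat.eq_zero_or_pos r with rfl | hr
  · exact ⟨1, by simp, fun a ha b hb _ => by simp_all⟩
  obtain ⟨p, hp, hd⟩ := exists_irreducible_natDegree_eq r hr.ne'
  obtain ⟨f, hf', rfl⟩ := exists_toPoly_eq (r + 1) p fun i hi =>
    coeff_eq_zero_of_natDegree_lt (by omega)
  have hf : 2 ^ r ≤ f := by
    by_contra h
    have h2 := coeff_toPoly_of_lt (not_le.1 h) le_rfl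
    have h3 : (toPoly f).leadingCoeff = 0 := by rw [leadingCoeff, hd, h2]
    exact hp.ne_zero (leadingCoeff_eq_zero.1 h3)
  have : Fact (Irreducible (toPoly f)) := ⟨hp⟩
  refine ⟨f, ⟨hf, hf'⟩, fun a ha b hb h => ?_⟩
  have h1 := resid_gmul hf hf' ha hb
  rw [h, resid_zero] at h1
  rcases mul_eq_zero.1 h1.symm with h2 | h2 <;> rw [← resid_zero f] at h2
  · rw [resid_injOn hf hf' ha (by positivity) h2, zero_mul]
  · rw [resid_injOn hf hf' hb (by positivity) h2, mul_zero]

/-- The least modulus of degree `r`. -/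
noncomputable def modulus (r : ℕ) : ℕ := sInf {f | IsModulus r f}

theorem isLeast_modulus (r : ℕ) : IsLeast {f | IsModulus r f} (modulus r) :=
  ⟨Nat.sInf_mem (exists_isModulus r), fun _ h => Nat.sInf_le h⟩

theorem modulus_spec (r : ℕ) : IsModulus r (modulus r) := (isLeast_modulus r).1

/-- The field with `2 ^ r` elements. -/
abbrev GF (r : ℕ) : Type := AdjoinRoot (toPoly (modulus r))

theorem isDomain_GF {r : ℕ} (hr : 1 ≤ r) : IsDomain (GF r) := (modulus_spec r).isDomain hr

/-- The element of the field with `2 ^ r` elements that is encoded by a number. -/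
noncomputable def gf (r a : ℕ) : GF r := resid (modulus r) a

theorem gf_xor (r a b : ℕ) : gf r (a ^^^ b) = gf r a + gf r b := resid_xor _ _ _

theorem gf_zero (r : ℕ) : gf r 0 = 0 := resid_zero _

theorem gf_one (r : ℕ) : gf r 1 = 1 := resid_one _

theorem gf_injOn {r a b : ℕ} (ha : a < 2 ^ r) (hb : b < 2 ^ r) (h : gf r a = gf r b) : a = b :=
  resid_injOn (modulus_spec r).1.1 (modulus_spec r).1.2 ha hb h

/-- Multiplication in the field with `2 ^ r` elements, on encodings. -/
noncomputable def fmul (r a b : ℕ) : ℕ := gmul r (modulus r) a b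

theorem fmul_lt (r a b : ℕ) : fmul r a b < 2 ^ r := gmul_lt _ _ _ _

theorem gf_fmul {r a b : ℕ} (ha : a < 2 ^ r) (hb : b < 2 ^ r) :
    gf r (fmul r a b) = gf r a * gf r b :=
  resid_gmul (modulus_spec r).1.1 (modulus_spec r).1.2 ha hb

/-- Powers in the field with `2 ^ r` elements, on encodings. -/
noncomputable def fpow (r a l : ℕ) : ℕ :=
  Nat.rec (motive := fun _ => ℕ) 1 (fun _ acc => fmul r acc a) l

theorem fpow_lt {r : ℕ} (hr : 1 ≤ r) (a l : ℕ) : fpow r a l < 2 ^ r := by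
  cases l with
  | zero => exact Nat.one_lt_two_pow (by omega)
  | succ l => exact fmul_lt _ _ _

theorem gf_fpow {r a : ℕ} (hr : 1 ≤ r) (ha : a < 2 ^ r) (l : ℕ) :
    gf r (fpow r a l) = gf r a ^ l := by
  induction l with
  | zero => exact gf_one r
  | succ l ih =>
    rw [pow_succ, ← ih]
    exact gf_fmul (fpow_lt hr a l) ha

/-- The value at `x` of the polynomial over the field with `2 ^ r` elements with the coefficients
`u 0, …, u (e - 1)`, by Horner's rule, on encodings. -/
noncomputable def horner (r : ℕ) (u : ℕ → ℕ) (x e : ℕ) : ℕ :=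
  Nat.rec (motive := fun _ => ℕ) 0 (fun i acc => fmul r acc x ^^^ u (e - (i + 1))) e

/-- After `i` rounds the accumulator is the value of the polynomial formed by the top `i`
coefficients. -/
theorem horner_aux {r : ℕ} {u : ℕ → ℕ} {x : ℕ} (e : ℕ) (hu : ∀ i < e, u i < 2 ^ r)
    (hx : x < 2 ^ r) (i : ℕ) (hi : i ≤ e) :
    Nat.rec (motive := fun _ => ℕ) 0 (fun i acc => fmul r acc x ^^^ u (e - (i + 1))) i < 2 ^ r ∧
    gf r (Nat.rec (motive := fun _ => ℕ) 0 (fun i acc => fmul r acc x ^^^ u (e - (i + 1))) i) =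
      ∑ m ∈ Finset.range i, gf r (u (e - i + m)) * gf r x ^ m := by
  induction i with
  | zero => exact ⟨by positivity, by simpa using gf_zero r⟩
  | succ i ih =>
    obtain ⟨h1, h2⟩ := ih (by omega)
    refine ⟨Nat.xor_lt_two_pow (fmul_lt _ _ _) (hu _ (by omega)), ?_⟩
    simp only
    rw [gf_xor, gf_fmul h1 hx, h2, Finset.sum_range_succ', Finset.sum_mul, add_zero, pow_zero,
      mul_one]
    congr 1
    refine Finset.sum_congr rfl fun m _ => ?_
    rw [pow_succ, mul_assoc, show e - (i + 1) + (m + 1) = e - i + m by omega]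

theorem horner_lt {r : ℕ} {u : ℕ → ℕ} {x e : ℕ} (hu : ∀ i < e, u i < 2 ^ r) (hx : x < 2 ^ r) :
    horner r u x e < 2 ^ r :=
  (horner_aux e hu hx e le_rfl).1

theorem gf_horner {r : ℕ} {u : ℕ → ℕ} {x e : ℕ} (hu : ∀ i < e, u i < 2 ^ r) (hx : x < 2 ^ r) :
    gf r (horner r u x e) = ∑ m ∈ Finset.range e, gf r (u m) * gf r x ^ m := by
  exact (horner_aux e hu hx e le_rfl).2.trans (by simp)

/-- The value at `x` of the polynomial over the field with `2 ^ r` elements whose coefficients are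
the first `e` digits of `c` in base `2 ^ r`. -/
noncomputable def digitEval (r e c x : ℕ) : ℕ :=
  horner r (fun m => c / (2 ^ r) ^ m % 2 ^ r) x e

theorem digitEval_lt {r e c x : ℕ} (hx : x < 2 ^ r) : digitEval r e c x < 2 ^ r :=
  horner_lt (fun _ _ => Nat.mod_lt _ (by positivity)) hx

theorem gf_digitEval {r e c x : ℕ} (hx : x < 2 ^ r) : gf r (digitEval r e c x) =
    ∑ m ∈ Finset.range e, gf r (c / (2 ^ r) ^ m % 2 ^ r) * gf r x ^ m :=
  gf_horner (fun _ _ => Nat.mod_lt _ (by positivity)) hx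

/-! ### Computability of the field arithmetic -/

namespace RAM

variable {α : Type} [Ctx α]

theorem Comp.gmul {r f a b : α → ℕ} (hr : Comp r) (hr2 : PB fun x => 2 ^ r x) (hf : Comp f)
    (ha : Comp a) (hb : Comp b) : Comp fun x => gmul (r x) (f x) (a x) (b x) := by
  have hq : Comp fun x => 2 ^ r x := Comp.pow (.const 2) hr hr2
  have ww {g : α → ℕ} (h : Comp g) : Comp fun p : (α × ℕ) × ℕ => g p.1.1 := h.weaken.weaken
  refine Comp.natRec (base := fun _ => 0) (.const 0) hr
    (((((Comp.const 2).mul .snd).xor ((ww hf).mul (((Comp.const 2).mul .snd).div (ww hq)))).xor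
      ((ww ha).mul (((ww hb).div_pow (.const 2) ((ww hr).sub
        (Comp.snd.weaken.add (.const 1)))).mod (.const 2)))).mod (ww hq)) hr2 fun x i _ => ?_
  cases i with
  | zero => exact Nat.zero_le _
  | succ i => exact (Nat.mod_lt _ (by positivity)).le

/-- Exhaustive search over all candidates and all pairs of residues is affordable, as `2 ^ r` is
polynomially bounded. -/
theorem Comp.modulus {r : α → ℕ} (hr : Comp r) (hr2 : PB fun x => 2 ^ r x) :
    Comp fun x => modulus (r x) := by
  have hq : Comp fun x => 2 ^ r x := Comp.pow (.const 2) hr hr2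
  have hq1 : Comp fun x => 2 ^ (r x + 1) :=
    (hq.mul (.const 2)).of_eq fun x => (pow_succ _ _).symm
  refine Comp.isLeast (p := fun x f => IsModulus (r x) f) hq1 ?_ (fun x => isLeast_modulus _)
    fun x => (modulus_spec (r x)).1.2.le
  refine ((hq.weaken.le .snd).and (Comp.snd.lt hq1.weaken)).and ?_
  refine CompP.forall_lt hq.weaken (CompP.forall_lt hq.weaken.weaken ?_)
  refine (((Comp.gmul (α := ((α × ℕ) × ℕ) × ℕ) hr.weaken.weaken.weaken hr2.weaken.weaken.weaken
    Comp.snd.weaken.weaken Comp.snd.weaken .snd).eq (.const 0)).and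
    ((Comp.snd.weaken.mul .snd).eq (.const 0)).not).not.of_iff fun p => ?_
  tauto

theorem Comp.fmul {r a b : α → ℕ} (hr : Comp r) (hr2 : PB fun x => 2 ^ r x)
    (ha : Comp a) (hb : Comp b) : Comp fun x => fmul (r x) (a x) (b x) :=
  Comp.gmul hr hr2 (Comp.modulus hr hr2) ha hb

theorem Comp.fpow {r a l : α → ℕ} (hr : Comp r) (hr2 : PB fun x => 2 ^ r x)
    (ha : Comp a) (hl : Comp l) : Comp fun x => fpow (r x) (a x) (l x) := by
  refine Comp.natRec (base := fun _ => 1) (step := fun x _ acc => _root_.fmul (r x) acc (a x))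
    (.const 1) hl
    (Comp.fmul (α := (α × ℕ) × ℕ) hr.weaken.weaken hr2.weaken.weaken .snd ha.weaken.weaken)
    (hr2.add (.const 1)) fun x i _ => ?_
  cases i with
  | zero => exact Nat.le_add_left _ _
  | succ i => exact (fmul_lt _ _ _).le.trans (Nat.le_succ _)

theorem Comp.horner {r z e : α → ℕ} {u : α → ℕ → ℕ} (hr : Comp r) (hr2 : PB fun x => 2 ^ r x)
    (hu : Comp fun p : α × ℕ => u p.1 p.2) (hul : ∀ x i, u x i < 2 ^ r x)
    (hz : Comp z) (he : Comp e) : Comp fun x => horner (r x) (u x) (z x) (e x) := by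
  have hu' : Comp fun p : (α × ℕ) × ℕ => u p.1.1 (e p.1.1 - (p.1.2 + 1)) :=
    hu.weaken_snd.weaken_snd.subst
      (he.weaken.weaken.sub (Comp.snd.weaken.add (.const 1)) : Comp fun p : (α × ℕ) × ℕ => _)
  refine Comp.natRec (base := fun _ => 0)
    (step := fun x i acc => _root_.fmul (r x) acc (z x) ^^^ u x (e x - (i + 1))) (.const 0) he
    ((Comp.fmul (α := (α × ℕ) × ℕ) hr.weaken.weaken hr2.weaken.weaken .snd hz.weaken.weaken).xor
      hu') hr2 fun x i _ => ?_
  cases i with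
  | zero => exact Nat.zero_le _
  | succ i => exact (Nat.xor_lt_two_pow (fmul_lt _ _ _) (hul _ _)).le

theorem Comp.digitEval {r e c z : α → ℕ} (hr : Comp r) (hr2 : PB fun x => 2 ^ r x)
    (he : Comp e) (hc : Comp c) (hz : Comp z) :
    Comp fun x => digitEval (r x) (e x) (c x) (z x) :=
  Comp.horner (u := fun x m => c x / (2 ^ r x) ^ m % 2 ^ r x) hr hr2
    (hc.weaken.digit (Comp.pow (.const 2) hr hr2).weaken .snd)
    (fun _ _ => Nat.mod_lt _ (by positivity)) hz he

end RAM

/-! ### Small-bias spaces over binary fields -/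

theorem card_gf_roots_le {r D : ℕ} (hr : 1 ≤ r) {p : (GF r)[X]} (hp : p ≠ 0)
    (hd : p.natDegree ≤ D) :
    ((Finset.range (2 ^ r)).filter fun a => p.eval (gf r a) = 0).card ≤ D := by
  classical
  have := isDomain_GF hr
  refine le_trans ?_ (p.card_roots'.trans hd)
  refine le_trans ?_ (Multiset.toFinset_card_le _)
  refine Finset.card_le_card_of_injOn (gf r) (fun a ha => ?_) fun a ha b hb h => ?_
  · simp only [Finset.coe_filter, Finset.mem_range, Set.mem_ofPred_eq] at ha
    simpa [hp] using ha.2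
  · simp only [Finset.coe_filter, Finset.mem_range, Set.mem_ofPred_eq] at ha hb
    exact gf_injOn ha.1 hb.1 h

/-- Vandermonde: if all these power sums vanished, so would the sum of the `P (g j)` for every
polynomial `P` of degree below `k`. The product of the `X - g j` over all of `T` but one element
contradicts this. -/
theorem exists_sum_pow_ne_zero {F ι : Type*} [CommRing F] [IsDomain F] {T : Finset ι} {g : ι → F}
    (hT : T.Nonempty) (hg : Set.InjOn g T) {k : ℕ} (hk : T.card ≤ k) :
    ∃ l < k, ∑ j ∈ T, g j ^ l ≠ 0 := by
  classical
  by_contra! h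
  obtain ⟨j₀, hj₀⟩ := hT
  let P : F[X] := ∏ j ∈ T.erase j₀, (X - C (g j))
  have hdeg : P.natDegree < k := by
    rw [natDegree_prod_of_monic _ _ fun j _ => monic_X_sub_C _]
    simp only [natDegree_X_sub_C, Finset.sum_const, smul_eq_mul, mul_one,
      Finset.card_erase_of_mem hj₀]
    have := Finset.card_pos.2 ⟨j₀, hj₀⟩
    omega
  have h0 : ∑ j ∈ T, P.eval (g j) = 0 := by
    simp only [eval_eq_sum_range' hdeg]
    rw [Finset.sum_comm]
    refine Finset.sum_eq_zero fun l hl => ?_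
    rw [← Finset.mul_sum, h l (Finset.mem_range.1 hl), mul_zero]
  rw [Finset.sum_eq_single_of_mem j₀ hj₀ fun j hj hne => by
    rw [eval_prod]
    exact Finset.prod_eq_zero (Finset.mem_erase.2 ⟨hne, hj⟩) (by simp), eval_prod,
    Finset.prod_eq_zero_iff] at h0
  obtain ⟨j, hj, hj0⟩ := h0
  rw [eval_sub, eval_X, eval_C, sub_eq_zero] at hj0
  exact Finset.ne_of_mem_erase hj (hg (Finset.mem_of_mem_erase hj) hj₀ hj0.symm)

/-- The character of `𝔽₂ ^ r` given by the vector `z`. -/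
noncomputable def chi (r y z : ℕ) : ℝ :=
  ∏ t ∈ Finset.range r, if y.testBit t && z.testBit t then -1 else 1

theorem chi_comm (r y z : ℕ) : chi r y z = chi r z y := by
  simp only [chi, Bool.and_comm]

theorem chi_xor (r y z z' : ℕ) : chi r y (z ^^^ z') = chi r y z * chi r y z' := by
  rw [chi, chi, chi, ← Finset.prod_mul_distrib]
  refine Finset.prod_congr rfl fun t _ => ?_
  rw [Nat.testBit_xor]
  cases y.testBit t <;> cases z.testBit t <;> cases z'.testBit t <;> simp

theorem chi_zero (r y : ℕ) : chi r y 0 = 1 := by simp [chi]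

/-- Translating `y` by a bit at which `z` is 1 permutes the range and flips the sign of every term.
-/
theorem sum_chi_eq_zero {r z : ℕ} (hz : z < 2 ^ r) (h0 : z ≠ 0) :
    ∑ y ∈ Finset.range (2 ^ r), chi r y z = 0 := by
  obtain ⟨t, ht⟩ : ∃ t, z.testBit t = true := by
    by_contra! h
    exact h0 (Nat.eq_of_testBit_eq fun i => by simpa using h i)
  have htr : t < r := by
    by_contra h
    rw [Nat.testBit_lt_two_pow (hz.trans_le (Nat.pow_le_pow_right two_pos (not_lt.1 h)))] at ht
    exact Bool.false_ne_true ht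
  have hw : (2 : ℕ) ^ t < 2 ^ r := Nat.pow_lt_pow_right (by norm_num) htr
  have hchi : chi r (2 ^ t) z = -1 := by
    rw [chi, Finset.prod_eq_single_of_mem t (Finset.mem_range.2 htr)]
    · simp [ht]
    · intro b _ hb
      simp [Nat.testBit_two_pow_of_ne hb.symm]
  have h : ∑ y ∈ Finset.range (2 ^ r), chi r y z = -∑ y ∈ Finset.range (2 ^ r), chi r y z := by
    rw [← Finset.sum_neg_distrib]
    refine Finset.sum_nbij' (· ^^^ 2 ^ t) (· ^^^ 2 ^ t)
      (fun y hy => Finset.mem_range.2 (Nat.xor_lt_two_pow (Finset.mem_range.1 hy) hw))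
      (fun y hy => Finset.mem_range.2 (Nat.xor_lt_two_pow (Finset.mem_range.1 hy) hw))
      (fun y _ => by simp) (fun y _ => by simp) fun y _ => ?_
    rw [chi_comm r (y ^^^ 2 ^ t), chi_xor, chi_comm r z (2 ^ t), hchi, chi_comm]
    ring
  linarith

/-- The inner product of two vectors of `𝔽₂ ^ r`. -/
def dot (r y z : ℕ) : ℕ :=
  (∑ t ∈ Finset.range r, (y / 2 ^ t % 2) * (z / 2 ^ t % 2)) % 2

theorem neg_one_pow_dot (r y z : ℕ) : (-1 : ℝ) ^ dot r y z = chi r y z := by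
  rw [dot, ← neg_one_pow_eq_pow_mod_two, ← Finset.prod_pow_eq_pow_sum, chi]
  refine Finset.prod_congr rfl fun t _ => ?_
  rw [Nat.testBit_eq_decide_div_mod_eq, Nat.testBit_eq_decide_div_mod_eq]
  rcases Nat.mod_two_eq_zero_or_one (y / 2 ^ t) with h | h <;>
    rcases Nat.mod_two_eq_zero_or_one (z / 2 ^ t) with h' | h' <;> simp [h, h']

/-- A single number, the exclusive or of the `z j`, represents the sum as a polynomial, as a field
element and as a character. This links vanishing in the field to triviality of a product of
characters. -/
theorem exists_xor_sum {ι : Type*} (r : ℕ) (z : ι → ℕ) (hz : ∀ j, z j < 2 ^ r) (T : Finset ι) :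
    ∃ w < 2 ^ r, toPoly w = ∑ j ∈ T, toPoly (z j) ∧ gf r w = ∑ j ∈ T, gf r (z j) ∧
      ∀ y, chi r y w = ∏ j ∈ T, chi r y (z j) := by
  classical
  induction T using Finset.induction_on with
  | empty => exact ⟨0, by positivity, by simp [toPoly_zero], by simp [gf_zero], by simp [chi_zero]⟩
  | insert j T hj ih =>
    obtain ⟨w, hw, h1, h2, h3⟩ := ih
    refine ⟨z j ^^^ w, Nat.xor_lt_two_pow (hz j) hw, ?_, ?_, fun y => ?_⟩
    · rw [toPoly_xor, h1, Finset.sum_insert hj]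
    · rw [gf_xor, h2, Finset.sum_insert hj]
    · rw [chi_xor, h3, Finset.prod_insert hj]

theorem sum_toPoly_eq_zero {ι : Type*} {r : ℕ} {z : ι → ℕ} (hz : ∀ j, z j < 2 ^ r) {T : Finset ι}
    (h : ∑ j ∈ T, gf r (z j) = 0) : ∑ j ∈ T, toPoly (z j) = 0 := by
  obtain ⟨w, hw, h1, h2, -⟩ := exists_xor_sum r z hz T
  rw [h, ← gf_zero r] at h2
  rw [← h1, gf_injOn hw (by positivity) h2, toPoly_zero]

/-- The indicator is the product over `j` of `(1 + (-1) ^ ξ j * χ_j) / 2`; expanding gives its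
Fourier series. -/
theorem indicator_eq_sum_chi {k r y : ℕ} (z ξ : Fin k → ℕ) (hξ : ∀ j, ξ j < 2) :
    (if ∀ j, dot r y (z j) = ξ j then (1 : ℝ) else 0) =
      (1 / 2 ^ k) * ∑ T : Finset (Fin k), (∏ j ∈ T, (-1 : ℝ) ^ ξ j) * ∏ j ∈ T, chi r y (z j) := by
  have h1 : (∏ j : Fin k, ((-1 : ℝ) ^ ξ j * chi r y (z j) + 1)) =
      ∑ T : Finset (Fin k), (∏ j ∈ T, (-1 : ℝ) ^ ξ j) * ∏ j ∈ T, chi r y (z j) := by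
    rw [Finset.prod_add]
    simp only [Finset.prod_const_one, mul_one, Finset.prod_mul_distrib, Finset.powerset_univ]
  have h2 : ∀ j, (-1 : ℝ) ^ ξ j * chi r y (z j) + 1 = if dot r y (z j) = ξ j then 2 else 0 := by
    intro j
    have hd : dot r y (z j) < 2 := Nat.mod_lt _ two_pos
    have hx := hξ j
    rw [← neg_one_pow_dot]
    generalize dot r y (z j) = d at hd
    generalize ξ j = x at hx
    interval_cases d <;> interval_cases x <;> norm_num
  rw [← h1, Finset.prod_congr rfl fun j _ => h2 j]
  by_cases h : ∀ j, dot r y (z j) = ξ j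
  · simp [h]
  · rw [if_neg h]
    push Not at h
    obtain ⟨j, hj⟩ := h
    rw [Finset.prod_eq_zero (Finset.mem_univ j) (by simp [hj]), mul_zero]

/-- For fixed `a`, the sum over `y` of the character belonging to `T` is `2 ^ r` if the sum over `T`
of the `z a j` vanishes, and 0 otherwise. So `T = ∅` yields the main term and every other `T` at
most `2 ^ r * D`. The normalization `1 / 2 ^ k` absorbs the number of sets `T`. -/
theorem abs_card_sub_le_of_bias {k r D : ℕ} (z : ℕ → Fin k → ℕ) (hz : ∀ a j, z a j < 2 ^ r)
    (hD : ∀ T : Finset (Fin k), T.Nonempty →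
      ((Finset.range (2 ^ r)).filter fun a => ∑ j ∈ T, gf r (z a j) = 0).card ≤ D)
    (ξ : Fin k → ℕ) (hξ : ∀ j, ξ j < 2) :
    |((((Finset.range (2 ^ r)) ×ˢ (Finset.range (2 ^ r))).filter fun p : ℕ × ℕ =>
      ∀ j, dot r p.2 (z p.1 j) = ξ j).card : ℝ) - ((2 : ℝ) ^ r) ^ 2 / 2 ^ k| ≤ (2 : ℝ) ^ r * (D : ℝ) := by
  classical
  let S : Finset (Fin k) → ℝ := fun T => ∑ a ∈ Finset.range (2 ^ r),
    ∑ y ∈ Finset.range (2 ^ r), ∏ j ∈ T, chi r y (z a j)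
  have hcount : ((((Finset.range (2 ^ r)) ×ˢ (Finset.range (2 ^ r))).filter fun p : ℕ × ℕ =>
      ∀ j, dot r p.2 (z p.1 j) = ξ j).card : ℝ) =
      (1 / 2 ^ k) * ∑ T : Finset (Fin k), (∏ j ∈ T, (-1 : ℝ) ^ ξ j) * S T := by
    rw [Finset.natCast_card_filter, Finset.sum_product]
    simp only [indicator_eq_sum_chi _ _ hξ, S]
    simp only [← Finset.mul_sum]
    congr 1
    simp only [Finset.mul_sum]
    rw [Finset.sum_congr rfl fun a _ => Finset.sum_comm, Finset.sum_comm]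
  have hS : ∀ T : Finset (Fin k), S T = 2 ^ r *
      (((Finset.range (2 ^ r)).filter fun a => ∑ j ∈ T, gf r (z a j) = 0).card : ℝ) := by
    intro T
    rw [Finset.natCast_card_filter, Finset.mul_sum]
    refine Finset.sum_congr rfl fun a _ => ?_
    obtain ⟨w, hw, -, h2, h3⟩ := exists_xor_sum r (z a) (hz a) T
    simp only [← h3, ← h2]
    by_cases h0 : w = 0
    · simp [h0, chi_zero, gf_zero]
    · rw [sum_chi_eq_zero hw h0, if_neg, mul_zero]
      rw [← gf_zero r]
      exact fun h => h0 (gf_injOn hw (by positivity) h)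
  have hempty : (∏ j ∈ (∅ : Finset (Fin k)), (-1 : ℝ) ^ ξ j) * S ∅ = (2 ^ r) ^ 2 := by
    simp [hS, sq]
  rw [hcount, ← Finset.add_sum_erase _ _ (Finset.mem_univ ∅), hempty]
  have hrest : |∑ T ∈ (Finset.univ : Finset (Finset (Fin k))).erase ∅,
      (∏ j ∈ T, (-1 : ℝ) ^ ξ j) * S T| ≤ 2 ^ k * (2 ^ r * D) := by
    refine (Finset.abs_sum_le_sum_abs _ _).trans ?_
    refine (Finset.sum_le_card_nsmul _ _ (2 ^ r * (D : ℝ)) fun T hT => ?_).trans ?_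
    · rw [abs_mul, Finset.abs_prod]
      simp only [abs_pow, abs_neg, abs_one, one_pow, Finset.prod_const_one, one_mul]
      rw [hS, abs_of_nonneg (by positivity)]
      have := hD T (Finset.nonempty_iff_ne_empty.2 (Finset.ne_of_mem_erase hT))
      have : (((Finset.range (2 ^ r)).filter fun a => ∑ j ∈ T, gf r (z a j) = 0).card : ℝ) ≤ D := by
        exact_mod_cast this
      gcongr
    · rw [nsmul_eq_mul]
      gcongr
      refine (Nat.cast_le.2 (Finset.card_le_univ _)).trans ?_
      simp
  rw [mul_add, one_div, inv_mul_eq_div, add_comm, add_sub_cancel_right, abs_mul, abs_of_nonneg (by positivity)]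
  calc (2 ^ k : ℝ)⁻¹ * _ ≤ (2 ^ k : ℝ)⁻¹ * (2 ^ k * (2 ^ r * D)) := by gcongr
    _ = 2 ^ r * D := by field_simp

/-- The value at `a`, in the field with `2 ^ r` elements, of the polynomial whose coefficients are
the base `2 ^ r` digits, `e` for each, of the first `k` powers of `i` in the field with `2 ^ R`
elements. -/
noncomputable def bchEval (R r e k i a : ℕ) : ℕ :=
  horner r (fun s => fpow R i (s / e) / (2 ^ r) ^ (s % e) % 2 ^ r) a (k * e)

theorem bchEval_lt {R r e k i a : ℕ} (ha : a < 2 ^ r) : bchEval R r e k i a < 2 ^ r :=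
  horner_lt (fun _ _ => Nat.mod_lt _ (by positivity)) ha

theorem testBit_digit (c r m t : ℕ) (ht : t < r) :
    (c / (2 ^ r) ^ m % 2 ^ r).testBit t = c.testBit (m * r + t) := by
  rw [Nat.testBit_mod_two_pow, ← pow_mul, Nat.testBit_div_two_pow]
  simp [ht, mul_comm r m, add_comm]

/-- The sum over `T` is the value at `a` of one polynomial `p` of degree below `k * e`. It is not
zero: by `exists_sum_pow_ne_zero` some power sum over GF(2^R) is nonzero, and taking digits is
additive over `𝔽₂`, so some coefficient of `p` is nonzero. -/
theorem card_bchEval_sum_eq_zero_le {R r e k : ℕ} (hR : 1 ≤ R) (hr : 1 ≤ r) (he : R ≤ e * r)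
    {I : Fin k → ℕ} (hI : Function.Injective I) (hI' : ∀ j, I j < 2 ^ R) {T : Finset (Fin k)}
    (hT : T.Nonempty) :
    ((Finset.range (2 ^ r)).filter fun a =>
      ∑ j ∈ T, gf r (bchEval R r e k (I j) a) = 0).card ≤ k * e := by
  classical
  have hdom := isDomain_GF hR
  let u : Fin k → ℕ → ℕ := fun j s => fpow R (I j) (s / e) / (2 ^ r) ^ (s % e) % 2 ^ r
  have hu : ∀ j s, u j s < 2 ^ r := fun j s => Nat.mod_lt _ (by positivity)
  let p : (GF r)[X] := ∑ s ∈ Finset.range (k * e), C (∑ j ∈ T, gf r (u j s)) * X ^ s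
  have hcoeff : ∀ s < k * e, p.coeff s = ∑ j ∈ T, gf r (u j s) := by
    intro s hs
    simp only [p, finsetSum_coeff, coeff_C_mul_X_pow]
    rw [Finset.sum_ite_eq]
    simp [hs]
  have hp : p ≠ 0 := by
    intro h0
    obtain ⟨l, hl, hne⟩ := exists_sum_pow_ne_zero (k := k) (g := fun j => gf R (I j)) hT
      (fun j _ j' _ h => hI (gf_injOn (hI' j) (hI' j') h)) ((Finset.card_le_univ T).trans (by simp))
    apply hne
    simp only [← gf_fpow hR (hI' _)]
    have hzero : ∑ j ∈ T, toPoly (fpow R (I j) l) = 0 := by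
      ext b
      rw [finsetSum_coeff, coeff_zero]
      by_cases hb : b < R
      · have hm : b / r < e := Nat.div_lt_of_lt_mul (by rw [mul_comm]; omega)
        -- Bit `b` of the power with exponent `l` sits in coefficient `e * l + b / r`, at bit
        -- position `b % r`.
        have hs : e * l + b / r < k * e := by
          calc e * l + b / r < e * l + e := Nat.add_lt_add_left hm _
            _ = e * (l + 1) := by ring
            _ ≤ e * k := Nat.mul_le_mul_left _ hl
            _ = k * e := mul_comm _ _
        have h1 := hcoeff _ hs
        rw [h0, coeff_zero] at h1
        have h2 := congrArg (fun q => coeff q (b % r)) (sum_toPoly_eq_zero (fun j => hu j _) h1.symm)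
        simp only [finsetSum_coeff, coeff_zero] at h2
        rw [← h2]
        refine Finset.sum_congr rfl fun j _ => ?_
        rw [coeff_toPoly, coeff_toPoly]
        simp only [u]
        rw [testBit_digit _ _ _ _ (Nat.mod_lt _ (by omega)), Nat.mul_add_div (Nat.zero_lt_of_lt hm),
          Nat.div_eq_of_lt hm, add_zero, Nat.mul_add_mod, Nat.mod_eq_of_lt hm, Nat.div_add_mod']
      · exact Finset.sum_eq_zero fun j _ =>
          coeff_toPoly_of_lt (fpow_lt hR _ _) (not_lt.1 hb)
    have := congrArg (AdjoinRoot.mk (toPoly (modulus R))) hzero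
    rwa [map_sum, map_zero] at this
  have hdeg : p.natDegree ≤ k * e := by
    refine natDegree_sum_le_of_forall_le _ _ fun s hs => ?_
    exact (natDegree_C_mul_X_pow_le _ _).trans (Finset.mem_range.1 hs).le
  refine le_trans (Finset.card_le_card fun a ha => ?_) (card_gf_roots_le hr hp hdeg)
  simp only [Finset.mem_filter] at ha ⊢
  refine ⟨ha.1, ?_⟩
  rw [← ha.2, eval_finsetSum]
  simp only [eval_mul, eval_C, eval_pow, eval_X, Finset.sum_mul]
  rw [Finset.sum_comm]
  refine Finset.sum_congr rfl fun j _ => ?_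
  exact (gf_horner (fun s _ => hu j s) (Finset.mem_range.1 ha.1)).symm

/-- It allows a sample point, which is a pair, to be numbered by one row index. -/
theorem card_filter_range_mul (A B : ℕ) (P : ℕ → ℕ → Prop) [∀ a b, Decidable (P a b)] :
    ((Finset.range (A * B)).filter fun x => P (x / B) (x % B)).card =
      ((Finset.range A ×ˢ Finset.range B).filter fun p : ℕ × ℕ => P p.1 p.2).card := by
  rcases Nat.eq_zero_or_pos B with rfl | hB
  · simp
  refine Finset.card_nbij' (fun x => (x / B, x % B)) (fun p => p.1 * B + p.2) ?_ ?_ ?_ ?_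
  · intro x hx
    simp only [Finset.coe_filter, Finset.mem_range, Set.mem_ofPred_eq, Finset.mem_product] at hx ⊢
    exact ⟨⟨Nat.div_lt_of_lt_mul (by rw [mul_comm]; exact hx.1), Nat.mod_lt _ hB⟩, hx.2⟩
  · rintro ⟨a, b⟩ hx
    simp only [Finset.coe_filter, Finset.mem_range, Set.mem_ofPred_eq, Finset.mem_product] at hx ⊢
    have h1 : (a * B + b) / B = a := by
      rw [mul_comm, Nat.mul_add_div hB, Nat.div_eq_of_lt hx.1.2, add_zero]
    have h2 : (a * B + b) % B = b := by
      rw [mul_comm, Nat.mul_add_mod, Nat.mod_eq_of_lt hx.1.2]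
    rw [h1, h2]
    refine ⟨?_, hx.2⟩
    calc a * B + b < a * B + B := by omega
      _ = (a + 1) * B := by ring
      _ ≤ A * B := Nat.mul_le_mul_right _ hx.1.1
  · intro x _
    exact Nat.div_add_mod' x B
  · rintro ⟨a, b⟩ hx
    simp only [Finset.coe_filter, Finset.mem_range, Set.mem_ofPred_eq, Finset.mem_product] at hx ⊢
    rw [Prod.mk.injEq, mul_comm a B, Nat.mul_add_div hB, Nat.div_eq_of_lt hx.1.2, Nat.mul_add_mod,
      Nat.mod_eq_of_lt hx.1.2]
    simp

/-- The entry `i` of the vector number `x` of the small-bias space. -/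
noncomputable def biasBit (R r e k x i : ℕ) : ℕ :=
  dot r (x % 2 ^ r) (bchEval R r e k i (x / 2 ^ r))

theorem abs_card_biasBit_sub_le {R r e k : ℕ} (hR : 1 ≤ R) (hr : 1 ≤ r) (he : R ≤ e * r)
    {I : Fin k → ℕ} (hI : Function.Injective I) (hI' : ∀ j, I j < 2 ^ R)
    (ξ : Fin k → ℕ) (hξ : ∀ j, ξ j < 2) :
    |(((Finset.range (2 ^ r * 2 ^ r)).filter fun x => ∀ j, biasBit R r e k x (I j) = ξ j).card : ℝ)
      - ((2 : ℝ) ^ r) ^ 2 / 2 ^ k| ≤ (2 : ℝ) ^ r * ((k * e : ℕ) : ℝ) := by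
  have h := abs_card_sub_le_of_bias (fun a j => bchEval R r e k (I j) (a % 2 ^ r))
    (fun a j => bchEval_lt (Nat.mod_lt _ (by positivity))) (D := k * e) (fun T hT => by
      refine le_trans (Finset.card_le_card fun a ha => ?_)
        (card_bchEval_sum_eq_zero_le hR hr he hI hI' hT)
      simp only [Finset.mem_filter, Finset.mem_range] at ha ⊢
      rwa [Nat.mod_eq_of_lt ha.1] at ha) ξ hξ
  rw [← card_filter_range_mul _ _ fun a y =>
    ∀ j, dot r y (bchEval R r e k (I j) (a % 2 ^ r)) = ξ j] at h
  convert h using 5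
  refine Finset.filter_congr fun x hx => ?_
  simp only [biasBit, Nat.mod_eq_of_lt (Nat.div_lt_of_lt_mul (Finset.mem_range.1 hx))]

/-! ### Computability of the small-bias space -/

namespace RAM

variable {α : Type} [Ctx α]

theorem Comp.dot {r y z : α → ℕ} (hr : Comp r) (hy : Comp y) (hz : Comp z) :
    Comp fun x => dot (r x) (y x) (z x) :=
  (Comp.sum (f := fun x t => (y x / 2 ^ t % 2) * (z x / 2 ^ t % 2)) hr
    ((hy.weaken.digit (.const 2) .snd).mul (hz.weaken.digit (.const 2) .snd))).mod (.const 2)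

theorem Comp.bchEval {R r e k i a : α → ℕ} (hR : Comp R) (hR2 : PB fun x => 2 ^ R x)
    (hr : Comp r) (hr2 : PB fun x => 2 ^ r x) (he : Comp e) (hk : Comp k) (hi : Comp i)
    (ha : Comp a) : Comp fun x => bchEval (R x) (r x) (e x) (k x) (i x) (a x) :=
  Comp.horner (u := fun x s => _root_.fpow (R x) (i x) (s / e x) / (2 ^ r x) ^ (s % e x) % 2 ^ r x) hr hr2
    ((Comp.fpow hR.weaken hR2.weaken hi.weaken (Comp.snd.div he.weaken)).digit
      (Comp.pow (.const 2) hr hr2).weaken (Comp.snd.mod he.weaken))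
    (fun _ _ => Nat.mod_lt _ (by positivity)) ha (hk.mul he)

theorem Comp.biasBit {R r e k x i : α → ℕ} (hR : Comp R) (hR2 : PB fun x => 2 ^ R x)
    (hr : Comp r) (hr2 : PB fun x => 2 ^ r x) (he : Comp e) (hk : Comp k) (hx : Comp x)
    (hi : Comp i) : Comp fun y => biasBit (R y) (r y) (e y) (k y) (x y) (i y) :=
  Comp.dot hr (hx.mod (Comp.pow (.const 2) hr hr2))
    (Comp.bchEval hR hR2 hr hr2 he hk hi (hx.div (Comp.pow (.const 2) hr hr2)))

end RAM

/-! ### Polynomial hashing and exact independence -/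

theorem eq_of_digits_eq {q : ℕ} (k : ℕ) {a b : ℕ} (ha : a < q ^ k) (hb : b < q ^ k)
    (h : ∀ m < k, a / q ^ m % q = b / q ^ m % q) : a = b := by
  induction k generalizing a b with
  | zero => simp at ha hb; omega
  | succ k ih =>
    have h0 := h 0 (Nat.succ_pos _)
    simp only [pow_zero, Nat.div_one] at h0
    have h1 : a / q = b / q := by
      refine ih (Nat.div_lt_of_lt_mul (by rwa [pow_succ'] at ha))
        (Nat.div_lt_of_lt_mul (by rwa [pow_succ'] at hb)) fun m hm => ?_
      have := h (m + 1) (Nat.succ_lt_succ hm)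
      rwa [pow_succ', ← Nat.div_div_eq_div_mul, ← Nat.div_div_eq_div_mul] at this
    rw [← Nat.div_add_mod a q, ← Nat.div_add_mod b q, h0, h1]

theorem exists_digits {q : ℕ} (k : ℕ) (x : Fin k → ℕ) (hx : ∀ j, x j < q) :
    ∃ t < q ^ k, ∀ j : Fin k, t / q ^ (j : ℕ) % q = x j := by
  induction k with
  | zero => exact ⟨0, by simp, fun j => j.elim0⟩
  | succ k ih =>
    obtain ⟨t, ht, h⟩ := ih (fun j => x j.succ) fun j => hx _
    have hq : 0 < q := (Nat.zero_le _).trans_lt (hx 0)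
    refine ⟨x 0 + q * t, ?_, fun j => ?_⟩
    · calc x 0 + q * t < q + q * t := Nat.add_lt_add_right (hx 0) _
        _ = q * (t + 1) := by ring
        _ ≤ q * q ^ k := Nat.mul_le_mul_left _ ht
        _ = q ^ (k + 1) := (pow_succ' _ _).symm
    · refine Fin.cases ?_ (fun j => ?_) j
      · simp [Nat.mod_eq_of_lt (hx 0)]
      · rw [Fin.val_succ, pow_succ', ← Nat.div_div_eq_div_mul, Nat.add_mul_div_left _ _ hq,
          Nat.div_eq_of_lt (hx 0), zero_add, h]

/-- The polynomial evaluated by `digitEval`. -/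
noncomputable def digitPoly (r e c : ℕ) : (GF r)[X] :=
  ∑ m ∈ Finset.range e, C (gf r (c / (2 ^ r) ^ m % 2 ^ r)) * X ^ m

theorem eval_digitPoly {r e c a : ℕ} (ha : a < 2 ^ r) :
    (digitPoly r e c).eval (gf r a) = gf r (digitEval r e c a) := by
  rw [gf_digitEval ha, digitPoly, eval_finsetSum]
  simp

theorem coeff_digitPoly (r e c m : ℕ) : (digitPoly r e c).coeff m =
    if m < e then gf r (c / (2 ^ r) ^ m % 2 ^ r) else 0 := by
  simp only [digitPoly, finsetSum_coeff, coeff_C_mul_X_pow]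
  rw [Finset.sum_ite_eq]
  simp

theorem digitPoly_injOn {r e c d : ℕ} (hc : c < (2 ^ r) ^ e) (hd : d < (2 ^ r) ^ e)
    (h : digitPoly r e c = digitPoly r e d) : c = d := by
  refine eq_of_digits_eq e hc hd fun m hm => ?_
  have := congrArg (fun p => coeff p m) h
  simp only [coeff_digitPoly, hm, if_true] at this
  exact gf_injOn (Nat.mod_lt _ (by positivity)) (Nat.mod_lt _ (by positivity)) this

/-- Reed–Solomon hashing: different numbers give different polynomials of degree below `e`, which
agree at fewer than `e` points. -/
theorem card_digitEval_eq_lt {r e c d : ℕ} (hr : 1 ≤ r) (hc : c < (2 ^ r) ^ e)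
    (hd : d < (2 ^ r) ^ e) (hcd : c ≠ d) :
    ((Finset.range (2 ^ r)).filter fun a => digitEval r e c a = digitEval r e d a).card < e := by
  have he : 0 < e := by
    rcases Nat.eq_zero_or_pos e with rfl | h
    · simp at hc hd; omega
    · exact h
  have hp : digitPoly r e c - digitPoly r e d ≠ 0 := fun h =>
    hcd (digitPoly_injOn hc hd (sub_eq_zero.1 h))
  have hdeg : (digitPoly r e c - digitPoly r e d).natDegree ≤ e - 1 :=
    natDegree_le_iff_coeff_eq_zero.2 fun m hm => by
      rw [coeff_sub, coeff_digitPoly, coeff_digitPoly, if_neg (by omega), if_neg (by omega),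
        sub_zero]
  refine lt_of_le_of_lt ?_ (Nat.sub_lt he one_pos)
  refine le_trans (Finset.card_le_card fun a ha => ?_) (card_gf_roots_le hr hp hdeg)
  simp only [Finset.mem_filter, Finset.mem_range] at ha ⊢
  exact ⟨ha.1, by rw [eval_sub, eval_digitPoly ha.1, eval_digitPoly ha.1, ha.2, sub_self]⟩

open Classical in
-- Union bound over the pairs of positions, each of which collides for at most `e` values of `a`.
theorem card_not_injective_digitEval_le {r e k : ℕ} (hr : 1 ≤ r) {I : Fin k → ℕ}
    (hI : Function.Injective I) (hI' : ∀ j, I j < (2 ^ r) ^ e) :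
    ((Finset.range (2 ^ r)).filter fun a =>
      ¬ Function.Injective fun j => digitEval r e (I j) a).card ≤ k ^ 2 * e := by
  let B : Fin k × Fin k → Finset ℕ := fun p =>
    if p.1 = p.2 then ∅ else
    (Finset.range (2 ^ r)).filter fun a => digitEval r e (I p.1) a = digitEval r e (I p.2) a
  have hB : ∀ p ∈ (Finset.univ : Finset (Fin k × Fin k)), (B p).card ≤ e := by
    intro p _
    by_cases h : p.1 = p.2
    · simp [B, h]
    · simp only [B, h, if_false]
      exact (card_digitEval_eq_lt hr (hI' _) (hI' _) fun h' => h (hI h')).le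
  refine le_trans (Finset.card_le_card (t := Finset.univ.biUnion B) fun a ha => ?_)
    ((Finset.card_biUnion_le_card_mul _ _ _ hB).trans (by simp [sq]))
  obtain ⟨ha, hinj⟩ := Finset.mem_filter.1 ha
  rw [Function.Injective] at hinj
  push Not at hinj
  obtain ⟨i, j, h, hij⟩ := hinj
  refine Finset.mem_biUnion.2 ⟨(i, j), Finset.mem_univ _, ?_⟩
  simp only [B, hij, if_false, Finset.mem_filter]
  exact ⟨ha, h⟩

theorem digitEval_tuple_injOn {r k : ℕ} (hr : 1 ≤ r) {x : Fin k → ℕ} (hx : Function.Injective x)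
    (hx' : ∀ j, x j < 2 ^ r) {c d : ℕ} (hc : c < (2 ^ r) ^ k) (hd : d < (2 ^ r) ^ k)
    (h : ∀ j, digitEval r k c (x j) = digitEval r k d (x j)) : c = d := by
  classical
  by_contra hcd
  have h1 := card_digitEval_eq_lt hr hc hd hcd
  have h2 := Finset.card_le_card_of_injOn (s := Finset.univ)
    (t := (Finset.range (2 ^ r)).filter fun a => digitEval r k c a = digitEval r k d a) x
    (fun j _ => by simp [hx' j, h j]) hx.injOn
  rw [Finset.card_univ, Fintype.card_fin] at h2
  omega

theorem card_range_mod_two {r b : ℕ} (hr : 1 ≤ r) (hb : b < 2) :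
    ((Finset.range (2 ^ r)).filter fun y => y % 2 = b).card = 2 ^ (r - 1) := by
  obtain ⟨s, rfl⟩ : ∃ s, r = s + 1 := ⟨r - 1, by omega⟩
  have h := card_filter_range_mul (2 ^ s) 2 fun _ y => y = b
  rw [pow_succ, h, Finset.filter_product_right (fun y : ℕ => y = b), Finset.card_product,
    Finset.filter_eq']
  simp [hb]

/-- The bit number `x` of the point `w` of a `k`-wise independent sample space. -/
noncomputable def ptBit (r k w x : ℕ) : ℕ := digitEval r k w x % 2

/-- Interpolation makes evaluation at `k` distinct points a bijection from the polynomials of degree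
below `k` onto all `k`-tuples of field elements, and half of the field elements have a given last
bit. -/
theorem card_ptBit_eq {r k : ℕ} (hr : 1 ≤ r) {x : Fin k → ℕ} (hx : Function.Injective x)
    (hx' : ∀ j, x j < 2 ^ r) {ξ : Fin k → ℕ} (hξ : ∀ j, ξ j < 2) :
    2 ^ k * ((Finset.range ((2 ^ r) ^ k)).filter fun w => ∀ j, ptBit r k w (x j) = ξ j).card =
      (2 ^ r) ^ k := by
  classical
  let F : ℕ → Fin k → ℕ := fun w j => digitEval r k w (x j)
  have hinj : Set.InjOn F (Finset.range ((2 ^ r) ^ k)) := fun c hc d hd h =>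
    digitEval_tuple_injOn hr hx hx' (by simpa using hc) (by simpa using hd) (congrFun h)
  have himg : (Finset.range ((2 ^ r) ^ k)).image F =
      Fintype.piFinset fun _ : Fin k => Finset.range (2 ^ r) := by
    -- Injectivity suffices, since both sides have `(2 ^ r) ^ k` elements.
    refine Finset.eq_of_subset_of_card_le (fun v hv => ?_) ?_
    · obtain ⟨w, -, rfl⟩ := Finset.mem_image.1 hv
      exact Fintype.mem_piFinset.2 fun j => Finset.mem_range.2 (digitEval_lt (hx' j))
    · rw [Finset.card_image_of_injOn hinj]
      simp
  have hcard : ((Finset.range ((2 ^ r) ^ k)).filter fun w => ∀ j, ptBit r k w (x j) = ξ j).card =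
      (Fintype.piFinset fun j : Fin k => (Finset.range (2 ^ r)).filter fun y => y % 2 = ξ j).card := by
    rw [← Finset.card_image_of_injOn (hinj.mono (Finset.coe_subset.2 (Finset.filter_subset
      (fun w => ∀ j, ptBit r k w (x j) = ξ j) _)))]
    congr 1
    ext v
    simp only [Finset.mem_image, Finset.mem_filter, Fintype.mem_piFinset]
    constructor
    · rintro ⟨w, ⟨hw, h⟩, rfl⟩ j
      exact ⟨Finset.mem_range.2 (digitEval_lt (hx' j)), h j⟩
    · intro h
      have hv : v ∈ Fintype.piFinset fun _ : Fin k => Finset.range (2 ^ r) :=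
        Fintype.mem_piFinset.2 fun j => (h j).1
      rw [← himg] at hv
      obtain ⟨w, hw, rfl⟩ := Finset.mem_image.1 hv
      exact ⟨w, ⟨hw, fun j => (h j).2⟩, rfl⟩
  rw [hcard, Fintype.card_piFinset, Finset.prod_congr rfl fun j _ => card_range_mod_two hr (hξ j)]
  rw [Finset.prod_const, Finset.card_univ, Fintype.card_fin, ← mul_pow, ← pow_succ']
  congr 2
  omega

/-! ### Greedy selection by multiplicative weights -/

/-- The number of events: an event is a direction, a pattern of `k` bits and a `k`-tuple of
positions. -/
def numEvents (r k : ℕ) : ℕ := 2 * (2 ^ k * (2 ^ r) ^ k)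

/-- The position number `j` of an event. -/
def evPos (r k ev j : ℕ) : ℕ := ev / 2 / 2 ^ k / (2 ^ r) ^ j % 2 ^ r

/-- The bit number `j` of the pattern of an event. -/
def evPat (k ev j : ℕ) : ℕ := ev / 2 % 2 ^ k / 2 ^ j % 2

/-- The positions of the event are distinct. -/
def EvInj (r k ev : ℕ) : Prop := ∀ j < k, ∀ l < j, evPos r k ev j ≠ evPos r k ev l

open Classical in
/-- Whether the point `w` shows the pattern of the event in the positions of the event. -/
noncomputable def evBit (r k ev w : ℕ) : ℕ :=
  if ∀ j < k, ptBit r k w (evPos r k ev j) = evPat k ev j then 1 else 0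

/-- The numerator of the factor of the weight of an event. -/
def evNum (k L ev u : ℕ) : ℕ := if ev % 2 = 0 then 2 ^ k * (L + u) else 2 ^ k * (L - u)

/-- The denominator of the factor of the weight of an event. -/
def evDen (k L ev : ℕ) : ℕ := if ev % 2 = 0 then 2 ^ k * L + 1 else 2 ^ k * L - 1

/-- The bound at which weights are cut off. -/
def evCap (r k N : ℕ) : ℕ := 2 * (numEvents r k * N) + 1

/-- The weight of an event after the choice of the point `w`. -/
noncomputable def evStep (r k L N ev v w : ℕ) : ℕ :=
  min (evCap r k N) (v * evNum k L ev (evBit r k ev w) / evDen k L ev + 1)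

/-- The weight of an event after the choice of the points `c 0, …, c (J - 1)`. -/
noncomputable def evWeight (r k L N : ℕ) (c : ℕ → ℕ) (ev J : ℕ) : ℕ :=
  Nat.rec (motive := fun _ => ℕ) N (fun j v => evStep r k L N ev v (c j)) J

open Classical in
/-- The total weight after the choice of the points `c 0, …, c (J - 1)` and `w`. -/
noncomputable def potential (r k L N : ℕ) (c : ℕ → ℕ) (J w : ℕ) : ℕ :=
  ∑ ev ∈ Finset.range (numEvents r k),
    if EvInj r k ev then evStep r k L N ev (evWeight r k L N c ev J) w else 0

/-- The greedy choice of a point after the points `c 0, …, c (J - 1)`. -/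
noncomputable def choice (r k L N : ℕ) (c : ℕ → ℕ) (J : ℕ) : ℕ :=
  sInf {w | potential r k L N c J w ≤ numEvents r k * (N + J + 1) ∨ w = (2 ^ r) ^ k}

/-- The default `(2 ^ r) ^ k`, just outside the space of points, keeps the search set nonempty for
arbitrary `c`, as computability on all array contents requires. -/
theorem isLeast_choice (r k L N : ℕ) (c : ℕ → ℕ) (J : ℕ) :
    IsLeast {w | potential r k L N c J w ≤ numEvents r k * (N + J + 1) ∨ w = (2 ^ r) ^ k}
      (choice r k L N c J) :=
  ⟨Nat.sInf_mem ⟨_, Or.inr rfl⟩, fun _ h => Nat.sInf_le h⟩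

theorem choice_le (r k L N : ℕ) (c : ℕ → ℕ) (J : ℕ) : choice r k L N c J ≤ (2 ^ r) ^ k :=
  (isLeast_choice r k L N c J).2 (Or.inr rfl)

theorem evWeight_congr (r k L N : ℕ) {c c' : ℕ → ℕ} (ev : ℕ) {J : ℕ} (h : ∀ j < J, c j = c' j) :
    evWeight r k L N c ev J = evWeight r k L N c' ev J := by
  induction J with
  | zero => rfl
  | succ J ih =>
    have := ih fun j hj => h j (by omega)
    simp only [evWeight] at this ⊢
    rw [this, h J (by omega)]

/-- A choice looks only at earlier points, so the array of points can be filled from left to right.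
-/
theorem choice_congr (r k L N : ℕ) {c c' : ℕ → ℕ} {J : ℕ} (h : ∀ j < J, c j = c' j) :
    choice r k L N c J = choice r k L N c' J := by
  simp only [choice, potential, evWeight_congr r k L N _ h]

theorem evPos_lt (r k ev j : ℕ) : evPos r k ev j < 2 ^ r := Nat.mod_lt _ (by positivity)

theorem evPat_lt (k ev j : ℕ) : evPat k ev j < 2 := Nat.mod_lt _ two_pos

theorem evBit_le_one (r k ev w : ℕ) : evBit r k ev w ≤ 1 := by
  unfold evBit; split_ifs <;> simp

theorem EvInj.injective {r k ev : ℕ} (h : EvInj r k ev) :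
    Function.Injective fun j : Fin k => evPos r k ev j := by
  intro i j hij
  rcases lt_trichotomy (i : ℕ) j with h' | h' | h'
  · exact absurd hij.symm (h j j.2 i h')
  · exact Fin.ext h'
  · exact absurd hij (h i i.2 j h')

theorem sum_evBit {r k ev : ℕ} (hr : 1 ≤ r) (h : EvInj r k ev) :
    2 ^ k * ∑ w ∈ Finset.range ((2 ^ r) ^ k), evBit r k ev w = (2 ^ r) ^ k := by
  classical
  have e := card_ptBit_eq hr h.injective (fun j => evPos_lt _ _ _ _)
    (ξ := fun j : Fin k => evPat k ev j) (fun j => evPat_lt _ _ _)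
  rw [Finset.card_filter] at e
  refine Eq.trans ?_ e
  congr 1
  refine Finset.sum_congr rfl fun w _ => ?_
  simp only [evBit, Fin.forall_iff]

/-- The denominators are made for this: by exact `k`-wise independence the update factor of an event
with distinct positions has average exactly 1. -/
theorem sum_evNum {r k L ev : ℕ} (hr : 1 ≤ r) (hL : 2 ≤ L) (h : EvInj r k ev) :
    ∑ w ∈ Finset.range ((2 ^ r) ^ k), evNum k L ev (evBit r k ev w) =
      (2 ^ r) ^ k * evDen k L ev := by
  have hs := sum_evBit hr h
  have hK : 0 < 2 ^ k := by positivity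
  by_cases hev : ev % 2 = 0
  · simp only [evNum, evDen, hev, if_true]
    rw [← Finset.mul_sum, Finset.sum_add_distrib, mul_add, hs]
    simp
    ring
  · simp only [evNum, evDen, hev, if_false]
    rw [← Finset.mul_sum]
    generalize (2 ^ r) ^ k = W at hs ⊢
    have h1 : ∑ w ∈ Finset.range W, (L - evBit r k ev w) +
        ∑ w ∈ Finset.range W, evBit r k ev w = W * L := by
      rw [← Finset.sum_add_distrib, Finset.sum_congr rfl fun w _ =>
        Nat.sub_add_cancel ((evBit_le_one r k ev w).trans (by omega))]
      simp
    rw [Nat.mul_sub, mul_one]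
    refine Nat.eq_sub_of_add_eq ?_
    nth_rewrite 2 [← hs]
    rw [← mul_add, h1]
    ring

/-- The cap and the floor only lower the sum, so the added 1 is the whole average increase of a
weight. -/
theorem sum_evStep_le {r k L ev : ℕ} (N v : ℕ) (hr : 1 ≤ r) (hL : 2 ≤ L) (h : EvInj r k ev) :
    ∑ w ∈ Finset.range ((2 ^ r) ^ k), evStep r k L N ev v w ≤ (2 ^ r) ^ k * (v + 1) := by
  have hD : 0 < evDen k L ev := by
    unfold evDen
    have : 1 * 2 ≤ 2 ^ k * L := Nat.mul_le_mul (Nat.one_le_two_pow) hL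
    split_ifs <;> omega
  refine (Finset.sum_le_sum fun w _ => min_le_right _ _).trans ?_
  rw [Finset.sum_add_distrib, mul_add, mul_one]
  simp only [Finset.sum_const, Finset.card_range, smul_eq_mul, mul_one]
  refine Nat.add_le_add_right ?_ _
  refine Nat.le_of_mul_le_mul_right ?_ hD
  rw [Finset.sum_mul]
  refine (Finset.sum_le_sum fun w _ => Nat.div_mul_le_self _ _).trans ?_
  rw [← Finset.mul_sum, sum_evNum hr hL h]
  exact le_of_eq (by ring)

theorem exists_potential_le {r k L N J : ℕ} (hr : 1 ≤ r) (hL : 2 ≤ L) {c : ℕ → ℕ}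
    (h : (∑ ev ∈ Finset.range (numEvents r k), open Classical in
      if EvInj r k ev then evWeight r k L N c ev J else 0) ≤ numEvents r k * (N + J)) :
    ∃ w < (2 ^ r) ^ k, potential r k L N c J w ≤ numEvents r k * (N + J + 1) := by
  classical
  obtain ⟨w, hw, hle⟩ := Finset.exists_le_of_sum_le (s := Finset.range ((2 ^ r) ^ k))
    (f := fun w => potential r k L N c J w) (g := fun _ => numEvents r k * (N + J + 1))
    ⟨0, by simp⟩ (by
      simp only [potential]
      rw [Finset.sum_comm, Finset.sum_const, Finset.card_range, smul_eq_mul]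
      calc _ ≤ ∑ ev ∈ Finset.range (numEvents r k), (2 ^ r) ^ k *
            ((if EvInj r k ev then evWeight r k L N c ev J else 0) + 1) := by
            refine Finset.sum_le_sum fun ev _ => ?_
            by_cases hi : EvInj r k ev
            · simp only [hi, if_true]
              exact sum_evStep_le _ _ hr hL hi
            · simp [hi]
        _ ≤ _ := by
            rw [← Finset.mul_sum, Finset.sum_add_distrib, mul_add _ (N + J)]
            refine Nat.mul_le_mul_left _ ?_
            simpa using h)
  exact ⟨w, Finset.mem_range.1 hw, hle⟩

/-- Averaging over the points shows that in each step some point raises the total weight by at most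
one unit per event; the greedy rule finds such a point. -/
theorem choice_lt_and_potential_le {r k L N : ℕ} (hr : 1 ≤ r) (hL : 2 ≤ L) {c : ℕ → ℕ}
    (hc : ∀ j < N, c j = choice r k L N c j) (J : ℕ) (hJ : J ≤ N) :
    (∀ j < J, c j < (2 ^ r) ^ k) ∧ (∑ ev ∈ Finset.range (numEvents r k), open Classical in
      if EvInj r k ev then evWeight r k L N c ev J else 0) ≤ numEvents r k * (N + J) := by
  classical
  induction J with
  | zero =>
    refine ⟨by simp, ?_⟩
    refine (Finset.sum_le_card_nsmul _ _ N fun ev _ => ?_).trans (by simp)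
    split_ifs
    · exact le_rfl
    · exact Nat.zero_le _
  | succ J ih =>
    obtain ⟨h1, h2⟩ := ih (by omega)
    obtain ⟨w, hw, hle⟩ := exists_potential_le hr hL h2
    -- A genuine good point lies below the default, so the default is never selected.
    have hle' := (isLeast_choice r k L N c J).2 (Or.inl hle)
    have hlt := hle'.trans_lt hw
    rw [← hc J (by omega)] at hlt
    refine ⟨fun j hj => ?_, ?_⟩
    · rcases Nat.lt_succ_iff_lt_or_eq.1 hj with h | rfl
      · exact h1 j h
      · exact hlt
    · have hmem := (isLeast_choice r k L N c J).1
      rw [← hc J (by omega)] at hmem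
      exact hmem.resolve_right hlt.ne

end

theorem evDen_pos {k L : ℕ} (ev : ℕ) (hL : 2 ≤ L) : 0 < evDen k L ev := by
  unfold evDen
  have : 1 * 2 ≤ 2 ^ k * L := Nat.mul_le_mul (Nat.one_le_two_pow) hL
  split_ifs <;> omega

theorem evWeight_le {r k L N : ℕ} (hr : 1 ≤ r) (hL : 2 ≤ L) {c : ℕ → ℕ}
    (hc : ∀ j < N, c j = choice r k L N c j) {ev : ℕ} (hev : ev < numEvents r k)
    (hi : EvInj r k ev) {J : ℕ} (hJ : J ≤ N) :
    evWeight r k L N c ev J ≤ 2 * (numEvents r k * N) := by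
  classical
  have h := (choice_lt_and_potential_le hr hL hc J hJ).2
  have h1 := Finset.single_le_sum (f := fun ev => if EvInj r k ev then evWeight r k L N c ev J else 0)
    (fun _ _ => Nat.zero_le _) (Finset.mem_range.2 hev)
  simp only [hi, if_true] at h1
  calc _ ≤ numEvents r k * (N + J) := h1.trans h
    _ ≤ numEvents r k * (N + N) := Nat.mul_le_mul_left _ (by omega)
    _ = _ := by ring

/-- Floor plus 1 rounds up, so the integer weights dominate the exact products. The cap is inactive
because no weight exceeds `2 * (numEvents r k * N)`, one less than the cap. -/
theorem prod_le_evWeight {r k L N : ℕ} (hr : 1 ≤ r) (hL : 2 ≤ L) {c : ℕ → ℕ}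
    (hc : ∀ j < N, c j = choice r k L N c j) {ev : ℕ} (hev : ev < numEvents r k)
    (hi : EvInj r k ev) {J : ℕ} (hJ : J ≤ N) :
    (N : ℝ) * ∏ j ∈ Finset.range J, ((evNum k L ev (evBit r k ev (c j)) : ℝ) / evDen k L ev) ≤
      evWeight r k L N c ev J := by
  induction J with
  | zero => simp [evWeight]
  | succ J ih =>
    have hle := evWeight_le hr hL hc hev hi hJ
    have hD := evDen_pos (k := k) ev hL
    have hw : evWeight r k L N c ev (J + 1) =
        evStep r k L N ev (evWeight r k L N c ev J) (c J) := rfl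
    rw [hw, evStep] at hle ⊢
    have hmin : min (evCap r k N) (evWeight r k L N c ev J *
        evNum k L ev (evBit r k ev (c J)) / evDen k L ev + 1) = evWeight r k L N c ev J *
        evNum k L ev (evBit r k ev (c J)) / evDen k L ev + 1 := by
      refine min_eq_right (le_of_not_gt fun h => ?_)
      rw [min_eq_left h.le, evCap] at hle
      omega
    rw [hmin, Finset.prod_range_succ, ← mul_assoc]
    calc _ ≤ (evWeight r k L N c ev J : ℝ) *
          ((evNum k L ev (evBit r k ev (c J)) : ℝ) / evDen k L ev) :=
          mul_le_mul_of_nonneg_right (ih (by omega)) (by positivity)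
      _ ≤ _ := by
          rw [← mul_div_assoc, div_le_iff₀ (by exact_mod_cast hD), mul_comm (Nat.cast (_ + 1))]
          exact_mod_cast (Nat.lt_mul_div_succ _ hD).le

theorem prod_evNum_div_evDen_even {r k L ev : ℕ} (hL : 2 ≤ L) (hev : ev % 2 = 0) (c : ℕ → ℕ)
    (N : ℕ) : ∏ j ∈ Finset.range N, ((evNum k L ev (evBit r k ev (c j)) : ℝ) / evDen k L ev) =
      (1 + 1 / (L : ℝ)) ^ (∑ j ∈ Finset.range N, evBit r k ev (c j)) /
        (1 + 1 / (2 ^ k * L : ℝ)) ^ N := by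
  have hL' : (0 : ℝ) < L := by exact_mod_cast (by omega : 0 < L)
  have h : ∀ j ∈ Finset.range N, ((evNum k L ev (evBit r k ev (c j)) : ℝ) / evDen k L ev) =
      (1 + 1 / (L : ℝ)) ^ evBit r k ev (c j) / (1 + 1 / (2 ^ k * L : ℝ)) := by
    intro j _
    have := evBit_le_one r k ev (c j)
    generalize evBit r k ev (c j) = u at this
    simp only [evNum, evDen, hev, if_true]
    push_cast
    interval_cases u
    · field_simp; simp
    · field_simp; simp
  rw [Finset.prod_congr rfl h, Finset.prod_div_distrib, Finset.prod_pow_eq_pow_sum,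
    Finset.prod_const, Finset.card_range]

theorem prod_evNum_div_evDen_odd {r k L ev : ℕ} (hL : 2 ≤ L) (hev : ev % 2 ≠ 0) (c : ℕ → ℕ)
    (N : ℕ) : ∏ j ∈ Finset.range N, ((evNum k L ev (evBit r k ev (c j)) : ℝ) / evDen k L ev) =
      (1 - 1 / (L : ℝ)) ^ (∑ j ∈ Finset.range N, evBit r k ev (c j)) /
        (1 - 1 / (2 ^ k * L : ℝ)) ^ N := by
  have hL' : (2 : ℝ) ≤ L := by exact_mod_cast hL
  have hKL : 2 ≤ 2 ^ k * L := hL.trans (Nat.le_mul_of_pos_left _ (by positivity))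
  have hKL' : (2 : ℝ) ≤ 2 ^ k * L := by exact_mod_cast hKL
  have h1 : (2 : ℝ) ^ k * L - 1 ≠ 0 := by linarith
  have h : ∀ j ∈ Finset.range N, ((evNum k L ev (evBit r k ev (c j)) : ℝ) / evDen k L ev) =
      (1 - 1 / (L : ℝ)) ^ evBit r k ev (c j) / (1 - 1 / (2 ^ k * L : ℝ)) := by
    intro j _
    have := evBit_le_one r k ev (c j)
    generalize evBit r k ev (c j) = u at this
    simp only [evNum, evDen, hev, if_false]
    push_cast [Nat.cast_sub (this.trans (by omega : 1 ≤ L)),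
      Nat.cast_sub (by omega : 1 ≤ 2 ^ k * L)]
    interval_cases u
    · field_simp; simp
    · field_simp; simp
  rw [Finset.prod_congr rfl h, Finset.prod_div_distrib, Finset.prod_pow_eq_pow_sum,
    Finset.prod_const, Finset.card_range]

/-- If `c` were larger, the estimates `log (1 + 1/L) ≥ 2/(2L + 1)` and `log (1 + 1/(KL)) ≤ 1/(KL)`
would make the two logarithmic terms differ by at least `N K / (32 M²)`, which exceeds `log E`. The
choice `L K ≈ M` up to constants balances the gain against the second-order loss. -/
theorem deviation_upper {c N L K M E : ℝ} (hN : 0 < N) (hK : 1 ≤ K) (hM : K ≤ M)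
    (hL : 4 * M ≤ L * K) (hL' : L * K ≤ 8 * M) (hNE : Real.log E < N * K / (32 * M ^ 2))
    (h : c * Real.log (1 + 1 / L) ≤ Real.log E + N * Real.log (1 + 1 / (K * L))) :
    c - N / K ≤ N / (2 * M) := by
  by_contra! hcon
  have hM0 : 0 < M := by linarith
  have hK0 : 0 < K := by linarith
  have hL0 : 0 < L := by
    by_contra! h'
    nlinarith
  have h1 : 2 / (2 * L + 1) ≤ Real.log (1 + 1 / L) := by
    refine le_trans (le_of_eq ?_) (Real.le_log_one_add_of_nonneg (x := 1 / L) (by positivity))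
    field_simp
    ring
  have h2 : Real.log (1 + 1 / (K * L)) ≤ 1 / (K * L) := by
    have := Real.log_le_sub_one_of_pos (x := 1 + 1 / (K * L)) (by positivity)
    linarith
  have hc : N * (1 / K + 1 / (2 * M)) < c := by
    have : N * (1 / K + 1 / (2 * M)) = N / K + N / (2 * M) := by ring
    linarith
  have h3 : N * (1 / K + 1 / (2 * M)) * (2 / (2 * L + 1)) ≤ c * Real.log (1 + 1 / L) :=
    mul_le_mul hc.le h1 (by positivity) (le_trans (by positivity) hc.le)
  have h4 : N * Real.log (1 + 1 / (K * L)) ≤ N * (1 / (K * L)) := by gcongr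
  have h5 : N * (1 / K + 1 / (2 * M)) * (2 / (2 * L + 1)) - N * (1 / (K * L)) =
      N * (L * K / M - 1) / (K * L * (2 * L + 1)) := by
    field_simp
    ring
  have h6 : N * K / (32 * M ^ 2) ≤ N * (L * K / M - 1) / (K * L * (2 * L + 1)) := by
    have e : N * (L * K / M - 1) / (K * L * (2 * L + 1)) =
        N * (L * K - M) / (M * (K * L * (2 * L + 1))) := by
      field_simp
    rw [e, div_le_div_iff₀ (by positivity) (by positivity)]
    have hL1 : 4 ≤ L * K / M := by rw [le_div_iff₀ hM0]; exact hL
    set P := L * K with hP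
    have : K * (2 * L + 1) = 2 * P + K := by rw [hP]; ring
    have e2 : N * K * (M * (K * L * (2 * L + 1))) = (N * M) * (P * (2 * P + K)) := by
      rw [hP]; ring
    have e3 : N * (P - M) * (32 * M ^ 2) = (N * M) * ((P - M) * (32 * M)) := by ring
    rw [e2, e3]
    refine mul_le_mul_of_nonneg_left ?_ (by positivity)
    -- What remains is quadratic in `P = L * K` and holds on `4M ≤ P ≤ 8M` because `K ≤ M`.
    nlinarith
  linarith

/-- The mirror image, with `log (1 - 1/L) ≥ -1/(L - 1)`. -/
theorem deviation_lower {c N L K M E : ℝ} (hN : 0 < N) (hK : 1 ≤ K) (hM : K ≤ M)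
    (hL : 4 * M ≤ L * K) (hL' : L * K ≤ 8 * M) (hNE : Real.log E < N * K / (32 * M ^ 2))
    (hc0 : 0 ≤ c)
    (h : c * Real.log (1 - 1 / L) ≤ Real.log E + N * Real.log (1 - 1 / (K * L))) :
    N / K - c ≤ N / (2 * M) := by
  by_contra! hcon
  have hM0 : 0 < M := by linarith
  have hK0 : 0 < K := by linarith
  have hL4 : 4 ≤ L := by
    by_contra! h'
    nlinarith
  have hL1 : 0 < L - 1 := by linarith
  have hKL : 4 ≤ K * L := by nlinarith
  have h1 : -(1 / (L - 1)) ≤ Real.log (1 - 1 / L) := by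
    have hpos : 0 < 1 - 1 / L := by
      have : 1 / L ≤ 1 / 4 := one_div_le_one_div_of_le (by norm_num) hL4
      linarith
    refine le_trans (le_of_eq ?_) (Real.one_sub_inv_le_log_of_pos hpos)
    have : 1 - 1 / L = (L - 1) / L := by field_simp
    rw [this, inv_div]
    field_simp
    ring
  have h2 : Real.log (1 - 1 / (K * L)) ≤ -(1 / (K * L)) := by
    have : 1 / (K * L) ≤ 1 / 4 := one_div_le_one_div_of_le (by norm_num) hKL
    have := Real.log_le_sub_one_of_pos (x := 1 - 1 / (K * L)) (by linarith)
    linarith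
  have hc : c < N * (1 / K - 1 / (2 * M)) := by
    have : N * (1 / K - 1 / (2 * M)) = N / K - N / (2 * M) := by ring
    linarith
  have h3 : -(N * (1 / K - 1 / (2 * M)) * (1 / (L - 1))) ≤ c * Real.log (1 - 1 / L) := by
    have h31 : c * (1 / (L - 1)) ≤ N * (1 / K - 1 / (2 * M)) * (1 / (L - 1)) := by gcongr
    have h32 : c * -(1 / (L - 1)) ≤ c * Real.log (1 - 1 / L) := mul_le_mul_of_nonneg_left h1 hc0
    linarith
  have h4 : N * Real.log (1 - 1 / (K * L)) ≤ N * -(1 / (K * L)) :=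
    mul_le_mul_of_nonneg_left h2 hN.le
  have h5 : N * (1 / (K * L)) - N * (1 / K - 1 / (2 * M)) * (1 / (L - 1)) =
      N * (L * K - 2 * M) / (2 * M * (K * L * (L - 1))) := by
    field_simp
    ring
  have h6 : N * K / (32 * M ^ 2) ≤ N * (L * K - 2 * M) / (2 * M * (K * L * (L - 1))) := by
    rw [div_le_div_iff₀ (by positivity) (by positivity)]
    set P := L * K with hP
    have e2 : N * K * (2 * M * (K * L * (L - 1))) = (2 * N * M) * (P * (P - K)) := by
      rw [hP]; ring
    have e3 : N * (P - 2 * M) * (32 * M ^ 2) = (2 * N * M) * ((P - 2 * M) * (16 * M)) := by ring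
    rw [e2, e3]
    refine mul_le_mul_of_nonneg_left ?_ (by positivity)
    nlinarith
  linarith

theorem evPos_encode {r k σ ξ t : ℕ} (hσ : σ < 2) (hξ : ξ < 2 ^ k) (j : ℕ) :
    evPos r k (σ + 2 * (ξ + 2 ^ k * t)) j = t / (2 ^ r) ^ j % 2 ^ r := by
  rw [evPos, Nat.add_mul_div_left _ _ two_pos, Nat.div_eq_of_lt hσ, zero_add,
    Nat.add_mul_div_left _ _ (by positivity), Nat.div_eq_of_lt hξ, zero_add]

theorem evPat_encode {k σ ξ t : ℕ} (hσ : σ < 2) (hξ : ξ < 2 ^ k) (j : ℕ) :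
    evPat k (σ + 2 * (ξ + 2 ^ k * t)) j = ξ / 2 ^ j % 2 := by
  rw [evPat, Nat.add_mul_div_left _ _ two_pos, Nat.div_eq_of_lt hσ, zero_add,
    Nat.add_mul_mod_self_left, Nat.mod_eq_of_lt hξ]

theorem exists_event {r k : ℕ} (σ : ℕ) (hσ : σ < 2) {x ξ : Fin k → ℕ}
    (hx : Function.Injective x) (hx' : ∀ j, x j < 2 ^ r) (hξ : ∀ j, ξ j < 2) :
    ∃ ev < numEvents r k, ev % 2 = σ ∧ EvInj r k ev ∧ ∀ w, evBit r k ev w =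
      open Classical in if ∀ j, ptBit r k w (x j) = ξ j then 1 else 0 := by
  obtain ⟨t, ht, hxt⟩ := exists_digits k x hx'
  obtain ⟨z, hz, hξz⟩ := exists_digits k ξ hξ
  refine ⟨σ + 2 * (z + 2 ^ k * t), ?_, by omega, ?_, fun w => ?_⟩
  · have : z + 2 ^ k * t < 2 ^ k * (2 ^ r) ^ k := by
      calc z + 2 ^ k * t < 2 ^ k + 2 ^ k * t := Nat.add_lt_add_right hz _
        _ = 2 ^ k * (t + 1) := by ring
        _ ≤ _ := Nat.mul_le_mul_left _ ht
    unfold numEvents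
    omega
  · intro j hj l hl
    rw [evPos_encode hσ hz, evPos_encode hσ hz, hxt ⟨j, hj⟩, hxt ⟨l, hl.trans hj⟩]
    intro h
    have := congrArg Fin.val (hx h)
    simp only at this
    omega
  · simp only [evBit, evPos_encode hσ hz, evPat_encode hσ hz]
    congr 1
    rw [← iff_eq_eq]
    constructor
    · intro h j
      have := h j j.2
      rwa [hxt j, hξz j] at this
    · intro h j hj
      have := h ⟨j, hj⟩
      rwa [← hxt, ← hξz] at this

open Classical in
-- Dividing the final weight bound by the initial weight `N` bounds the product of all factors by `2
-- * numEvents r k`. Logarithms turn this into a bound for the count: events of even number exclude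
-- too many occurrences of the pattern, those of odd number too few.
theorem abs_card_choice_sub_le {r k L N M : ℕ} (hr : 1 ≤ r) (hN : 0 < N) (hM : 2 ^ k ≤ M)
    (hL : 4 * M ≤ L * 2 ^ k) (hL' : L * 2 ^ k ≤ 8 * M)
    (hNE : Real.log (2 * numEvents r k) < N * 2 ^ k / (32 * (M : ℝ) ^ 2)) {c : ℕ → ℕ}
    (hc : ∀ j < N, c j = choice r k L N c j) {x ξ : Fin k → ℕ}
    (hx : Function.Injective x) (hx' : ∀ j, x j < 2 ^ r) (hξ : ∀ j, ξ j < 2) :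
    |(((Finset.range N).filter fun j => ∀ i, ptBit r k (c j) (x i) = ξ i).card : ℝ) - N / 2 ^ k| ≤
      N / (2 * M) := by
  have hK : 1 ≤ 2 ^ k := Nat.one_le_two_pow
  have hL4 : 4 ≤ L := by
    by_contra! h
    have : L * 2 ^ k ≤ 3 * 2 ^ k := Nat.mul_le_mul_right _ (by omega)
    omega
  have hL2 : 2 ≤ L := by omega
  have hE : 0 < numEvents r k := by unfold numEvents; positivity
  have hNR : (0 : ℝ) < N := by exact_mod_cast hN
  have hER : (0 : ℝ) < 2 * numEvents r k := by exact_mod_cast (by omega : 0 < 2 * numEvents r k)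
  have hKR : (1 : ℝ) ≤ 2 ^ k := by exact_mod_cast hK
  have hMR : (2 : ℝ) ^ k ≤ M := by exact_mod_cast hM
  have hLR : 4 * (M : ℝ) ≤ L * 2 ^ k := by exact_mod_cast hL
  have hLR' : (L : ℝ) * 2 ^ k ≤ 8 * M := by exact_mod_cast hL'
  have hL4R : (4 : ℝ) ≤ L := by exact_mod_cast hL4
  have hKL : (4 : ℝ) ≤ 2 ^ k * L := by nlinarith
  set C := ((Finset.range N).filter fun j => ∀ i, ptBit r k (c j) (x i) = ξ i).card with hC
  have hprod : ∀ ev < numEvents r k, EvInj r k ev →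
      ∏ j ∈ Finset.range N, ((evNum k L ev (evBit r k ev (c j)) : ℝ) / evDen k L ev) ≤
        2 * numEvents r k := by
    intro ev hev hi
    have h1 := prod_le_evWeight hr hL2 hc hev hi le_rfl
    have h2 : (evWeight r k L N c ev N : ℝ) ≤ 2 * (numEvents r k * N) := by
      exact_mod_cast evWeight_le hr hL2 hc hev hi le_rfl
    have h3 := h1.trans h2
    rw [← mul_assoc, mul_comm] at h3
    exact le_of_mul_le_mul_right h3 hNR
  have hcount : ∀ ev, (∀ w, evBit r k ev w = if ∀ j, ptBit r k w (x j) = ξ j then 1 else 0) →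
      ∑ j ∈ Finset.range N, evBit r k ev (c j) = C := by
    intro ev h
    rw [hC, Finset.card_filter]
    exact Finset.sum_congr rfl fun j _ => h _
  rw [abs_le]
  constructor
  · obtain ⟨ev, hev, hσ, hi, hb⟩ := exists_event (r := r) 1 (by norm_num) hx hx' hξ
    have h := hprod ev hev hi
    rw [prod_evNum_div_evDen_odd hL2 (by omega), hcount ev hb] at h
    have p1 : 1 / (L : ℝ) ≤ 1 / 4 := one_div_le_one_div_of_le (by norm_num) hL4R
    have p2 : 1 / (2 ^ k * L : ℝ) ≤ 1 / 4 := one_div_le_one_div_of_le (by norm_num) hKL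
    have q1 : 0 < 1 - 1 / (L : ℝ) := by linarith
    have q2 : 0 < 1 - 1 / (2 ^ k * L : ℝ) := by linarith
    rw [div_le_iff₀ (by positivity)] at h
    have h' := Real.log_le_log (by positivity) h
    rw [Real.log_pow, Real.log_mul hER.ne' (by positivity), Real.log_pow] at h'
    have := deviation_lower (c := C) hNR hKR hMR hLR hLR' hNE (by positivity) h'
    linarith
  · obtain ⟨ev, hev, hσ, hi, hb⟩ := exists_event (r := r) 0 (by norm_num) hx hx' hξ
    have h := hprod ev hev hi
    rw [prod_evNum_div_evDen_even hL2 hσ, hcount ev hb] at h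
    rw [div_le_iff₀ (by positivity)] at h
    have h' := Real.log_le_log (by positivity) h
    rw [Real.log_pow, Real.log_mul hER.ne' (by positivity), Real.log_pow] at h'
    exact deviation_upper (c := C) hNR hKR hMR hLR hLR' hNE h'

/-- The entry `i` of the vector number `x` of the sample space made of the points `c`. -/
noncomputable def hashBit (r e k N : ℕ) (c : ℕ → ℕ) (x i : ℕ) : ℕ :=
  ptBit r k (c (x % N)) (digitEval r e i (x / N))

/-- The error is split in halves: a fraction at most `1/(2M)` of the `a` is not injective on the
positions and is estimated trivially, and every other `a` contributes a relative error at most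
`1/(2M)` from the greedy points. -/
theorem abs_card_hashBit_sub_le {r e k L N M : ℕ} (hr : 1 ≤ r) (hN : 0 < N) (hM : 2 ^ k ≤ M)
    (hL : 4 * M ≤ L * 2 ^ k) (hL' : L * 2 ^ k ≤ 8 * M)
    (hNE : Real.log (2 * numEvents r k) < N * 2 ^ k / (32 * (M : ℝ) ^ 2)) {c : ℕ → ℕ}
    (hc : ∀ j < N, c j = choice r k L N c j) (hq : 2 * (k ^ 2 * e) * M ≤ 2 ^ r) {I ξ : Fin k → ℕ}
    (hI : Function.Injective I) (hI' : ∀ j, I j < (2 ^ r) ^ e) (hξ : ∀ j, ξ j < 2) :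
    |(((Finset.range (2 ^ r * N)).filter fun x => ∀ j, hashBit r e k N c x (I j) = ξ j).card : ℝ)
      - (2 ^ r * N : ℝ) / 2 ^ k| ≤ (2 ^ r * N : ℝ) / M := by
  classical
  have hMR : (0 : ℝ) < M := by
    exact_mod_cast lt_of_lt_of_le (by positivity : 0 < 2 ^ k) hM
  have hNR : (0 : ℝ) < N := by exact_mod_cast hN
  let C : ℕ → ℕ := fun a => ((Finset.range N).filter fun j =>
    ∀ i, ptBit r k (c j) (digitEval r e (I i) a) = ξ i).card
  have hcard : ((Finset.range (2 ^ r * N)).filter fun x =>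
      ∀ j, hashBit r e k N c x (I j) = ξ j).card = ∑ a ∈ Finset.range (2 ^ r), C a := by
    have := card_filter_range_mul (2 ^ r) N fun a b =>
      ∀ j, ptBit r k (c b) (digitEval r e (I j) a) = ξ j
    refine (Eq.trans ?_ this).trans ?_
    · rfl
    · rw [Finset.card_filter, Finset.sum_product]
      exact Finset.sum_congr rfl fun a _ => (Finset.card_filter _ _).symm
  let B : ℕ → Prop := fun a => ¬ Function.Injective fun j => digitEval r e (I j) a
  have hdev : ∀ a ∈ Finset.range (2 ^ r), |(C a : ℝ) - N / 2 ^ k| ≤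
      N / (2 * M) + (if B a then 1 else 0) * N := by
    intro a ha
    by_cases hB : B a
    · rw [if_pos hB, one_mul]
      have h1 : (C a : ℝ) ≤ N := by
        have : C a ≤ N := (Finset.card_filter_le _ _).trans (by simp)
        exact_mod_cast this
      have h2 : (N : ℝ) / 2 ^ k ≤ N := div_le_self hNR.le (one_le_pow₀ (by norm_num))
      have h3 : (0 : ℝ) ≤ C a := by positivity
      have h4 : (0 : ℝ) ≤ N / 2 ^ k := by positivity
      have h5 : (0 : ℝ) ≤ N / (2 * M) := by positivity
      rw [abs_le]
      constructor <;> linarith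
    · rw [if_neg hB, zero_mul, add_zero]
      exact abs_card_choice_sub_le hr hN hM hL hL' hNE hc (not_not.1 hB)
        (fun j => digitEval_lt (Finset.mem_range.1 ha)) hξ
  have hbad : ((Finset.range (2 ^ r)).filter B).card ≤ k ^ 2 * e :=
    card_not_injective_digitEval_le hr hI hI'
  have hbad' : (((Finset.range (2 ^ r)).filter B).card : ℝ) * (2 * M) ≤ 2 ^ r := by
    have : ((Finset.range (2 ^ r)).filter B).card * (2 * M) ≤ 2 ^ r :=
      (Nat.mul_le_mul_right _ hbad).trans (le_trans (le_of_eq (by ring)) hq)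
    exact_mod_cast this
  have hsum : (2 ^ r * N : ℝ) / 2 ^ k = ∑ _a ∈ Finset.range (2 ^ r), (N : ℝ) / 2 ^ k := by
    simp; ring
  rw [hcard, hsum, Nat.cast_sum, ← Finset.sum_sub_distrib]
  refine (Finset.abs_sum_le_sum_abs _ _).trans ((Finset.sum_le_sum hdev).trans ?_)
  rw [Finset.sum_add_distrib, ← Finset.sum_mul, ← Finset.natCast_card_filter]
  simp only [Finset.sum_const, Finset.card_range, nsmul_eq_mul]
  push_cast
  have h1 : (((Finset.range (2 ^ r)).filter B).card : ℝ) ≤ 2 ^ r / (2 * M) := by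
    rwa [le_div_iff₀ (by positivity)]
  calc _ ≤ (2 : ℝ) ^ r * (N / (2 * M)) + 2 ^ r / (2 * M) * N := by gcongr
    _ = _ := by field_simp; ring

/-! ### Computability of the greedy selection -/

namespace RAM

open Ctx

variable {α : Type} [Ctx α]

theorem Comp.min {f g : α → ℕ} (hf : Comp f) (hg : Comp g) : Comp fun a => min (f a) (g a) :=
  (Comp.ite (hf.le hg) hf hg).of_eq fun _ => (min_def _ _).symm

theorem Comp.ptBit {r k w x : α → ℕ} (hr : Comp r) (hr2 : PB fun a => 2 ^ r a) (hk : Comp k)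
    (hw : Comp w) (hx : Comp x) : Comp fun a => ptBit (r a) (k a) (w a) (x a) :=
  (Comp.digitEval hr hr2 hk hw hx).mod (.const 2)

/-- The parameters of the greedy selection are computable, and the numbers of points and of
patterns are polynomially bounded. -/
structure GreedyComp (r k L N : α → ℕ) : Prop where
  comp_r : Comp r
  comp_k : Comp k
  comp_L : Comp L
  comp_N : Comp N
  field : PB fun a => 2 ^ r a
  patterns : PB fun a => 2 ^ k a
  points : PB fun a => (2 ^ r a) ^ k a

theorem GreedyComp.weaken {r k L N : α → ℕ} (h : GreedyComp r k L N) :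
    GreedyComp (α := α × ℕ) (fun p => r p.1) (fun p => k p.1) (fun p => L p.1) fun p => N p.1 :=
  ⟨h.comp_r.weaken, h.comp_k.weaken, h.comp_L.weaken, h.comp_N.weaken, h.field.weaken, h.patterns.weaken,
    h.points.weaken⟩

variable {r k L N : α → ℕ}

theorem GreedyComp.two_pow_r (h : GreedyComp r k L N) : Comp fun a => 2 ^ r a :=
  Comp.pow (.const 2) h.comp_r h.field

theorem GreedyComp.two_pow_k (h : GreedyComp r k L N) : Comp fun a => 2 ^ k a :=
  Comp.pow (.const 2) h.comp_k h.patterns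

theorem GreedyComp.pow_pow (h : GreedyComp r k L N) : Comp fun a => (2 ^ r a) ^ k a :=
  Comp.pow h.two_pow_r h.comp_k h.points

theorem GreedyComp.numEvents (h : GreedyComp r k L N) : Comp fun a => numEvents (r a) (k a) :=
  (Comp.const 2).mul (h.two_pow_k.mul h.pow_pow)

theorem GreedyComp.evCap (h : GreedyComp r k L N) : Comp fun a => evCap (r a) (k a) (N a) :=
  ((Comp.const 2).mul (h.numEvents.mul h.comp_N)).add (.const 1)

theorem GreedyComp.evPos (h : GreedyComp r k L N) {ev j : α → ℕ} (hev : Comp ev) (hj : Comp j) :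
    Comp fun a => evPos (r a) (k a) (ev a) (j a) :=
  ((hev.div (.const 2)).div h.two_pow_k).digit h.two_pow_r hj

theorem GreedyComp.evPat (h : GreedyComp r k L N) {ev j : α → ℕ} (hev : Comp ev) (hj : Comp j) :
    Comp fun a => evPat (k a) (ev a) (j a) :=
  ((hev.div (.const 2)).mod h.two_pow_k).digit (.const 2) hj

theorem GreedyComp.evInj (h : GreedyComp r k L N) {ev : α → ℕ} (hev : Comp ev) :
    CompP fun a => EvInj (r a) (k a) (ev a) :=
  CompP.forall_lt h.comp_k (CompP.forall_lt .snd
    ((h.weaken.weaken.evPos hev.weaken.weaken Comp.snd.weaken).eq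
      (h.weaken.weaken.evPos hev.weaken.weaken .snd)).not)

theorem GreedyComp.evBit (h : GreedyComp r k L N) {ev w : α → ℕ} (hev : Comp ev) (hw : Comp w) :
    Comp fun a => evBit (r a) (k a) (ev a) (w a) :=
  Comp.ite (CompP.forall_lt h.comp_k ((Comp.ptBit h.weaken.comp_r h.weaken.field h.weaken.comp_k hw.weaken
    (h.weaken.evPos hev.weaken .snd)).eq (h.weaken.evPat hev.weaken .snd))) (.const 1) (.const 0)

theorem GreedyComp.evNum (h : GreedyComp r k L N) {ev u : α → ℕ} (hev : Comp ev) (hu : Comp u) :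
    Comp fun a => evNum (k a) (L a) (ev a) (u a) :=
  Comp.ite ((hev.mod (.const 2)).eq (.const 0)) (h.two_pow_k.mul (h.comp_L.add hu))
    (h.two_pow_k.mul (h.comp_L.sub hu))

theorem GreedyComp.evDen (h : GreedyComp r k L N) {ev : α → ℕ} (hev : Comp ev) :
    Comp fun a => evDen (k a) (L a) (ev a) :=
  Comp.ite ((hev.mod (.const 2)).eq (.const 0)) ((h.two_pow_k.mul h.comp_L).add (.const 1))
    ((h.two_pow_k.mul h.comp_L).sub (.const 1))

theorem GreedyComp.evStep (h : GreedyComp r k L N) {ev v w : α → ℕ} (hev : Comp ev) (hv : Comp v)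
    (hw : Comp w) : Comp fun a => evStep (r a) (k a) (L a) (N a) (ev a) (v a) (w a) :=
  h.evCap.min (((hv.mul (h.evNum hev (h.evBit hev hw))).div (h.evDen hev)).add (.const 1))

/-- This is what the cap is for: it bounds the recursion for arbitrary array contents, not only for
points chosen greedily. -/
theorem GreedyComp.evWeight (h : GreedyComp r k L N) {ev J : α → ℕ} (hev : Comp ev)
    (hJ : Comp J) :
    Comp fun a => evWeight (r a) (k a) (L a) (N a) (arr a) (ev a) (J a) := by
  refine Comp.natRec
    (step := fun a j v => _root_.evStep (r a) (k a) (L a) (N a) (ev a) v (arr a j)) h.comp_N hJ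
    (h.weaken.weaken.evStep hev.weaken.weaken .snd (Comp.get Comp.snd.weaken))
    (h.evCap.bdd.add h.comp_N.bdd) fun a i _ => ?_
  cases i with
  | zero => exact Nat.le_add_left _ _
  | succ i => exact (min_le_left _ _).trans (Nat.le_add_right _ _)

open Classical in
theorem GreedyComp.potential (h : GreedyComp r k L N) {J w : α → ℕ} (hJ : Comp J) (hw : Comp w) :
    Comp fun a => potential (r a) (k a) (L a) (N a) (arr a) (J a) (w a) :=
  Comp.sum h.numEvents (Comp.ite (h.weaken.evInj .snd)
    (h.weaken.evStep .snd (h.weaken.evWeight .snd hJ.weaken) hw.weaken) (.const 0))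

theorem GreedyComp.choice (h : GreedyComp r k L N) {J : α → ℕ} (hJ : Comp J) :
    Comp fun a => choice (r a) (k a) (L a) (N a) (arr a) (J a) := by
  refine Comp.isLeast h.pow_pow ?_ (fun a => isLeast_choice _ _ _ _ _ _)
    fun a => choice_le _ _ _ _ _ _
  refine (((h.weaken.potential hJ.weaken .snd).le (h.weaken.numEvents.mul
    ((h.weaken.comp_N.add hJ.weaken).add (.const 1)))).not.and
    (Comp.snd.eq h.weaken.pow_pow).not).not.of_iff fun p => ?_
  exact (not_and_or.trans (or_congr not_not not_not))

theorem GreedyComp.hashBit (h : GreedyComp r k L N) {e x i : α → ℕ} (he : Comp e) (hx : Comp x)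
    (hi : Comp i) : Comp fun a => hashBit (r a) (e a) (k a) (N a) (arr a) (x a) (i a) :=
  Comp.ptBit h.comp_r h.field h.comp_k (Comp.get (hx.mod h.comp_N))
    (Comp.digitEval h.comp_r h.field he hi (hx.div h.comp_N))

end RAM

/-! ### From counting to almost `k`-wise independence -/

/-- All fibres of the restriction have the same size, since translation by an extension of `ξ + η`
exchanges the fibres over `ξ` and `η`. -/
theorem card_restrict_eq {n k : ℕ} (I : Fin k ↪o Fin n) (ξ : Fin k → Bool) :
    2 ^ k * (Finset.univ.filter fun a : Fin n → Bool => ξ = fun j => a (I j)).card = 2 ^ n := by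
  classical
  have hconst : ∀ η : Fin k → Bool,
      (Finset.univ.filter fun a : Fin n → Bool => η = fun j => a (I j)).card =
      (Finset.univ.filter fun a : Fin n → Bool => ξ = fun j => a (I j)).card := by
    intro η
    let s : Fin n → Bool := Function.extend I (fun j => xor (ξ j) (η j)) fun _ => false
    have hs : ∀ j, s (I j) = xor (ξ j) (η j) := fun j => I.injective.extend_apply _ _ _
    refine Finset.card_nbij' (fun a i => xor (a i) (s i)) (fun a i => xor (a i) (s i)) ?_ ?_ ?_ ?_
    · intro a ha
      simp only [Finset.coe_filter, Finset.mem_univ, true_and, Set.mem_ofPred_eq] at ha ⊢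
      subst ha
      funext j
      simp only [hs]
      cases a (I j) <;> cases ξ j <;> rfl
    · intro a ha
      simp only [Finset.coe_filter, Finset.mem_univ, true_and, Set.mem_ofPred_eq] at ha ⊢
      subst ha
      funext j
      simp only [hs]
      cases a (I j) <;> cases η j <;> rfl
    · intro a _
      funext i
      simp
    · intro a _
      funext i
      simp
  have h := Finset.card_eq_sum_card_fiberwise (s := (Finset.univ : Finset (Fin n → Bool)))
    (t := (Finset.univ : Finset (Fin k → Bool))) (f := fun a j => a (I j)) (by simp)
  have h2 : ∀ η : Fin k → Bool, (Finset.univ.filter fun a : Fin n → Bool =>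
      (fun j => a (I j)) = η).card =
      (Finset.univ.filter fun a : Fin n → Bool => ξ = fun j => a (I j)).card := by
    intro η
    rw [← hconst η]
    congr 1
    ext a
    simp [eq_comm]
  rw [Finset.sum_congr rfl fun η _ => h2 η] at h
  simpa using h.symm

theorem restrictPMF_apply {n k : ℕ} (Q : PMF (Fin n → Bool)) (I : Fin k ↪o Fin n)
    (ξ : Fin k → Bool) : (restrictPMF Q I ξ).toReal =
      ∑ a : Fin n → Bool, if ξ = fun j => a (I j) then (Q a).toReal else 0 := by
  classical
  rw [restrictPMF, PMF.map_apply, tsum_fintype, ENNReal.toReal_sum]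
  · refine Finset.sum_congr rfl fun a _ => ?_
    split_ifs <;> simp
  · intro a _
    split_ifs
    · exact PMF.apply_ne_top _ _
    · simp

theorem restrictPMF_uniform {n k : ℕ} (I : Fin k ↪o Fin n) (ξ : Fin k → Bool) :
    (restrictPMF (PMF.uniformOfFintype (Fin n → Bool)) I ξ).toReal = 1 / 2 ^ k := by
  classical
  rw [restrictPMF_apply]
  simp only [PMF.uniformOfFintype_apply]
  rw [← Finset.sum_filter, Finset.sum_const, nsmul_eq_mul]
  have h : (2 : ℝ) ^ k *
      (Finset.univ.filter fun a : Fin n → Bool => ξ = fun j => a (I j)).card = 2 ^ n := by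
    exact_mod_cast card_restrict_eq I ξ
  simp only [Fintype.card_pi, Fintype.card_bool, Finset.prod_const, Finset.card_univ,
    Fintype.card_fin, ENNReal.toReal_inv, Nat.cast_pow, Nat.cast_ofNat, ENNReal.toReal_pow,
    ENNReal.toReal_ofNat]
  field_simp
  linarith

/-- The list of the rows `0, …, S - 1` of the `0/1` table `g`, as vectors of length `n`. -/
def rowList (n S : ℕ) (g : ℕ → ℕ → ℕ) : List (Fin n → Bool) :=
  List.ofFn fun (x : Fin S) (i : Fin n) => decide (g x i = 1)

theorem length_rowList (n S : ℕ) (g : ℕ → ℕ → ℕ) : (rowList n S g).length = S := by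
  simp [rowList]

theorem restrictPMF_ofMultiset {n k S : ℕ} {g : ℕ → ℕ → ℕ} (hg : ∀ x i, g x i < 2)
    (h : (rowList n S g : Multiset (Fin n → Bool)) ≠ 0) (I : Fin k ↪o Fin n) (ξ : Fin k → Bool) :
    (restrictPMF (PMF.ofMultiset (rowList n S g) h) I ξ).toReal =
      ((Finset.range S).filter fun x => ∀ j, g x (I j) = (ξ j).toNat).card / S := by
  classical
  rw [restrictPMF_apply]
  have hcoe : ((rowList n S g : List _) : Multiset (Fin n → Bool)) =
      (Finset.univ : Finset (Fin S)).val.map fun (x : Fin S) (i : Fin n) => decide (g x i = 1) :=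
    (Fin.univ_val_map _).symm
  have hQ : ∀ a, (PMF.ofMultiset (rowList n S g) h a).toReal =
      (∑ x : Fin S, if a = (fun i : Fin n => decide (g x i = 1)) then (1 : ℝ) else 0) / S := by
    intro a
    rw [PMF.ofMultiset_apply, ENNReal.toReal_div, ENNReal.toReal_natCast, ENNReal.toReal_natCast,
      Multiset.coe_card, length_rowList, hcoe, Multiset.count_map, Finset.sum_boole,
      Finset.card_def, Finset.filter_val]
    congr!
  simp only [hQ]
  rw [← Finset.sum_filter, ← Finset.sum_div]
  congr 1
  rw [Finset.sum_comm, Finset.natCast_card_filter, Finset.sum_range]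
  refine Finset.sum_congr rfl fun x _ => ?_
  rw [Finset.sum_ite_eq']
  simp only [Finset.mem_filter, Finset.mem_univ, true_and]
  congr 1
  rw [← iff_eq_eq, funext_iff]
  refine forall_congr' fun j => ?_
  have := hg x (I j)
  generalize g x (I j) = y at this
  interval_cases y <;> cases ξ j <;> simp

theorem isAlmostKWiseIndepSet_rowList {n k S : ℕ} {ε : ℝ} {g : ℕ → ℕ → ℕ} (hS : 0 < S)
    (hε : 0 ≤ ε) (hg : ∀ x i, g x i < 2)
    (h : ∀ I : Fin k → ℕ, Function.Injective I → (∀ j, I j < n) → ∀ ξ : Fin k → ℕ,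
      (∀ j, ξ j < 2) → |(((Finset.range S).filter fun x => ∀ j, g x (I j) = ξ j).card : ℝ) -
        S / 2 ^ k| ≤ S * ε) :
    IsAlmostKWiseIndepSet ε k (rowList n S g : Multiset (Fin n → Bool)) := by
  have h0 : (rowList n S g : Multiset (Fin n → Bool)) ≠ 0 := by
    rw [Ne, Multiset.coe_eq_zero, ← List.length_eq_zero_iff, length_rowList]
    omega
  refine ⟨h0, fun I => Real.iSup_le (fun ξ => ?_) hε⟩
  rw [restrictPMF_uniform, restrictPMF_ofMultiset hg]
  have hSR : (0 : ℝ) < S := by exact_mod_cast hS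
  have := h (fun j => I j) (fun i j hij => I.injective (Fin.ext hij)) (fun j => (I j).2)
    (fun j => (ξ j).toNat) (fun j => (ξ j).toNat_lt)
  rw [div_sub' hSR.ne', abs_div, abs_of_pos hSR, div_le_iff₀ hSR, mul_comm ε]
  rwa [mul_one_div]

/-! ### Parameters -/

/-- The least degree `r` of a binary field with more than `A * (R / r + 1)` elements. -/
noncomputable def degree (A R : ℕ) : ℕ := sInf {r | A * (R / r + 1) < 2 ^ r}

theorem degree_bound_mem (A R : ℕ) : A * (R / (A * (R + 1)) + 1) < 2 ^ (A * (R + 1)) :=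
  (Nat.mul_le_mul_left _ (Nat.succ_le_succ (Nat.div_le_self _ _))).trans_lt Nat.lt_two_pow_self

theorem isLeast_degree (A R : ℕ) : IsLeast {r | A * (R / r + 1) < 2 ^ r} (degree A R) :=
  ⟨Nat.sInf_mem ⟨_, degree_bound_mem A R⟩, fun _ h => Nat.sInf_le h⟩

theorem degree_le (A R : ℕ) : degree A R ≤ A * (R + 1) :=
  (isLeast_degree A R).2 (degree_bound_mem A R)

theorem lt_two_pow_degree (A R : ℕ) : A * (R / degree A R + 1) < 2 ^ degree A R :=
  (isLeast_degree A R).1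

/-- By minimality the exponent one smaller fails, and doubling gives the bound; the final 1 covers
degree 0. -/
theorem two_pow_degree_le (A R : ℕ) :
    2 ^ degree A R ≤ 2 * (A * (R / (degree A R - 1) + 1)) + 1 := by
  rcases Nat.eq_zero_or_pos (degree A R) with h | h
  · simp [h]
  · have : ¬ A * (R / (degree A R - 1) + 1) < 2 ^ (degree A R - 1) := fun h' => by
      have := (isLeast_degree A R).2 h'
      omega
    have e : 2 ^ degree A R = 2 ^ (degree A R - 1) * 2 := by
      rw [← pow_succ]; congr 1; omega
    omega

theorem two_pow_degree_le' {A : ℕ} (hA : 1 ≤ A) (R : ℕ) :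
    2 ^ degree A R ≤ 2 * (A * (R / (degree A R - 1) + 1)) := by
  have h := two_pow_degree_le A R
  have h1 := lt_two_pow_degree A R
  have hA' : A * 1 ≤ A * (R / degree A R + 1) := Nat.mul_le_mul_left _ (Nat.le_add_left 1 _)
  -- At degree 0 the quotient `R / 0` is 0, so the defining inequality would read `A < 1`.
  have h2 : degree A R ≠ 0 := by
    intro h0
    rw [h0] at h1
    rw [h0] at hA'
    omega
  have e : 2 ^ degree A R = 2 ^ (degree A R - 1) * 2 := by
    rw [← pow_succ]; congr 1; omega
  omega

theorem lt_degree {A R k : ℕ} (h : 2 ^ k ≤ A) : k < degree A R := by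
  have h1 := lt_two_pow_degree A R
  have hA' : A * 1 ≤ A * (R / degree A R + 1) := Nat.mul_le_mul_left _ (Nat.le_add_left 1 _)
  exact (Nat.pow_lt_pow_iff_right (by norm_num : 1 < 2)).1 (by omega)

theorem le_succ_div_mul (R r : ℕ) (hr : 1 ≤ r) : R ≤ (R / r + 1) * r := by
  have := Nat.lt_mul_div_succ R hr
  rw [mul_comm]
  exact this.le

section small_bias

variable (n k M : ℕ)

/-- The degree of the field of the small-bias space. -/
noncomputable def biasDeg : ℕ := degree (k * M) n.size

/-- The size of the small-bias space. -/
noncomputable def biasSize : ℕ := 2 ^ biasDeg n k M * 2 ^ biasDeg n k M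

/-- The entries of the small-bias space. -/
noncomputable def biasTable (x i : ℕ) : ℕ :=
  biasBit n.size (biasDeg n k M) (n.size / biasDeg n k M + 1) k x i

variable {n k M}

/-- Since `k` is less than the degree, `k * (R / (degree - 1)) ≤ R`, so the field has at most `2M(R
+ k)` elements. In the square, `R ^ 2 * 2 ^ k` is controlled by the case assumption and `k ^ 2 * 2 ^
k` by `2 ^ k < M`. -/
theorem biasSize_le (hn : 2 ≤ n) (hk : 1 ≤ k) (hM : 2 ^ k < M)
    (h : n.size * 2 ^ k ≤ k ^ 3 * M) :
    biasSize n k M * 2 ^ k ≤ 16 * (k ^ 3 * n.size * M ^ 3) := by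
  set R := n.size with hR
  have hR1 : 1 ≤ R := Nat.size_pos.2 (by omega)
  have hM' : M ≤ k * M := Nat.le_mul_of_pos_left _ hk
  have hdk : k < biasDeg n k M := lt_degree (hM.le.trans hM')
  have hM0 : 0 < M := Nat.zero_lt_of_lt hM
  have hq : 2 ^ biasDeg n k M ≤ 2 * M * (R + k) := by
    refine (two_pow_degree_le' (hM0.trans_le hM') _).trans ?_
    have : k * (R / (biasDeg n k M - 1)) ≤ R :=
      (Nat.mul_le_mul_right _ (by omega)).trans (Nat.mul_div_le R (biasDeg n k M - 1))
    calc 2 * (k * M * (R / (biasDeg n k M - 1) + 1)) =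
          2 * M * (k * (R / (biasDeg n k M - 1)) + k) := by ring
      _ ≤ _ := Nat.mul_le_mul_left _ (by omega)
  have h1 : (R + k) ^ 2 * 2 ^ k ≤ 4 * (k ^ 3 * R * M) := by
    have e1 : (R + k) ^ 2 ≤ 2 * R ^ 2 + 2 * k ^ 2 := by
      zify; nlinarith [sq_nonneg ((R : ℤ) - k)]
    have e2 : R ^ 2 * 2 ^ k ≤ k ^ 3 * R * M := by
      calc R ^ 2 * 2 ^ k = R * (R * 2 ^ k) := by ring
        _ ≤ R * (k ^ 3 * M) := Nat.mul_le_mul_left _ h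
        _ = _ := by ring
    have e3 : k ^ 2 * 2 ^ k ≤ k ^ 3 * R * M := by
      refine Nat.mul_le_mul ?_ hM.le
      calc k ^ 2 ≤ k ^ 3 := Nat.pow_le_pow_right hk (by norm_num)
        _ ≤ k ^ 3 * R := Nat.le_mul_of_pos_right _ hR1
    calc (R + k) ^ 2 * 2 ^ k ≤ (2 * R ^ 2 + 2 * k ^ 2) * 2 ^ k := Nat.mul_le_mul_right _ e1
      _ = 2 * (R ^ 2 * 2 ^ k) + 2 * (k ^ 2 * 2 ^ k) := by ring
      _ ≤ _ := by omega
  calc biasSize n k M * 2 ^ k ≤ (2 * M * (R + k)) * (2 * M * (R + k)) * 2 ^ k :=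
        Nat.mul_le_mul_right _ (Nat.mul_le_mul hq hq)
    _ = 4 * M ^ 2 * ((R + k) ^ 2 * 2 ^ k) := by ring
    _ ≤ 4 * M ^ 2 * (4 * (k ^ 3 * R * M)) := Nat.mul_le_mul_left _ h1
    _ = _ := by ring

theorem abs_card_biasTable_sub_le (hn : 2 ≤ n) (hk : 1 ≤ k) (hM : 2 ^ k < M) {I : Fin k → ℕ}
    (hI : Function.Injective I) (hI' : ∀ j, I j < n) (ξ : Fin k → ℕ) (hξ : ∀ j, ξ j < 2) :
    |(((Finset.range (biasSize n k M)).filter fun x =>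
      ∀ j, biasTable n k M x (I j) = ξ j).card : ℝ) - (biasSize n k M : ℝ) / 2 ^ k| ≤
      (biasSize n k M : ℝ) * (1 / M) := by
  have hM' : M ≤ k * M := Nat.le_mul_of_pos_left _ hk
  have hd : k < biasDeg n k M := lt_degree (hM.le.trans hM')
  have h := abs_card_biasBit_sub_le (R := n.size) (r := biasDeg n k M)
    (e := n.size / biasDeg n k M + 1) (Nat.size_pos.2 (by omega)) (by omega)
    (le_succ_div_mul _ _ (by omega)) hI (fun j => (hI' j).trans (Nat.lt_size_self n)) ξ hξ
  have hMR : (0 : ℝ) < M := by exact_mod_cast Nat.zero_lt_of_lt hM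
  have hS : (biasSize n k M : ℝ) = (2 ^ biasDeg n k M) ^ 2 := by
    simp [biasSize, sq]
  rw [hS]
  refine h.trans ?_
  have h1 : ((k * (n.size / biasDeg n k M + 1) : ℕ) : ℝ) * M ≤ 2 ^ biasDeg n k M := by
    have := (lt_two_pow_degree (k * M) n.size).le
    have : k * (n.size / biasDeg n k M + 1) * M ≤ 2 ^ biasDeg n k M := by
      refine le_trans (le_of_eq ?_) this
      rw [biasDeg]
      ring
    exact_mod_cast this
  rw [← le_div_iff₀ hMR] at h1
  calc _ ≤ (2 : ℝ) ^ biasDeg n k M * (2 ^ biasDeg n k M / M) := by gcongr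
    _ = _ := by ring

end small_bias

section greedy

variable (n k M : ℕ)

/-- The degree of the field of the hash functions. -/
noncomputable def hashDeg : ℕ := degree (2 * k ^ 2 * M) n.size

/-- The parameter of the weights. -/
def rate : ℕ := 4 * (M / 2 ^ k + 1)

/-- The number of points that are selected. -/
noncomputable def numPoints : ℕ := 128 * (k * hashDeg n k M * (M ^ 2 / 2 ^ k + 1))

/-- The size of the hashed sample space. -/
noncomputable def hashSize : ℕ := 2 ^ hashDeg n k M * numPoints n k M

/-- The entries of the hashed sample space. -/
noncomputable def hashTable (c : ℕ → ℕ) (x i : ℕ) : ℕ :=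
  hashBit (hashDeg n k M) (n.size / hashDeg n k M + 1) k (numPoints n k M) c x i

variable {n k M}

theorem lt_hashDeg (hk : 1 ≤ k) (hM : 2 ^ k < M) : k < hashDeg n k M :=
  lt_degree (hM.le.trans (Nat.le_mul_of_pos_left _ (by positivity)))

theorem two_pow_hashDeg_le (hk : 1 ≤ k) (hM : 2 ^ k < M) :
    2 ^ hashDeg n k M ≤ 4 * (k ^ 2 * M) * (n.size / (hashDeg n k M - 1) + 1) :=
  (two_pow_degree_le' (Nat.mul_pos (by positivity) (Nat.zero_lt_of_lt hM)) n.size).trans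
    (le_of_eq (by rw [hashDeg]; ring))

theorem cube_lt_size (hM : 2 ^ k < M) (h : k ^ 3 * M < n.size * 2 ^ k) : k ^ 3 < n.size :=
  Nat.lt_of_mul_lt_mul_right ((Nat.mul_le_mul_left _ hM.le).trans_lt h)

theorem hashDeg_le_log (hk : 1 ≤ k) (hM : 2 ^ k < M) (h : k ^ 3 * M < n.size * 2 ^ k) :
    hashDeg n k M ≤ 2 + 2 * n.size.size + k := by
  set R := n.size with hR
  have h1 : k ^ 2 * M ≤ R * 2 ^ k :=
    (Nat.mul_le_mul_right _ (Nat.pow_le_pow_right hk (by norm_num))).trans h.le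
  have hm := Nat.lt_size_self R
  refine (Nat.pow_le_pow_iff_right (by norm_num : 1 < 2)).1 ?_
  calc 2 ^ hashDeg n k M ≤ 4 * (k ^ 2 * M) * (R / (hashDeg n k M - 1) + 1) :=
        two_pow_hashDeg_le hk hM
    _ ≤ 4 * (R * 2 ^ k) * (R + 1) := by
        gcongr
        exact Nat.div_le_self _ _
    _ ≤ 4 * (2 ^ R.size * 2 ^ k) * 2 ^ R.size := by
        gcongr
        exact hm
    _ = 2 ^ (2 + 2 * R.size + k) := by ring

theorem hashDeg_le (hk : 1 ≤ k) (hM : 2 ^ k < M) (h : k ^ 3 * M < n.size * 2 ^ k) :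
    hashDeg n k M ≤ 5 * n.size := by
  have h1 := hashDeg_le_log hk hM h
  have h2 := RAM.size_le_self n.size
  have h3 := cube_lt_size hM h
  have h4 : k ≤ k ^ 3 := Nat.le_self_pow (by norm_num) k
  omega

theorem sq_le_two_mul_two_pow (m : ℕ) : m ^ 2 ≤ 2 * 2 ^ m := by
  induction m with
  | zero => norm_num
  | succ m ih =>
    rcases Nat.lt_or_ge m 3 with h | h
    · interval_cases m <;> norm_num
    · have : 2 * m + 1 ≤ m ^ 2 := by nlinarith
      rw [pow_succ 2 m]
      nlinarith

/-- This makes the greedy search feasible. With `m = R.size` the exponent is at most `2k + 2mk +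
k²`, and `m² ≤ 2 * 2 ^ m ≤ 4R` together with `k ^ 3 < R` bounds it by `8R`. -/
theorem pow_hashDeg_le (hn : 2 ≤ n) (hk : 1 ≤ k) (hM : 2 ^ k < M)
    (h : k ^ 3 * M < n.size * 2 ^ k) : (2 ^ hashDeg n k M) ^ k ≤ (2 * n) ^ 8 := by
  set R := n.size with hR
  have hR1 : 1 ≤ R := Nat.size_pos.2 (by omega)
  have h1 := hashDeg_le_log hk hM h
  rw [← hR] at h1
  have h3 := cube_lt_size hM h
  set m := R.size with hm
  have hm1 : 1 ≤ m := Nat.size_pos.2 hR1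
  have hm2 : 2 ^ m ≤ 2 * R := by
    have : 2 ^ (m - 1) ≤ R := Nat.lt_size.1 (by omega)
    calc 2 ^ m = 2 ^ (m - 1) * 2 := by rw [← pow_succ]; congr 1; omega
      _ ≤ _ := by omega
  have hn2 : 2 ^ R ≤ 2 * n := by
    have : 2 ^ (R - 1) ≤ n := Nat.lt_size.1 (by omega)
    calc 2 ^ R = 2 ^ (R - 1) * 2 := by rw [← pow_succ]; congr 1; omega
      _ ≤ _ := by omega
  have hm3 := sq_le_two_mul_two_pow m
  have hk2 : k ^ 2 ≤ k ^ 3 := Nat.pow_le_pow_right hk (by norm_num)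
  have hk1 : k ≤ k ^ 2 := Nat.le_self_pow (by norm_num) k
  have hmk : 2 * (m * k) ≤ m ^ 2 + k ^ 2 := by
    zify; nlinarith [sq_nonneg ((m : ℤ) - k)]
  have hexp : hashDeg n k M * k ≤ R * 8 := by
    calc hashDeg n k M * k ≤ (2 + 2 * m + k) * k := Nat.mul_le_mul_right _ h1
      _ = 2 * k + 2 * (m * k) + k ^ 2 := by ring
      _ ≤ R * 8 := by omega
  calc (2 ^ hashDeg n k M) ^ k = 2 ^ (hashDeg n k M * k) := (pow_mul _ _ _).symm
    _ ≤ 2 ^ (R * 8) := Nat.pow_le_pow_right two_pos hexp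
    _ = (2 ^ R) ^ 8 := pow_mul _ _ _
    _ ≤ (2 * n) ^ 8 := Nat.pow_le_pow_left hn2 8

/-- The factor `d` in the number of points is absorbed by the quotient `R / (d - 1)` in the field
size: `d * (R / (d - 1) + 1) ≤ 7R`, using `d ≤ 5R`. -/
theorem hashSize_le (hk : 1 ≤ k) (hM : 2 ^ k < M) (h : k ^ 3 * M < n.size * 2 ^ k) :
    hashSize n k M * 2 ^ k ≤ 7168 * (k ^ 3 * n.size * M ^ 3) := by
  set R := n.size with hR
  set d := hashDeg n k M with hd
  have hdk : k < d := lt_hashDeg hk hM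
  have hN : numPoints n k M * 2 ^ k ≤ 256 * (k * d * M ^ 2) := by
    have e1 : M ^ 2 / 2 ^ k * 2 ^ k ≤ M ^ 2 := Nat.div_mul_le_self _ _
    have e2 : 2 ^ k ≤ M ^ 2 := hM.le.trans (Nat.le_self_pow (by norm_num) M)
    calc numPoints n k M * 2 ^ k = 128 * (k * d * (M ^ 2 / 2 ^ k * 2 ^ k + 2 ^ k)) := by
          rw [numPoints]; ring
      _ ≤ 128 * (k * d * (M ^ 2 + M ^ 2)) := by gcongr
      _ = _ := by ring
  have hdR : d * (R / (d - 1) + 1) ≤ 7 * R := by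
    have e1 : (d - 1) * (R / (d - 1)) ≤ R := Nat.mul_div_le _ _
    have e2 : d ≤ 5 * R := hashDeg_le hk hM h
    calc d * (R / (d - 1) + 1) = d * (R / (d - 1)) + d := by ring
      _ ≤ 2 * (d - 1) * (R / (d - 1)) + d := by
          gcongr; omega
      _ = 2 * ((d - 1) * (R / (d - 1))) + d := by ring
      _ ≤ _ := by omega
  calc hashSize n k M * 2 ^ k = 2 ^ d * (numPoints n k M * 2 ^ k) := by rw [hashSize]; ring
    _ ≤ (4 * (k ^ 2 * M) * (R / (d - 1) + 1)) * (256 * (k * d * M ^ 2)) :=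
        Nat.mul_le_mul (two_pow_hashDeg_le hk hM) hN
    _ = 1024 * (k ^ 3 * M ^ 3) * (d * (R / (d - 1) + 1)) := by ring
    _ ≤ 1024 * (k ^ 3 * M ^ 3) * (7 * R) := Nat.mul_le_mul_left _ hdR
    _ = _ := by ring

theorem numPoints_pos (hk : 1 ≤ k) (hM : 2 ^ k < M) : 0 < numPoints n k M := by
  have : 0 < hashDeg n k M := (Nat.zero_le k).trans_lt (lt_hashDeg hk hM)
  unfold numPoints
  positivity

theorem abs_card_hashTable_sub_le (hk : 1 ≤ k) (hM : 2 ^ k < M) {c : ℕ → ℕ}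
    (hc : ∀ j < numPoints n k M,
      c j = choice (hashDeg n k M) k (rate k M) (numPoints n k M) c j) {I : Fin k → ℕ}
    (hI : Function.Injective I) (hI' : ∀ j, I j < n) (ξ : Fin k → ℕ) (hξ : ∀ j, ξ j < 2) :
    |(((Finset.range (hashSize n k M)).filter fun x =>
      ∀ j, hashTable n k M c x (I j) = ξ j).card : ℝ) - (hashSize n k M : ℝ) / 2 ^ k| ≤
      (hashSize n k M : ℝ) * (1 / M) := by
  have hdk : k < hashDeg n k M := lt_hashDeg hk hM
  have hK : 0 < 2 ^ k := by positivity
  set d := hashDeg n k M with hd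
  set N := numPoints n k M with hN
  have hMR : (0 : ℝ) < M := by exact_mod_cast Nat.zero_lt_of_lt hM
  have hL : 4 * M ≤ rate k M * 2 ^ k := by
    have := (Nat.lt_mul_div_succ M hK).le
    calc 4 * M ≤ 4 * (2 ^ k * (M / 2 ^ k + 1)) := Nat.mul_le_mul_left _ this
      _ = _ := by rw [rate]; ring
  have hL' : rate k M * 2 ^ k ≤ 8 * M := by
    have := Nat.div_mul_le_self M (2 ^ k)
    calc rate k M * 2 ^ k = 4 * (M / 2 ^ k * 2 ^ k + 2 ^ k) := by rw [rate]; ring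
      _ ≤ _ := by omega
  -- The factor 128 in `numPoints` is `32 * 4`: the logarithm is at most the exponent `2 + k + d *
  -- k`, which is below `4 * (k * d)`.
  have hNE : Real.log (2 * numEvents d k) < N * 2 ^ k / (32 * (M : ℝ) ^ 2) := by
    have e1 : (2 * numEvents d k : ℝ) = 2 ^ (2 + k + d * k) := by
      simp only [numEvents]
      push_cast
      ring
    have e2 : 128 * (k * d) * M ^ 2 ≤ N * 2 ^ k := by
      have := (Nat.lt_mul_div_succ (M ^ 2) hK).le
      calc 128 * (k * d) * M ^ 2 ≤ 128 * (k * d) * (2 ^ k * (M ^ 2 / 2 ^ k + 1)) :=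
            Nat.mul_le_mul_left _ this
        _ = _ := by rw [hN, numPoints]; ring
    have e3 : (128 * (k * d) * M ^ 2 : ℝ) ≤ N * 2 ^ k := by exact_mod_cast e2
    have e4 : 2 + k + d * k < 4 * (k * d) := by nlinarith
    have e5 : ((2 + k + d * k : ℕ) : ℝ) < 4 * (k * d) := by exact_mod_cast e4
    rw [e1, Real.log_pow, lt_div_iff₀ (by positivity)]
    have e6 : Real.log 2 ≤ 1 := by
      have := Real.log_le_sub_one_of_pos (x := 2) (by norm_num)
      linarith
    calc ((2 + k + d * k : ℕ) : ℝ) * Real.log 2 * (32 * (M : ℝ) ^ 2) ≤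
          ((2 + k + d * k : ℕ) : ℝ) * 1 * (32 * (M : ℝ) ^ 2) := by gcongr
      _ < 4 * (k * d) * 1 * (32 * (M : ℝ) ^ 2) := by gcongr
      _ ≤ _ := by linarith
  have hq : 2 * (k ^ 2 * (n.size / d + 1)) * M ≤ 2 ^ d :=
    le_trans (le_of_eq (by rw [hd, hashDeg]; ring)) (lt_two_pow_degree (2 * k ^ 2 * M) n.size).le
  have h := abs_card_hashBit_sub_le (r := d) (e := n.size / d + 1) (by omega)
    (numPoints_pos hk hM) hM.le hL hL' hNE hc hq hI (fun j => (hI' j).trans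
      ((Nat.lt_size_self n).trans_le (by
        rw [← pow_mul, mul_comm d]
        exact Nat.pow_le_pow_right two_pos (le_succ_div_mul _ _ (by omega))))) hξ
  have hS : (hashSize n k M : ℝ) = 2 ^ d * N := by
    simp [hashSize, hd, hN]
  rw [hS, mul_one_div]
  exact h

end greedy

namespace RAM

open Ctx

/-! ### The parameters are computable -/

section

variable {α : Type} [Ctx α]

theorem PB.two_pow_degree {A R : α → ℕ} (hA : PB A) (hR : PB R) :
    PB fun a => 2 ^ degree (A a) (R a) :=
  (((PB.const 2).mul (hA.mul (hR.add (.const 1)))).add (.const 1)).mono fun a =>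
    (two_pow_degree_le _ _).trans (by gcongr; exact Nat.div_le_self _ _)

theorem Comp.degree {A R : α → ℕ} (hA : Comp A) (hR : Comp R) :
    Comp fun a => degree (A a) (R a) := by
  refine Comp.isLeast (p := fun a r => A a * (R a / r + 1) < 2 ^ r)
    (hA.mul (hR.add (.const 1))) ?_ (fun a => isLeast_degree _ _) fun a => degree_le _ _
  refine (((hA.weaken.mul ((hR.weaken.div .snd).add (.const 1))).div_pow (.const 2) .snd).eq
    (.const 0)).of_iff fun p => ?_
  rw [Nat.div_eq_zero_iff]
  simp

theorem PB.two_pow_size {n : α → ℕ} (hn : PB n) : PB fun a => 2 ^ (n a).size := by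
  refine (((PB.const 2).mul hn).add (.const 1)).mono fun a => ?_
  rcases Nat.eq_zero_or_pos (n a) with h | h
  · simp [h]
  · have h1 : 0 < (n a).size := Nat.size_pos.2 h
    have : 2 ^ ((n a).size - 1) ≤ n a := Nat.lt_size.1 (by omega)
    calc 2 ^ (n a).size = 2 ^ ((n a).size - 1) * 2 := by rw [← pow_succ]; congr 1; omega
      _ ≤ _ := by omega

variable {n k M : α → ℕ}

theorem Comp.biasDeg (hn : Comp n) (hk : Comp k) (hM : Comp M) :
    Comp fun a => biasDeg (n a) (k a) (M a) :=
  (hk.mul hM).degree hn.size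

theorem PB.two_pow_biasDeg (hn : Comp n) (hk : PB k) (hM : PB M) :
    PB fun a => 2 ^ biasDeg (n a) (k a) (M a) :=
  (hk.mul hM).two_pow_degree hn.size.bdd

theorem Comp.biasSize (hn : Comp n) (hk : Comp k) (hM : Comp M) :
    Comp fun a => biasSize (n a) (k a) (M a) :=
  have h := Comp.pow (.const 2) (hn.biasDeg hk hM) (PB.two_pow_biasDeg hn hk.bdd hM.bdd)
  h.mul h

theorem Comp.biasTable (hn : Comp n) (hk : Comp k) (hM : Comp M) {x i : α → ℕ} (hx : Comp x)
    (hi : Comp i) : Comp fun a => biasTable (n a) (k a) (M a) (x a) (i a) :=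
  Comp.biasBit hn.size hn.bdd.two_pow_size (hn.biasDeg hk hM)
    (PB.two_pow_biasDeg hn hk.bdd hM.bdd) ((hn.size.div (hn.biasDeg hk hM)).add (.const 1)) hk hx hi

theorem Comp.hashDeg (hn : Comp n) (hk : Comp k) (hM : Comp M) :
    Comp fun a => hashDeg (n a) (k a) (M a) :=
  ((((Comp.const 2).mul (hk.mul hk)).mul hM).degree hn.size).of_eq fun a => by
    rw [_root_.hashDeg, sq]

theorem PB.two_pow_hashDeg (hn : Comp n) (hk : PB k) (hM : PB M) :
    PB fun a => 2 ^ hashDeg (n a) (k a) (M a) :=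
  (((PB.const 2).mul (hk.pow 2)).mul hM).two_pow_degree hn.size.bdd

theorem Comp.greedyComp (hn : Comp n) (hk : Comp k) (hM : Comp M) (hk2 : PB fun a => 2 ^ k a)
    (hp : PB fun a => (2 ^ _root_.hashDeg (n a) (k a) (M a)) ^ k a) :
    GreedyComp (fun a => _root_.hashDeg (n a) (k a) (M a)) k (fun a => rate (k a) (M a))
      fun a => numPoints (n a) (k a) (M a) :=
  have h := Comp.pow (.const 2) hk hk2
  ⟨hn.hashDeg hk hM, hk, (Comp.const 4).mul ((hM.div h).add (.const 1)),
    ((Comp.const 128).mul ((hk.mul (hn.hashDeg hk hM)).mul (((hM.mul hM).div h).add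
      (.const 1)))).of_eq fun a => by rw [numPoints, sq],
    PB.two_pow_hashDeg hn hk.bdd hM.bdd, hk2, hp⟩

end

/-! ### Inputs -/

/-- Inputs `n, k, M` with a given property, together with bounded contents of array `1`. -/
structure Inp (p : ℕ → ℕ → ℕ → Prop) where
  /-- the length of the vectors -/
  n : ℕ
  /-- the number of positions -/
  k : ℕ
  /-- the inverse of the error -/
  M : ℕ
  /-- the contents of array number `1` -/
  cells : ℕ → ℕ
  /-- a bound for the contents of array number `1` -/
  bound : ℕ
  valid : p n k M
  cells_le : ∀ i, cells i ≤ bound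

instance (p : ℕ → ℕ → ℕ → Prop) : Ctx (Inp p) where
  len := 3
  enc a i := if i = 0 then a.n else if i = 1 then a.k else a.M
  arr a := a.cells
  sz a := a.n + a.k + a.M + a.bound
  enc_le a i _ := by split_ifs <;> omega
  arr_le a i := (a.cells_le i).trans (Nat.le_add_left _ _)

theorem Inp.sz_eq {p : ℕ → ℕ → ℕ → Prop} (a : Inp p) : sz a = a.n + a.k + a.M + a.bound := rfl

section

variable {p : ℕ → ℕ → ℕ → Prop}

theorem Comp.inp_n : Comp fun a : Inp p => a.n := by
  simpa [Ctx.enc] using Comp.reg (α := Inp p) (i := 0) (by simp [Ctx.len])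

theorem Comp.inp_k : Comp fun a : Inp p => a.k := by
  simpa [Ctx.enc] using Comp.reg (α := Inp p) (i := 1) (by simp [Ctx.len])

theorem Comp.inp_M : Comp fun a : Inp p => a.M := by
  simpa [Ctx.enc] using Comp.reg (α := Inp p) (i := 2) (by simp [Ctx.len])

end

/-- The general case. -/
def Valid (n k M : ℕ) : Prop := 2 ≤ n ∧ 1 ≤ k ∧ 2 ^ k < M

/-- The case in which the hashed sample space is used. -/
def ValidLarge (n k M : ℕ) : Prop := Valid n k M ∧ k ^ 3 * M < n.size * 2 ^ k

theorem PB.inp_two_pow_k {p : ℕ → ℕ → ℕ → Prop} (hp : ∀ n k M, p n k M → Valid n k M) :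
    PB fun a : Inp p => 2 ^ a.k :=
  Comp.inp_M.bdd.mono fun a => (hp _ _ _ a.valid).2.2.le

/-- The case condition is part of the context type, so the bound on the number of points is
available for every context considered. -/
theorem greedyComp_inp : GreedyComp (α := Inp ValidLarge) (fun a => hashDeg a.n a.k a.M)
    (fun a => a.k) (fun a => rate a.k a.M) fun a => numPoints a.n a.k a.M :=
  Comp.greedyComp .inp_n .inp_k .inp_M (PB.inp_two_pow_k fun _ _ _ h => h.1)
    ((((PB.const 2).mul Comp.inp_n.bdd).pow 8).mono fun a =>
      pow_hashDeg_le a.valid.1.1 a.valid.1.2.1 a.valid.1.2.2 a.valid.2)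

theorem comp_isLarge : CompP fun a : Inp Valid => a.k ^ 3 * a.M < a.n.size * 2 ^ a.k :=
  (((Comp.inp_k.mul (Comp.inp_k.mul Comp.inp_k)).mul .inp_M).lt (Comp.inp_n.size.mul
    (Comp.pow (.const 2) .inp_k (PB.inp_two_pow_k fun _ _ _ h => h)))).of_iff fun a => by
    rw [show a.k ^ 3 = a.k * (a.k * a.k) by ring]

/-! ### Filling an array -/

section

variable {α : Type} [Ctx α]

/-- A program that writes the values `f 0, f 1, …` into an array; the context may change in the
process. -/
theorem Comp.fill {f : α × ℕ → ℕ} (hf : Comp f) {cnt : α → ℕ} (hcnt : Comp cnt) (A : ℕ)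
    (x : ℕ → ℕ) (b : ℕ) (hx : ∀ i < len α, x i < b) :
    ∃ (P : Prog) (T : α → ℕ → ℕ), (∃ d, ∀ a Z, T a Z ≤ (sz a + Z + 2) ^ d) ∧
      ∀ (a : ℕ → α) (Z : ℕ) (s : State), Holds x (a 0) s →
        (∀ j ≤ cnt (a 0), sz (a j) ≤ Z) →
        (∀ j, ∀ i < len α, enc (a j) i = enc (a 0) i) →
        (∀ j < cnt (a 0), ∀ s' : State, s'.arr 1 = arr (a j) →
          (s'.setArr A j (f (a j, j))).arr 1 = arr (a (j + 1))) →
        Tri P s (T (a 0) Z) fun s' => Holds x (a (cnt (a 0))) s' ∧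
          (∀ r < b, s'.var r = s.var r) ∧ ∀ j < cnt (a 0), s'.arr A j = f (a j, j) := by
  obtain ⟨P, T, hT, hP⟩ := hcnt.run x b hx
  let y : ℕ → ℕ := fun j => if j < len α then x j else b + 1
  obtain ⟨P', T', ⟨d, hd⟩, hP'⟩ := hf.run y (b + 2) (by
    intro i hi
    by_cases h1 : i < len α
    · simp only [y, h1, if_true]; have := hx i h1; omega
    · simp [y, h1])
  obtain ⟨d', hd'⟩ := hf.bdd
  let U : α → ℕ := fun a => (cnt a + 1) + (cnt a + 1) + (cnt a + 1) * (cnt a + 1)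
  let V : α → ℕ → ℕ := fun a Z => (Z + cnt a + 2) ^ d + (cnt a + 1 + (2 * (Z + cnt a + 2) ^ d' + 1) +
    cnt a + 1 + ((cnt a + 1) + 2 + (cnt a + 1) * 2 + (cnt a + 1) + 1))
  refine ⟨.seq P (.seq (.assign (b + 1) (.lit 0))
    (.loop (.op .sub (.var b) (.var (b + 1)))
      (.seq P' (.seq (.store A (.var (b + 1)) (.var (b + 2)))
        (.assign (b + 1) (.op .add (.var (b + 1)) (.lit 1))))))),
    fun a Z => T a + (2 + (cnt a + 1) * (U a + 1 + V a Z)), ?_, fun a Z s hs hZ henc harr => ?_⟩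
  · have hc : PB fun q : α × ℕ => cnt q.1 := hcnt.bdd.weaken
    have hpow : ∀ e, PB fun q : α × ℕ => (q.2 + cnt q.1 + 2) ^ e := fun e =>
      ((PB.snd.add hc).add (.const 2)).pow e
    have hU : PB fun q : α × ℕ => U q.1 := ((hc.add (.const 1)).add (hc.add (.const 1))).add
      ((hc.add (.const 1)).mul (hc.add (.const 1)))
    have hV : PB fun q : α × ℕ => V q.1 q.2 := (hpow d).add ((((hc.add (.const 1)).add
      (((PB.const 2).mul (hpow d')).add (.const 1))).add hc).add (.const 1) |>.add
      (((((hc.add (.const 1)).add (.const 2)).add ((hc.add (.const 1)).mul (.const 2))).add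
        (hc.add (.const 1))).add (.const 1)))
    obtain ⟨e, he⟩ := hT.weaken.add ((PB.const 2).add ((hc.add (.const 1)).mul
      ((hU.add (.const 1)).add hV)))
    exact ⟨e, fun a Z => he (a, Z)⟩
  · refine (hP (a 0) s hs).seq fun s₁ h₁ => ?_
    have hs₁ := hs.congr hx h₁.2.1 h₁.2.2
    -- The context moves with the index: for `A = 1` the array being written is also the one that
    -- later values read.
    let Inv : ℕ → State → Prop := fun i s' => i ≤ cnt (a 0) ∧ s'.var b = cnt (a 0) ∧
      s'.var (b + 1) = i ∧ (∀ r < b, s'.var r = s.var r) ∧ s'.arr 1 = arr (a i) ∧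
      ∀ j < i, s'.arr A j = f (a j, j)
    have hhold : ∀ i s', Inv i s' → Holds x (a i) s' := fun i s' h =>
      ⟨fun j hj => by rw [h.2.2.2.1 _ (hx j hj), hs.1 j hj, henc i j hj], h.2.2.2.2.1⟩
    refine Tri.seq (Q := Inv 0) (.assign ?_ ?_) fun s₃ h₃ => ?_
    · simp [Expr.cost, Expr.val]
    · refine ⟨Nat.zero_le _, ?_, by simp [Expr.val], fun r hr => ?_, ?_, by simp⟩
      · rw [setVar_var_of_ne _ _ (by omega), h₁.1]
      · rw [setVar_var_of_ne _ _ (by omega), h₁.2.1 r hr]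
      · rw [setVar_arr, hs₁.2]
    · have cost_le : ∀ i ≤ cnt (a 0), (cnt (a 0)).size + 1 + (i.size + 1) +
          ((cnt (a 0)).size + 1) * (i.size + 1) ≤ U (a 0) := by
        intro i hi
        have h3 := size_le_self (cnt (a 0))
        have h4 := size_le_self i
        have := op_cost_le (cnt (a 0)) i (cnt (a 0)) le_rfl hi
        simp only [U]
        omega
      refine (Tri.loop (m := cnt (a 0)) (U := U (a 0)) (T := V (a 0) Z) Inv ?_ ?_ h₃).mono le_rfl ?_
      · intro i hi s' hI
        have hH := hhold i s' hI
        obtain ⟨-, e1, e2, e3, e4, e5⟩ := hI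
        refine ⟨?_, ?_, ?_⟩
        · simp only [Expr.val, Op.apply, e1, e2]; omega
        · simpa only [Expr.cost, Expr.val, e1, e2] using cost_le i hi.le
        · have hold : Holds y (a i, i) s' := by
            refine ⟨fun j hj => ?_, e4⟩
            by_cases h1 : j < len α
            · simpa [y, h1, Ctx.enc] using hH.1 j h1
            · simpa [y, h1, Ctx.enc] using e2
          have hsz : sz (a i, i) + 2 ≤ Z + cnt (a 0) + 2 := by
            have := hZ i hi.le
            rw [sz_prod]; simp only; omega
          have ht : T' (a i, i) ≤ (Z + cnt (a 0) + 2) ^ d :=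
            (hd _).trans (Nat.pow_le_pow_left hsz d)
          have hfv : f (a i, i) ≤ (Z + cnt (a 0) + 2) ^ d' :=
            (hd' _).trans (Nat.pow_le_pow_left hsz d')
          refine ((hP' _ s' hold).mono ht fun _ h => h).seq fun s₄ h₄ => ?_
          have f1 : s₄.var (b + 1) = i := (h₄.2.1 _ (by omega)).trans e2
          refine Tri.seq (Q := fun s'' => s'' = s₄.setArr A i (f (a i, i)))
            (.store ?_ ?_) fun s₅ h₅ => .assign ?_ ?_
          · simp only [Expr.cost, Expr.val, f1, h₄.1]
            have := size_le_self i
            have := size_le_self (f (a i, i))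
            show _ ≤ cnt (a 0) + 1 + (2 * (Z + cnt (a 0) + 2) ^ d' + 1) + cnt (a 0) + 1
            omega
          · simp only [Expr.val, f1, h₄.1]
          · have g1 : s₅.var (b + 1) = i := by rw [h₅]; exact f1
            simp only [Expr.cost, Expr.val, g1, Op.apply, Nat.size_one]
            have h3 := size_le_self i
            have h4 := size_le_self (i + 1)
            have : (i.size + 1) * (1 + 1) ≤ (cnt (a 0) + 1) * 2 := by omega
            omega
          · have hv : ∀ r < b + 2, s₅.var r = s'.var r := fun r hr => by rw [h₅]; exact h₄.2.1 r hr
            refine ⟨hi, ?_, ?_, fun r hr => ?_, ?_, fun j hj => ?_⟩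
            · rw [setVar_var_of_ne _ _ (by omega), hv _ (by omega), e1]
            · simp [Expr.val, Op.apply, hv _ (by omega : b + 1 < b + 2), e2]
            · rw [setVar_var_of_ne _ _ (by omega), hv _ (by omega), e3 r hr]
            · rw [setVar_arr, h₅]
              exact harr i hi s₄ (by rw [h₄.2.2, e4])
            · rw [setVar_arr, h₅]
              simp only [State.setArr, Function.update_self]
              rcases Nat.lt_succ_iff_lt_or_eq.1 hj with hj' | rfl
              · rw [Function.update_of_ne hj'.ne, h₄.2.2, e5 j hj']
              · rw [Function.update_self]
      · rintro s' ⟨-, e1, e2, -⟩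
        refine ⟨?_, ?_⟩
        · simp [Expr.val, Op.apply, e1, e2]
        · simpa only [Expr.cost, Expr.val, e1, e2] using cost_le _ le_rfl
      · intro s' hI
        exact ⟨hhold _ _ hI, hI.2.2.2.1, hI.2.2.2.2.2⟩

end

end RAM

/-! ### Programs for the two constructions -/

namespace RAM

open Ctx

/-- The registers of the inputs `n, k, M`. -/
def inpReg (i : ℕ) : ℕ := if i = 0 then 0 else if i = 1 then 1 else 4

theorem inpReg_lt (i : ℕ) : inpReg i < 5 := by
  unfold inpReg; split_ifs <;> omega

theorem holds_inp {p : ℕ → ℕ → ℕ → Prop} (a : Inp p) (s : State) (hn : s.var 0 = a.n)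
    (hk : s.var 1 = a.k) (hM : s.var 4 = a.M) (ha : s.arr 1 = a.cells) : Holds inpReg a s := by
  refine ⟨fun i hi => ?_, ha⟩
  have hi' : i < 3 := hi
  interval_cases i <;> simpa [inpReg, Ctx.enc]

/-- The memory holds the table `g` with `S` rows of length `n` as the output. -/
def HoldsTable (n S : ℕ) (g : ℕ → ℕ → ℕ) (s : State) : Prop :=
  s.var 0 = S ∧ ∀ j < S * n, s.arr 0 j = g (j / n) (j % n)

theorem HoldsTable.outputs {n S : ℕ} {g : ℕ → ℕ → ℕ} {s : State} (hg : ∀ x i, g x i < 2)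
    (h : HoldsTable n S g s) : s.Outputs (rowList n S g) := by
  refine ⟨by rw [h.1, length_rowList], fun j i => ?_⟩
  have hj : (j : ℕ) < S := j.2.trans_eq (length_rowList n S g)
  have hi := i.2
  have hlt : (j : ℕ) * n + i < S * n := by
    calc (j : ℕ) * n + i < j * n + n := Nat.add_lt_add_left hi _
      _ = (j + 1) * n := by ring
      _ ≤ S * n := Nat.mul_le_mul_right _ hj
  have e1 : ((j : ℕ) * n + i) / n = j := by
    rw [mul_comm, Nat.mul_add_div (Nat.zero_lt_of_lt hi), Nat.div_eq_of_lt hi, add_zero]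
  have e2 : ((j : ℕ) * n + i) % n = i := by
    rw [mul_comm, Nat.mul_add_mod, Nat.mod_eq_of_lt hi]
  rw [h.2 _ hlt, e1, e2]
  have := hg j i
  have e : (rowList n S g).get j i = decide (g j i = 1) :=
    congrFun (List.get_ofFn (fun (x : Fin S) (i : Fin n) => decide (g x i = 1)) j) i
  rw [e]
  generalize g j i = y at this
  interval_cases y <;> rfl

/-- A program that writes a table with a computable number of rows. -/
theorem exists_table_prog {p : ℕ → ℕ → ℕ → Prop} {S : Inp p → ℕ} (hS : Comp S)
    {g : Inp p × ℕ → ℕ} (hg : Comp g) : ∃ (P : Prog) (T : Inp p → ℕ), PB T ∧ ∀ a s,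
      Holds inpReg a s → Tri P s (T a) fun s' => s'.var 0 = S a ∧
        ∀ j < S a * a.n, s'.arr 0 j = g (a, j) := by
  obtain ⟨P, T, ⟨d, hd⟩, hP⟩ := hg.fill (hS.mul .inp_n) 0 inpReg 5 fun i _ => inpReg_lt i
  obtain ⟨P', T', hT', hP'⟩ := hS.run inpReg 5 fun i _ => inpReg_lt i
  -- Variable 0 holds `n` during the computation, so the number of rows is put there last.
  refine ⟨.seq P (.seq P' (.assign 0 (.var 5))),
    fun a => (sz a + sz a + 2) ^ d + (T' a + (S a + 1 + S a + 1)),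
    (((PB.sz.add .sz).add (.const 2)).pow d).add (hT'.add (((hS.bdd.add (.const 1)).add
      hS.bdd).add (.const 1))), fun a s hs => ?_⟩
  refine ((hP (fun _ => a) (sz a) s hs (fun _ _ => le_rfl) (fun _ _ _ => rfl) fun j _ s' h => ?_).mono
    (hd a _) fun _ h => h).seq fun s₁ h₁ => (hP' a s₁ h₁.1).seq fun s₂ h₂ => .assign ?_ ⟨?_, ?_⟩
  · simpa [State.setArr] using h
  · simp only [Expr.cost, Expr.val, h₂.1]
    have := size_le_self (S a)
    omega
  · simp [Expr.val, h₂.1]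
  · rw [setVar_arr, h₂.2.2]
    exact h₁.2.2

theorem exists_bias_prog : ∃ (P : Prog) (T : Inp Valid → ℕ), PB T ∧ ∀ a s,
    Holds inpReg a s → Tri P s (T a)
      (HoldsTable a.n (biasSize a.n a.k a.M) (biasTable a.n a.k a.M)) :=
  exists_table_prog (Comp.inp_n.biasSize .inp_k .inp_M)
    (Comp.inp_n.weaken.biasTable Comp.inp_k.weaken Comp.inp_M.weaken
      (Comp.snd.div Comp.inp_n.weaken) (Comp.snd.mod Comp.inp_n.weaken))

/-- The points chosen by the greedy selection in the first `j` steps. -/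
noncomputable def greedySeq (r k L N : ℕ) (j : ℕ) : ℕ → ℕ :=
  Nat.rec (fun _ => 0) (fun j c => Function.update c j (choice r k L N c j)) j

theorem greedySeq_succ (r k L N j : ℕ) : greedySeq r k L N (j + 1) =
    Function.update (greedySeq r k L N j) j (choice r k L N (greedySeq r k L N j) j) := rfl

theorem greedySeq_le (r k L N j i : ℕ) : greedySeq r k L N j i ≤ (2 ^ r) ^ k := by
  induction j with
  | zero => exact Nat.zero_le _
  | succ j ih =>
    rw [greedySeq_succ, Function.update_apply]
    split_ifs
    · exact choice_le _ _ _ _ _ _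
    · exact ih

theorem greedySeq_apply {r k L N i j : ℕ} (h : i < j) : greedySeq r k L N j i =
    choice r k L N (greedySeq r k L N i) i := by
  induction j with
  | zero => omega
  | succ j ih =>
    rw [greedySeq_succ, Function.update_apply]
    split_ifs with h1
    · rw [h1]
    · exact ih (by omega)

/-- Later updates leave entry `i` alone, and the choice at `i` reads only entries before `i`. -/
theorem greedySeq_eq_choice {r k L N j i : ℕ} (h : i < j) : greedySeq r k L N j i =
    choice r k L N (greedySeq r k L N j) i := by
  rw [greedySeq_apply h]
  exact choice_congr _ _ _ _ fun m hm => by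
    rw [greedySeq_apply hm, greedySeq_apply (hm.trans h)]

/-- The input with the points chosen by the greedy selection in array number `1`. -/
noncomputable def greedyInp {n k M : ℕ} (h : ValidLarge n k M) (j : ℕ) : Inp ValidLarge where
  n := n
  k := k
  M := M
  cells := greedySeq (hashDeg n k M) k (rate k M) (numPoints n k M) j
  bound := (2 * n) ^ 8
  valid := h
  cells_le _ := (greedySeq_le _ _ _ _ _ _).trans (pow_hashDeg_le h.1.1 h.1.2.1 h.1.2.2 h.2)

theorem exists_hash_prog : ∃ (P : Prog) (d : ℕ), ∀ (n k M : ℕ) (s : State), ValidLarge n k M →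
    s.var 0 = n → s.var 1 = k → s.var 4 = M → s.arr 1 = (fun _ => 0) →
    Tri P s ((n + k + M + 2) ^ d) fun s' => ∃ c : ℕ → ℕ,
      (∀ j < numPoints n k M, c j = choice (hashDeg n k M) k (rate k M) (numPoints n k M) c j) ∧
      HoldsTable n (hashSize n k M) (hashTable n k M c) s' := by
  have hG := greedyComp_inp
  obtain ⟨P, T, ⟨d, hd⟩, hP⟩ := (hG.weaken.choice Comp.snd).fill hG.comp_N 1 inpReg 5
    fun i _ => inpReg_lt i
  obtain ⟨P', T', ⟨d', hd'⟩, hP'⟩ := exists_table_prog (S := fun a : Inp ValidLarge =>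
    hashSize a.n a.k a.M) (hG.two_pow_r.mul hG.comp_N) (hG.weaken.hashBit
      (e := fun p : Inp ValidLarge × ℕ => p.1.n.size / hashDeg p.1.n p.1.k p.1.M + 1)
      ((Comp.inp_n.weaken.size.div hG.weaken.comp_r).add (.const 1))
      (Comp.snd.div Comp.inp_n.weaken) (Comp.snd.mod Comp.inp_n.weaken))
  refine ⟨.seq P P', 18 * d + (17 * d' + 1), fun n k M s hv hn hk hM harr => ?_⟩
  let a : ℕ → Inp ValidLarge := greedyInp hv
  obtain ⟨X, hX⟩ : ∃ X, X = n + k + M + 2 := ⟨_, rfl⟩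
  rw [← hX]
  have hX2 : 2 ≤ X := by omega
  -- The cells are at most `(2 * n) ^ 8 ≤ X ^ 16`, which dominates the other parts of the size.
  have hsz : ∀ j, sz (a j) + 2 ≤ X ^ 17 := by
    intro j
    have e : (2 * n) ^ 8 ≤ X ^ 16 := by
      calc (2 * n) ^ 8 ≤ (X * X) ^ 8 := Nat.pow_le_pow_left (Nat.mul_le_mul hX2 (by omega)) 8
        _ = X ^ 16 := by ring
    have e1 : X ≤ X ^ 16 := Nat.le_self_pow (by norm_num) X
    have e2 : X ^ 16 * 2 ≤ X ^ 17 := by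
      rw [pow_succ X 16]; exact Nat.mul_le_mul_left _ hX2
    rw [Inp.sz_eq]
    show n + k + M + (2 * n) ^ 8 + 2 ≤ X ^ 17
    omega
  have hT1 : T (a 0) (sz (a 0)) ≤ X ^ (18 * d) := by
    refine (hd _ _).trans ?_
    rw [pow_mul]
    refine Nat.pow_le_pow_left ?_ d
    have e2 : X ^ 17 * 2 ≤ X ^ 18 := by
      rw [pow_succ X 17]; exact Nat.mul_le_mul_left _ hX2
    have := hsz 0
    omega
  have hT2 : ∀ j, T' (a j) ≤ X ^ (17 * d') := fun j => (hd' _).trans (by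
    rw [pow_mul]; exact Nat.pow_le_pow_left (hsz j) d')
  have hT : X ^ (18 * d) + X ^ (17 * d') ≤ X ^ (18 * d + (17 * d' + 1)) := by
    have e1 : X ^ (18 * d) ≤ X ^ (18 * d + 17 * d') := Nat.pow_le_pow_right (by omega) (by omega)
    have e2 : X ^ (17 * d') ≤ X ^ (18 * d + 17 * d') := Nat.pow_le_pow_right (by omega) (by omega)
    have e3 : X ^ (18 * d + 17 * d') * 2 ≤ X ^ (18 * d + (17 * d' + 1)) := by
      rw [← add_assoc, pow_succ]; exact Nat.mul_le_mul_left _ hX2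
    omega
  refine Tri.mono ?_ hT fun _ h => h
  refine ((hP a (sz (a 0)) s (holds_inp _ _ hn hk hM harr) (fun _ _ => le_rfl)
    (fun _ _ _ => rfl) fun j _ s' h => ?_).mono hT1 fun _ h => h).seq fun s₁ h₁ => ?_
  · simp only [State.setArr, Function.update_self, h]
    rfl
  · refine (hP' _ s₁ h₁.1).mono (hT2 _) fun s₂ h₂ =>
      ⟨greedySeq (hashDeg n k M) k (rate k M) (numPoints n k M) (numPoints n k M),
        fun j hj => greedySeq_eq_choice hj, h₂⟩

end RAM

/-! ### The complete program -/

namespace RAM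

open Ctx

/-- The inverse of the error, rounded up. -/
def invErr (num den : ℕ) : ℕ := (den + num - 1) / num

theorem le_mul_invErr {num : ℕ} (den : ℕ) (hnum : 0 < num) : den ≤ num * invErr num den := by
  have := Nat.lt_mul_div_succ (den + num - 1) hnum
  rw [mul_add, mul_one] at this
  unfold invErr
  omega

theorem invErr_mul_le (num den : ℕ) : invErr num den * num ≤ den + num - 1 :=
  Nat.div_mul_le_self _ _

/-- The expression for the inverse of the error, rounded up. -/
def invErrExpr : Expr :=
  .op .div (.op .sub (.op .add (.var 3) (.var 2)) (.lit 1)) (.var 2)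

theorem invErrExpr_val {s : State} {num den : ℕ} (h2 : s.var 2 = num) (h3 : s.var 3 = den) :
    invErrExpr.val s = invErr num den := by
  simp [invErrExpr, Expr.val, Op.apply, h2, h3, invErr]

/-- The numerator and denominator may be exponentially large, so this one expression is costed in
binary lengths; everything afterwards depends on them through `M` only. -/
theorem invErrExpr_cost_le {s : State} {num den : ℕ} (h2 : s.var 2 = num) (h3 : s.var 3 = den) :
    invErrExpr.cost s + (invErrExpr.val s).size + 1 ≤ 10 * (num.size + den.size + 3) ^ 2 := by
  obtain ⟨W, hW⟩ : ∃ W, W = num.size + den.size + 3 := ⟨_, rfl⟩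
  have hsum : (den + num).size + 2 ≤ W := by
    have : (den + num).size ≤ num.size + den.size + 1 := by
      rw [Nat.size_le]
      have h1 := Nat.lt_size_self num
      have h2 := Nat.lt_size_self den
      have h3 : 2 ^ num.size ≤ 2 ^ (num.size + den.size) :=
        Nat.pow_le_pow_right two_pos (by omega)
      have h4 : 2 ^ den.size ≤ 2 ^ (num.size + den.size) :=
        Nat.pow_le_pow_right two_pos (by omega)
      rw [pow_succ]
      omega
    omega
  have hdiff : (den + num - 1).size + 2 ≤ W :=
    le_trans (Nat.add_le_add_right (Nat.size_le_size (by omega)) 2) hsum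
  have hquot : (invErr num den).size + 2 ≤ W :=
    le_trans (Nat.add_le_add_right (Nat.size_le_size (Nat.div_le_self _ _)) 2) hdiff
  have p1 : (den.size + 1) * (num.size + 1) ≤ W ^ 2 := by
    rw [sq]; exact Nat.mul_le_mul (by omega) (by omega)
  have p2 : ((den + num).size + 1) * (1 + 1) ≤ W ^ 2 := by
    rw [sq]; exact Nat.mul_le_mul (by omega) (by omega)
  have p3 : ((den + num - 1).size + 1) * (num.size + 1) ≤ W ^ 2 := by
    rw [sq]; exact Nat.mul_le_mul (by omega) (by omega)
  have p4 : W * 3 ≤ W ^ 2 := by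
    rw [sq]; exact Nat.mul_le_mul_left _ (by omega)
  rw [invErrExpr_val h2 h3, ← hW]
  simp only [invErrExpr, Expr.cost, Expr.val, Op.apply, h2, h3, Nat.size_one]
  omega

/-- The memory presents an output for the length `n`, the number of positions `k` and the inverse
`M` of the error, which comes from the small-bias space or from the hashed sample space. -/
def Good (n k M : ℕ) (s : State) : Prop :=
  ∃ (S : ℕ) (g : ℕ → ℕ → ℕ), 0 < S ∧ (∀ x i, g x i < 2) ∧ HoldsTable n S g s ∧
    S * 2 ^ k ≤ 7168 * (k ^ 3 * n.size * M ^ 3) ∧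
    ∀ I : Fin k → ℕ, Function.Injective I → (∀ j, I j < n) → ∀ ξ : Fin k → ℕ, (∀ j, ξ j < 2) →
      |(((Finset.range S).filter fun x => ∀ j, g x (I j) = ξ j).card : ℝ) - S / 2 ^ k| ≤
        S * (1 / M)

theorem good_of_biasTable {n k M : ℕ} (h : Valid n k M) (hs : ¬ k ^ 3 * M < n.size * 2 ^ k)
    {s : State} (ht : HoldsTable n (biasSize n k M) (biasTable n k M) s) : Good n k M s :=
  ⟨_, _, by unfold biasSize; positivity, fun _ _ => Nat.mod_lt _ two_pos, ht,
    (biasSize_le h.1 h.2.1 h.2.2 (not_lt.1 hs)).trans (Nat.mul_le_mul_right _ (by norm_num)),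
    fun _ hI hI' ξ hξ => abs_card_biasTable_sub_le h.1 h.2.1 h.2.2 hI hI' ξ hξ⟩

theorem good_of_hashTable {n k M : ℕ} (h : ValidLarge n k M) {c : ℕ → ℕ}
    (hc : ∀ j < numPoints n k M,
      c j = choice (hashDeg n k M) k (rate k M) (numPoints n k M) c j)
    {s : State} (ht : HoldsTable n (hashSize n k M) (hashTable n k M c) s) : Good n k M s :=
  ⟨_, _, Nat.mul_pos (by positivity) (numPoints_pos h.1.2.1 h.1.2.2),
    fun _ _ => Nat.mod_lt _ two_pos, ht, hashSize_le h.1.2.1 h.1.2.2 h.2,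
    fun _ hI hI' ξ hξ => abs_card_hashTable_sub_le h.1.2.1 h.1.2.2 hc hI hI' ξ hξ⟩

/-- The input without contents of array number `1`. -/
def plainInp {n k M : ℕ} (h : Valid n k M) : Inp Valid where
  n := n
  k := k
  M := M
  cells _ := 0
  bound := 0
  valid := h
  cells_le _ := le_rfl

/-- A genuine branch replaces `Comp.ite`, since the hashing program has its polynomial time bound
only in the large case. -/
theorem exists_main_prog : ∃ (P : Prog) (d : ℕ), ∀ (n k M : ℕ) (s : State), Valid n k M →
    s.var 0 = n → s.var 1 = k → s.var 4 = M → s.arr 1 = (fun _ => 0) →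
    Tri P s ((n + k + M + 2) ^ d) (Good n k M) := by
  obtain ⟨f, hf, hf'⟩ := comp_isLarge
  obtain ⟨P₀, T₀, hT₀, hP₀⟩ := hf.run inpReg 5 fun i _ => inpReg_lt i
  obtain ⟨P₁, T₁, hT₁, hP₁⟩ := exists_bias_prog
  obtain ⟨P₂, d₂, hP₂⟩ := exists_hash_prog
  obtain ⟨d, hd⟩ := hT₀.add ((hf.bdd.add (.const 2)).add (hT₁.add
    ((PB.sz.add (.const 2)).pow d₂)))
  refine ⟨.seq P₀ (.cond (.var 5) P₂ P₁), d, fun n k M s hv hn hk hM harr => ?_⟩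
  have ha := holds_inp (plainInp hv) s hn hk hM harr
  have hd' := hd (plainInp hv)
  have hsz : sz (plainInp hv) + 2 = n + k + M + 2 := rfl
  rw [hsz] at hd'
  refine Tri.mono ((hP₀ _ s ha).seq (Q' := Good n k M)
    (T₂ := f (plainInp hv) + 2 + (T₁ (plainInp hv) + (n + k + M + 2) ^ d₂))
    fun s₁ h₁ => ?_) hd' fun _ h => h
  have hcost : (Expr.var 5).cost s₁ + 1 ≤ f (plainInp hv) + 2 := by
    simp only [Expr.cost, h₁.1]
    have := size_le_self (f (plainInp hv))
    omega
  by_cases h0 : f (plainInp hv) = 0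
  · have hsmall : ¬ k ^ 3 * M < n.size * 2 ^ k := fun h => (hf' (plainInp hv)).2 h h0
    obtain ⟨t, s', hr, ht, hq⟩ := hP₁ (plainInp hv) s₁
      (ha.congr (fun i _ => inpReg_lt i) h₁.2.1 h₁.2.2)
    exact ⟨_, s', .cond_false (by simpa [Expr.val, h₁.1] using h0) hr, by omega,
      good_of_biasTable hv hsmall hq⟩
  · have hlarge : k ^ 3 * M < n.size * 2 ^ k := (hf' (plainInp hv)).1 h0
    obtain ⟨t, s', hr, ht, c, hc, hq⟩ := hP₂ n k M s₁ ⟨hv, hlarge⟩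
      (by rw [h₁.2.1 _ (by norm_num), hn]) (by rw [h₁.2.1 _ (by norm_num), hk])
      (by rw [h₁.2.1 _ (by norm_num), hM]) (by rw [h₁.2.2, harr])
    exact ⟨_, s', .cond_true (by simpa [Expr.val, h₁.1] using h0) hr, by omega,
      good_of_hashTable ⟨hv, hlarge⟩ hc hq⟩

theorem exists_prog : ∃ (P : Prog) (d : ℕ), ∀ (n k num den : ℕ), 0 < num →
    Valid n k (invErr num den) →
    Tri P (State.init [n, k, num, den]) (10 * (num.size + den.size + 3) ^ 2 +
      (n + k + invErr num den + 2) ^ d) (Good n k (invErr num den)) := by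
  obtain ⟨P, d, hP⟩ := exists_main_prog
  refine ⟨.seq (.assign 4 invErrExpr) P, d, fun n k num den hnum hv => ?_⟩
  have h2 : (State.init [n, k, num, den]).var 2 = num := rfl
  have h3 : (State.init [n, k, num, den]).var 3 = den := rfl
  refine Tri.seq (Q := fun s => s = (State.init [n, k, num, den]).setVar 4 (invErr num den))
    (.assign (invErrExpr_cost_le h2 h3) (by rw [invErrExpr_val h2 h3])) fun s hs => ?_
  subst hs
  refine hP n k _ _ hv ?_ ?_ (setVar_var_self _ _ _) rfl
  · rw [setVar_var_of_ne _ _ (by norm_num)]; rfl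
  · rw [setVar_var_of_ne _ _ (by norm_num)]; rfl

end RAM

/-- One factor 2 comes from `n.size ≤ 2 * (n.size - 1)`, the other from `log 2 ≥ 1/2`. -/
theorem size_le_four_mul_log {n : ℕ} (hn : 2 ≤ n) : (n.size : ℝ) ≤ 4 * Real.log n := by
  have h2 : 2 ≤ n.size := Nat.lt_size.2 (by simpa using hn)
  have h : 2 ^ (n.size - 1) ≤ n := Nat.lt_size.1 (by omega)
  have h' : (2 : ℝ) ^ (n.size - 1) ≤ n := by exact_mod_cast h
  have hlog := Real.log_le_log (by positivity) h'
  rw [Real.log_pow] at hlog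
  have hl : (1 : ℝ) / 2 ≤ Real.log 2 := by
    have := Real.log_two_gt_d9
    linarith
  have hs : (n.size : ℝ) ≤ 2 * ((n.size - 1 : ℕ) : ℝ) := by
    exact_mod_cast (by omega : n.size ≤ 2 * (n.size - 1))
  have : ((n.size - 1 : ℕ) : ℝ) * (1 / 2) ≤ ((n.size - 1 : ℕ) : ℝ) * Real.log 2 := by gcongr
  linarith

theorem theorem14 :
    ∃ (C : ℝ) (c d : ℕ) (P : RAM.Prog),
      ∀ (n k : ℕ) (ε : ℚ), 2 ≤ n → 1 ≤ k → 0 < ε → ε < 1 / 2 ^ k →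
        ∃ (t : ℕ) (s : RAM.State) (L : List (Fin n → Bool)),
          RAM.Runs P (RAM.State.init [n, k, ε.num.natAbs, ε.den]) t s ∧
          s.Outputs L ∧
          (t : ℝ) ≤ c * (n + 1 / (ε : ℝ) + ε.num.natAbs.size + ε.den.size) ^ d ∧
          (L.length : ℝ) ≤ C * ((k : ℝ) ^ 3 * Real.log n / (2 ^ k * (ε : ℝ) ^ 3)) ∧
          IsAlmostKWiseIndepSet (ε : ℝ) k (L : Multiset (Fin n → Bool)) := by
  obtain ⟨P, d, hP⟩ := RAM.exists_prog
  -- Here `32 = 4 * 2 ^ 3` comes from `n.size ≤ 4 log n` and `M ≤ 2/ε`. In the time bound both bases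
  -- are at most `4 * X`, which gives `10 * 4 ^ 2 = 160` and `4 ^ d`.
  refine ⟨7168 * 32, 160 + 4 ^ d, d + 2, P, fun n k ε hn hk hε hεk => ?_⟩
  obtain ⟨num, hnum⟩ : ∃ num, num = ε.num.natAbs := ⟨_, rfl⟩
  obtain ⟨den, hden⟩ : ∃ den, den = ε.den := ⟨_, rfl⟩
  obtain ⟨M, hM⟩ : ∃ M, M = RAM.invErr num den := ⟨_, rfl⟩
  rw [← hnum, ← hden]
  have hnum0 : 0 < num := by
    rw [hnum]; exact Int.natAbs_pos.2 (Rat.num_pos.2 hε).ne'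
  have hden0 : 0 < den := hden ▸ ε.den_pos
  have hεR : (ε : ℝ) = num / den := by
    have h1 : ((num : ℤ)) = ε.num := by
      rw [hnum]; exact Int.natAbs_of_nonneg (Rat.num_pos.2 hε).le
    have h2 : ((num : ℤ) : ℝ) = (ε.num : ℝ) := by rw [h1]
    rw [hden, Rat.cast_def, ← h2]
    simp
  have hε0 : (0 : ℝ) < ε := by exact_mod_cast hε
  have hnumR : (0 : ℝ) < num := by exact_mod_cast hnum0
  have hdenR : (0 : ℝ) < den := by exact_mod_cast hden0
  have hεk' : (ε : ℝ) < 1 / 2 ^ k := by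
    have : ((ε : ℚ) : ℝ) < ((1 / 2 ^ k : ℚ) : ℝ) := by exact_mod_cast hεk
    simpa using this
  have hMle := RAM.le_mul_invErr den hnum0
  have hMge := RAM.invErr_mul_le num den
  rw [← hM] at hMle hMge
  have hkM : 2 ^ k < M := by
    rw [hεR, div_lt_div_iff₀ hdenR (by positivity), one_mul] at hεk'
    have h1 : num * 2 ^ k < den := by exact_mod_cast hεk'
    exact Nat.lt_of_mul_lt_mul_left (h1.trans_le hMle)
  have hM0 : (0 : ℝ) < M := by exact_mod_cast Nat.zero_lt_of_lt hkM
  have hMinv : 1 / (M : ℝ) ≤ ε := by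
    rw [hεR, div_le_div_iff₀ hM0 hdenR, one_mul]
    exact_mod_cast hMle
  have hεM : (M : ℝ) ≤ 1 / ε + 1 := by
    have h1 : M * num ≤ den + num := hMge.trans (Nat.sub_le _ _)
    have h2 : (M : ℝ) * num ≤ den + num := by exact_mod_cast h1
    rw [hεR, one_div_div, div_add_one hnumR.ne', le_div_iff₀ hnumR]
    exact h2
  have hK2 : (2 : ℝ) ≤ 2 ^ k := by
    calc (2 : ℝ) = 2 ^ 1 := by norm_num
      _ ≤ 2 ^ k := pow_le_pow_right₀ (by norm_num) hk
  -- As `k ≥ 1`, `ε` is below `1/2`, so rounding `1/ε` up costs at most a constant factor.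
  have hεinv : (2 : ℝ) ≤ 1 / ε := by
    rw [le_div_iff₀ hε0]
    rw [lt_div_iff₀ (by positivity)] at hεk'
    nlinarith
  obtain ⟨t, s, hr, ht, S, g, hS, hg, hT, hsize, hind⟩ := hP n k num den hnum0
    (by rw [← hM]; exact ⟨hn, hk, hkM⟩)
  rw [← hM] at ht hsize hind
  refine ⟨t, s, rowList n S g, hr, hT.outputs hg, ?_, ?_, ?_⟩
  · obtain ⟨X, hX⟩ : ∃ X : ℝ, X = n + 1 / (ε : ℝ) + num.size + den.size := ⟨_, rfl⟩
    rw [← hX]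
    have hnR : (2 : ℝ) ≤ n := by exact_mod_cast hn
    have hsn : (0 : ℝ) ≤ num.size := by positivity
    have hsd : (0 : ℝ) ≤ den.size := by positivity
    have hX1 : 1 ≤ X := by linarith
    have hkM' : (k : ℝ) ≤ M := by
      exact_mod_cast (Nat.lt_two_pow_self (n := k)).le.trans hkM.le
    have e1 : ((num.size + den.size + 3 : ℕ) : ℝ) ≤ 4 * X := by push_cast; linarith
    have e2 : ((n + k + M + 2 : ℕ) : ℝ) ≤ 4 * X := by push_cast; linarith
    have ht' : (t : ℝ) ≤ 10 * ((num.size + den.size + 3 : ℕ) : ℝ) ^ 2 +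
        ((n + k + M + 2 : ℕ) : ℝ) ^ d := by exact_mod_cast ht
    have e3 : X ^ 2 ≤ X ^ (d + 2) := pow_le_pow_right₀ hX1 (by omega)
    have e4 : X ^ d ≤ X ^ (d + 2) := pow_le_pow_right₀ hX1 (by omega)
    calc (t : ℝ) ≤ 10 * (4 * X) ^ 2 + (4 * X) ^ d := ht'.trans (by gcongr)
      _ = 160 * X ^ 2 + 4 ^ d * X ^ d := by rw [mul_pow, mul_pow]; ring
      _ ≤ 160 * X ^ (d + 2) + 4 ^ d * X ^ (d + 2) := by gcongr
      _ = ((160 + 4 ^ d : ℕ) : ℝ) * X ^ (d + 2) := by push_cast; ring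
  · rw [length_rowList]
    have h1 : (S : ℝ) * 2 ^ k ≤ 7168 * (k ^ 3 * n.size * (M : ℝ) ^ 3) := by exact_mod_cast hsize
    have h2 : (M : ℝ) ≤ 2 * (1 / ε) := by linarith
    have h3 := size_le_four_mul_log hn
    have h4 : (S : ℝ) * 2 ^ k ≤ 7168 * (k ^ 3 * (4 * Real.log n) * (2 * (1 / (ε : ℝ))) ^ 3) :=
      h1.trans (by gcongr)
    rw [← le_div_iff₀ (by positivity)] at h4
    refine h4.trans (le_of_eq ?_)
    field_simp
    ring
  · refine isAlmostKWiseIndepSet_rowList hS hε0.le hg fun I hI hI' ξ hξ =>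
      (hind I hI hI' ξ hξ).trans ?_
    gcongr
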